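/- **Setting.** Let $\omega=e^{2\pi i/3}$, $\Lambda=\mathbb Z+\omega\mathbb Z$, $K=\tfrac43\pi$ and $\langle a,b\rangle=\operatorname{Re}(a\bar b)$ for $a,b\in\mathbb C$. Let $U,V\in C^\infty(\mathbb C;\mathbb C)$ satisfy, for all $z\in\mathbb C$ and $\gamma\in\Lambda$, $$U(z+\gamma)=e^{i\langle\gamma,K\rangle}U(z),\quad U(\omega z)=\omega U(z),\quad \overline{U(\bar z)}=-U(-z),$$ $$V(z+\gamma)=e^{i\langle\gamma,K\rangle}V(z),\quad V(\omega z)=V(z),\quad V(z)=V(\bar z)=\overline{V(-z)}.$$ Let $L^2_0$ be the space of $w\in L^2_{\rm loc}(\mathbb C;\mathbb C^4)$ with $\operatorname{diag}(\omega^{\gamma_1+\gamma_2},1,\omega^{\gamma_1+\gamma_2},1)\,w(z+\gamma)=w(z)$ for almost every $z$, for all $\gamma=\gamma_1+\omega\gamma_2\in\Lambda$ with $\gamma_1,\gamma_2\in\mathbb Z$. For $(\alpha,\lambda)\in\mathbb R^2$ and $k\in\mathbb C$ let $$H_k(\alpha,\lambda)=\begin{pmatrix}\lambda C & D(\alpha)^*+\bar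 k\\ D(\alpha)+k&\lambda C\end{pmatrix},\quad D(\alpha)=\begin{pmatrix}2D_{\bar z}&\alpha U(z)\\ \alpha U(-z)&2D_{\bar z}\end{pmatrix},\quad C=\begin{pmatrix}0&V(z)\\ \overline{V(z)}&0\end{pmatrix},$$ where $2D_{\bar z}=-i(\partial_x+i\partial_y)$, acting on $L^2_0$ with domain $H^1_{\rm loc}\cap L^2_0$. When $\dim\ker H_0(\alpha,\lambda)=2$, a *numbering of the bands* is a family $E_j(k)=E_j(\alpha,\lambda;k)$, $j\in\mathbb Z\setminus\{0\}$, $k\in\mathbb C$, of real numbers such that for each $k$ the sequence $\cdots\le E_{-2}(k)\le E_{-1}(k)\le E_1(k)\le E_2(k)\le\cdots$ lists the eigenvalues of $H_k(\alpha,\lambda)$ with multiplicity, $E_{\pm1}(0)=0$, and $E_1$ and $E_{-1}$ are continuous at $k=0$. **Proposition.** Let $\Omega\subset\mathbb R^2$ be open with $\dim\ker_{L^2_0}H_0(\alpha,\lambda)=2$ for all $(\alpha,\lambda)\in\Omega$. Then there is a real-analytic function $v_F:\Omega\to\mathbb R$ such that for every $(\alpha,\lambda)\in\Omega$ a numbering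 of the bands exists, and for every such numbering $$E_{\pm1}(\alpha,\lambda;k)=\pm|v_F(\alpha,\lambda)|\,|k|+O(|k|^2)\qquad(k\to0).$$ In particular, if $v_F(\alpha,\lambda)\ne0$, then the bands $E_{\pm1}$ have a conic singularity at $k=0$ at energy zero with slope $|v_F(\alpha,\lambda)|$: $E_{\pm1}(\alpha,\lambda;0)=0$ and $E_{\pm1}(\alpha,\lambda;k)/|k|\to\pm|v_F(\alpha,\lambda)|$ as $k\to0$, $k\neq 0$. -/

import Mathlib

open MeasureTheory Filter Topology Asymptotics
open scoped ContDiff ComplexConjugate Matrix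

namespace TBG

noncomputable section

/-! ### The moire lattice and the tunnelling potentials -/

/-- The primitive cube root of unity `ω = exp (2πi/3)`. -/
def omega : ℂ := Complex.exp (2 * Real.pi * Complex.I / 3)

/-- The point `γ = m + n ω` of the lattice `Λ = ℤ + ω ℤ`. -/
def latticePt (m n : ℤ) : ℂ := m + n * omega

/-- The real inner product `⟨a, b⟩ = Re (a * conj b)` on `ℂ`. -/
def pairing (a b : ℂ) : ℝ := (a * conj b).re

/-- The high symmetry momentum `K = 4π/3`. -/
def bigK : ℂ := 4 * Real.pi / 3

/-- Smooth tunnelling potentials `U`, `V` with the translation, rotation and reflection symmetries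
of the Bistritzer-MacDonald model. -/
structure IsTunnelling (U V : ℂ → ℂ) : Prop where
  smooth_U : ContDiff ℝ ∞ U
  smooth_V : ContDiff ℝ ∞ V
  U_translate : ∀ (m n : ℤ) (z : ℂ),
    U (z + latticePt m n) = Complex.exp (Complex.I * (pairing (latticePt m n) bigK : ℝ)) * U z
  U_rotate : ∀ z, U (omega * z) = omega * U z
  U_reflect : ∀ z, conj (U (conj z)) = -U (-z)
  V_translate : ∀ (m n : ℤ) (z : ℂ),
    V (z + latticePt m n) = Complex.exp (Complex.I * (pairing (latticePt m n) bigK : ℝ)) * V z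
  V_rotate : ∀ z, V (omega * z) = V z
  V_conj : ∀ z, V z = V (conj z)
  V_neg : ∀ z, V z = conj (V (-z))

/-! ### The function spaces -/

/-- Index set of the four components, as two blocks of two. -/
abbrev Idx : Type := Fin 2 ⊕ Fin 2

/-- Measurable functions `ℂ → ℂ⁴` modulo equality almost everywhere, written by components. -/
abbrev Spinor : Type := Idx → (ℂ →ₘ[(volume : Measure ℂ)] ℂ)

/-- Local square integrability. -/
def IsL2Loc (f : ℂ →ₘ[(volume : Measure ℂ)] ℂ) : Prop :=
  ∀ s : Set ℂ, IsCompact s → MemLp f 2 (volume.restrict s)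

/-- `g` is the weak derivative of `f` in the real direction `a` (`a = 1` gives `∂ₓ` and `a = I`
gives `∂_y`). It is only used for `f` and `g` that are locally square integrable. -/
def IsWeakDeriv (a : ℂ) (f g : ℂ →ₘ[(volume : Measure ℂ)] ℂ) : Prop :=
  ∀ φ : ℂ → ℂ, ContDiff ℝ ∞ φ → HasCompactSupport φ →
    ∫ z, f z * fderiv ℝ φ z a = -∫ z, g z * φ z

/-- The diagonal entries of the matrix `diag (ω^(m+n), 1, ω^(m+n), 1)`. -/
def layerPhase (m n : ℤ) : Idx → ℂ :=
  Sum.elim ![omega ^ (m + n), 1] ![omega ^ (m + n), 1]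

/-- Membership in `L²₀(ℂ/Λ; ℂ⁴)`: local square integrability, and invariance under the modified
translations `(𝓛_γ u)(z) = diag (ω^(m+n), 1, ω^(m+n), 1) u(z + γ)` for `γ = m + n ω`. -/
def MemL20 (u : Spinor) : Prop :=
  (∀ i, IsL2Loc (u i)) ∧
    ∀ (m n : ℤ) (i : Idx), ∀ᵐ z : ℂ, layerPhase m n i * u i (z + latticePt m n) = u i z

/-! ### The Bloch transformed Hamiltonian -/

/-- The zeroth order part of `D(α)`, without the factor `α`. -/
def matU (U : ℂ → ℂ) (z : ℂ) : Matrix (Fin 2) (Fin 2) ℂ := !![0, U z; U (-z), 0]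

/-- The matrix `C`. -/
def matC (V : ℂ → ℂ) (z : ℂ) : Matrix (Fin 2) (Fin 2) ℂ := !![0, V z; conj (V z), 0]

/-- The zeroth order part of `H_k(α, lam)`. -/
def zerothOrder (U V : ℂ → ℂ) (α lam : ℝ) (k z : ℂ) : Matrix Idx Idx ℂ :=
  Matrix.fromBlocks
    ((lam : ℂ) • matC V z)                               ((α : ℂ) • (matU U z)ᴴ + conj k • 1)
    ((α : ℂ) • matU U z + k • 1)                         ((lam : ℂ) • matC V z)

/-- The first order part of `H_k`, applied to the values `p = ∂ₓ u (z)` and `q = ∂_y u (z)`: the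
operator `2 D_z = -i (∂ₓ - i ∂_y)` stands in the upper right and `2 D_{z̄} = -i (∂ₓ + i ∂_y)` in the
lower left block. -/
def firstOrder (p q : Idx → ℂ) : Idx → ℂ :=
  Matrix.fromBlocks 0 1 0 0 *ᵥ ((-Complex.I) • (p - Complex.I • q)) +
    Matrix.fromBlocks 0 0 1 0 *ᵥ ((-Complex.I) • (p + Complex.I • q))

/-- The graph of the unbounded operator
`H_k(α, lam) = [[lam C, D(α)* + k̄], [D(α) + k, lam C]]` on `L²₀(ℂ/Λ; ℂ⁴)`: the function `u` lies in
the domain `H¹_loc ∩ L²₀` and `H_k(α, lam) u = f`. -/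
def IsImage (U V : ℂ → ℂ) (α lam : ℝ) (k : ℂ) (u f : Spinor) : Prop :=
  MemL20 u ∧ ∃ ux uy : Spinor,
    (∀ i, IsL2Loc (ux i) ∧ IsL2Loc (uy i) ∧
      IsWeakDeriv 1 (u i) (ux i) ∧ IsWeakDeriv Complex.I (u i) (uy i)) ∧
    ∀ᵐ z : ℂ, (fun i => f i z) =
      firstOrder (fun i => ux i z) (fun i => uy i z) +
        zerothOrder U V α lam k z *ᵥ (fun i => u i z)

lemma isL2Loc_zero : IsL2Loc 0 := fun _ _ =>
  (MemLp.ae_eq (ae_restrict_of_ae (AEEqFun.coeFn_zero (μ := (volume : Measure ℂ)) (β := ℂ)).symm)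
    (MemLp.zero' (p := 2)))

lemma IsL2Loc.add {f g} (hf : IsL2Loc f) (hg : IsL2Loc g) : IsL2Loc (f + g) := fun s hs =>
  MemLp.ae_eq (ae_restrict_of_ae (AEEqFun.coeFn_add f g).symm) ((hf s hs).add (hg s hs))

lemma IsL2Loc.smul {f} (c : ℂ) (hf : IsL2Loc f) : IsL2Loc (c • f) := fun s hs =>
  MemLp.ae_eq (ae_restrict_of_ae (AEEqFun.coeFn_smul c f).symm) ((hf s hs).const_smul c)

lemma IsL2Loc.locallyIntegrable {f} (hf : IsL2Loc f) :
    LocallyIntegrable (f : ℂ → ℂ) volume := by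
  rw [locallyIntegrable_iff]
  intro s hs
  have : IsFiniteMeasure ((volume : Measure ℂ).restrict s) :=
    ⟨by simpa using hs.measure_lt_top⟩
  exact (hf s hs).integrable (by norm_num)

lemma IsL2Loc.integrable_mul {f} (hf : IsL2Loc f) {φ : ℂ → ℂ} (h1 : Continuous φ)
    (h2 : HasCompactSupport φ) : Integrable (fun z => f z * φ z) := by
  have := hf.locallyIntegrable.integrable_smul_left_of_hasCompactSupport h1 h2
  simpa [mul_comm] using this

lemma continuous_fderiv_apply {φ : ℂ → ℂ} (h : ContDiff ℝ ∞ φ) (a : ℂ) :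
    Continuous fun z => fderiv ℝ φ z a :=
  (h.continuous_fderiv (by simp)).clm_apply continuous_const

lemma IsWeakDeriv.add {a f g f' g'} (hf : IsL2Loc f) (hf' : IsL2Loc f') (hg : IsL2Loc g)
    (hg' : IsL2Loc g') (h : IsWeakDeriv a f f') (h' : IsWeakDeriv a g g') :
    IsWeakDeriv a (f + g) (f' + g') := by
  intro φ hφ hc
  have hd := continuous_fderiv_apply hφ a
  have hdc : HasCompactSupport fun z => fderiv ℝ φ z a := hc.fderiv_apply ℝ a
  have e1 : ∫ z, (f + g) z * fderiv ℝ φ z a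
      = ∫ z, (f z * fderiv ℝ φ z a + g z * fderiv ℝ φ z a) := by
    refine integral_congr_ae ?_
    filter_upwards [AEEqFun.coeFn_add f g] with z hz
    rw [hz, Pi.add_apply, add_mul]
  have e2 : ∫ z, (f' + g') z * φ z = ∫ z, (f' z * φ z + g' z * φ z) := by
    refine integral_congr_ae ?_
    filter_upwards [AEEqFun.coeFn_add f' g'] with z hz
    rw [hz, Pi.add_apply, add_mul]
  rw [e1, e2, integral_add (hf.integrable_mul hd hdc) (hg.integrable_mul hd hdc),
    integral_add (hf'.integrable_mul hφ.continuous hc) (hg'.integrable_mul hφ.continuous hc),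
    h φ hφ hc, h' φ hφ hc]
  ring

lemma IsWeakDeriv.smul {a f f'} (c : ℂ) (h : IsWeakDeriv a f f') :
    IsWeakDeriv a (c • f) (c • f') := by
  intro φ hφ hc
  have e1 : ∫ z, (c • f) z * fderiv ℝ φ z a = ∫ z, c * (f z * fderiv ℝ φ z a) := by
    refine integral_congr_ae ?_
    filter_upwards [AEEqFun.coeFn_smul c f] with z hz
    rw [hz, Pi.smul_apply, smul_eq_mul, mul_assoc]
  have e2 : ∫ z, (c • f') z * φ z = ∫ z, c * (f' z * φ z) := by
    refine integral_congr_ae ?_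
    filter_upwards [AEEqFun.coeFn_smul c f'] with z hz
    rw [hz, Pi.smul_apply, smul_eq_mul, mul_assoc]
  rw [e1, e2, integral_const_mul, integral_const_mul, h φ hφ hc]
  ring

lemma ae_translate {P : ℂ → Prop} (γ : ℂ) (h : ∀ᵐ z : ℂ, P z) : ∀ᵐ z : ℂ, P (z + γ) :=
  (measurePreserving_add_right (volume : Measure ℂ) γ).quasiMeasurePreserving.ae h

lemma MemL20.add {u v} (hu : MemL20 u) (hv : MemL20 v) : MemL20 (u + v) := by
  refine ⟨fun i => (hu.1 i).add (hv.1 i), fun m n i => ?_⟩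
  have hc : ∀ᵐ z : ℂ, (u i + v i) z = u i z + v i z := AEEqFun.coeFn_add (u i) (v i)
  filter_upwards [hu.2 m n i, hv.2 m n i, hc, ae_translate (latticePt m n) hc] with z h1 h2 h3 h4
  rw [Pi.add_apply, h3, h4, mul_add, h1, h2]

lemma MemL20.smul {u} (c : ℂ) (hu : MemL20 u) : MemL20 (c • u) := by
  refine ⟨fun i => (hu.1 i).smul c, fun m n i => ?_⟩
  have hc : ∀ᵐ z : ℂ, (c • u i) z = c * u i z := AEEqFun.coeFn_smul c (u i)
  filter_upwards [hu.2 m n i, hc, ae_translate (latticePt m n) hc] with z h1 h3 h4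
  rw [Pi.smul_apply, h3, h4, mul_left_comm, h1]

lemma firstOrder_add (p q p' q' : Idx → ℂ) :
    firstOrder (p + p') (q + q') = firstOrder p q + firstOrder p' q' := by
  simp only [firstOrder, smul_add, smul_sub, Matrix.mulVec_add, Matrix.mulVec_sub]
  abel

lemma firstOrder_smul (c : ℂ) (p q : Idx → ℂ) :
    firstOrder (c • p) (c • q) = c • firstOrder p q := by
  simp only [firstOrder, smul_comm _ c, ← smul_sub, ← smul_add, Matrix.mulVec_smul]

lemma coe_add_ae (u v : Spinor) :
    ∀ᵐ z : ℂ, (fun i => (u + v) i z) = (fun i => u i z) + fun i => v i z := by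
  have : ∀ i, ∀ᵐ z : ℂ, (u i + v i) z = u i z + v i z := fun i => AEEqFun.coeFn_add (u i) (v i)
  filter_upwards [ae_all_iff.2 this] with z hz
  funext i
  exact hz i

lemma coe_smul_ae (c : ℂ) (u : Spinor) :
    ∀ᵐ z : ℂ, (fun i => (c • u) i z) = c • fun i => u i z := by
  have : ∀ i, ∀ᵐ z : ℂ, (c • u i) z = c * u i z := fun i => AEEqFun.coeFn_smul c (u i)
  filter_upwards [ae_all_iff.2 this] with z hz
  funext i
  exact hz i

lemma IsImage.add {U V α lam k u f u' f'} (h : IsImage U V α lam k u f)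
    (h' : IsImage U V α lam k u' f') : IsImage U V α lam k (u + u') (f + f') := by
  obtain ⟨hu, ux, uy, hd, he⟩ := h
  obtain ⟨hu', ux', uy', hd', he'⟩ := h'
  refine ⟨hu.add hu', ux + ux', uy + uy', fun i => ⟨(hd i).1.add (hd' i).1,
    (hd i).2.1.add (hd' i).2.1,
    IsWeakDeriv.add (hu.1 i) (hd i).1 (hu'.1 i) (hd' i).1 (hd i).2.2.1 (hd' i).2.2.1,
    IsWeakDeriv.add (hu.1 i) (hd i).2.1 (hu'.1 i) (hd' i).2.1 (hd i).2.2.2 (hd' i).2.2.2⟩, ?_⟩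
  filter_upwards [he, he', coe_add_ae u u', coe_add_ae f f', coe_add_ae ux ux',
    coe_add_ae uy uy'] with z h1 h2 h3 h4 h5 h6
  rw [h3, h4, h5, h6, h1, h2, firstOrder_add, Matrix.mulVec_add]
  abel

lemma IsImage.smul {U V α lam k u f} (c : ℂ) (h : IsImage U V α lam k u f) :
    IsImage U V α lam k (c • u) (c • f) := by
  obtain ⟨hu, ux, uy, hd, he⟩ := h
  refine ⟨hu.smul c, c • ux, c • uy, fun i => ⟨(hd i).1.smul c, (hd i).2.1.smul c,
    (hd i).2.2.1.smul c, (hd i).2.2.2.smul c⟩, ?_⟩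
  filter_upwards [he, coe_smul_ae c u, coe_smul_ae c f, coe_smul_ae c ux,
    coe_smul_ae c uy] with z h1 h3 h4 h5 h6
  rw [h3, h4, h5, h6, h1, firstOrder_smul, Matrix.mulVec_smul, smul_add]

lemma isImage_zero (U V : ℂ → ℂ) (α lam : ℝ) (k : ℂ) : IsImage U V α lam k 0 0 := by
  have hc : ∀ᵐ z : ℂ, (0 : ℂ →ₘ[(volume : Measure ℂ)] ℂ) z = 0 := AEEqFun.coeFn_zero
  have hw : ∀ a, IsWeakDeriv a 0 0 := by
    intro a φ _ _
    have e1 : ∫ z, (0 : ℂ →ₘ[(volume : Measure ℂ)] ℂ) z * fderiv ℝ φ z a = 0 := by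
      refine integral_eq_zero_of_ae ?_
      filter_upwards [hc] with z hz
      simp [hz]
    have e2 : ∫ z, (0 : ℂ →ₘ[(volume : Measure ℂ)] ℂ) z * φ z = 0 := by
      refine integral_eq_zero_of_ae ?_
      filter_upwards [hc] with z hz
      simp [hz]
    rw [e1, e2, neg_zero]
  refine ⟨⟨fun _ => isL2Loc_zero, fun m n i => ?_⟩, 0, 0,
    fun _ => ⟨isL2Loc_zero, isL2Loc_zero, hw _, hw _⟩, ?_⟩
  · filter_upwards [hc, ae_translate (latticePt m n) hc] with z h1 h2
    rw [Pi.zero_apply, h1, h2, mul_zero]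
  · filter_upwards [hc] with z hz
    have : (fun i : Idx => (0 : Spinor) i z) = 0 := funext fun _ => hz
    rw [this]
    simp [firstOrder]

/-- The eigenspace `ker (H_k(α, lam) - x)` in `L²₀(ℂ/Λ; ℂ⁴)`. -/
def eigenspace (U V : ℂ → ℂ) (α lam : ℝ) (k : ℂ) (x : ℝ) : Submodule ℂ Spinor where
  carrier := {u | IsImage U V α lam k u ((x : ℂ) • u)}
  zero_mem' := by simpa using isImage_zero U V α lam k
  add_mem' := fun hu hv => by
    have := IsImage.add hu hv
    change IsImage U V α lam k _ _
    rwa [smul_add]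
  smul_mem' := fun c u hu => by
    have := IsImage.smul c hu
    change IsImage U V α lam k _ _
    rwa [smul_comm]

/-! ### Bloch bands -/

/-- `E j k` for `j = ±1, ±2, …` is a numbering of the Bloch bands of `k ↦ H_k(α, lam)` by the
nonzero integers (the value at `j = 0` plays no role), when `H_0` has a kernel of dimension two:
for each `k` it lists all eigenvalues of `H_k`, repeated according to multiplicity, in
nondecreasing order. A list of this kind is determined up to a shift of the numbering for each
`k`; the shift is fixed at `k = 0` by `E_{±1}(0) = 0`, and near `k = 0` by continuity of the two
bands `E_{±1}` at `0`. -/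
structure IsBlochBands (U V : ℂ → ℂ) (α lam : ℝ) (E : ℤ → ℂ → ℝ) : Prop where
  mono : ∀ (k : ℂ) (i j : ℤ), i ≠ 0 → j ≠ 0 → i ≤ j → E i k ≤ E j k
  multiplicity : ∀ (k : ℂ) (x : ℝ),
    Cardinal.mk {j : ℤ // j ≠ 0 ∧ E j k = x} = Module.rank ℂ (eigenspace U V α lam k x)
  zero_pos : E 1 0 = 0
  zero_neg : E (-1) 0 = 0
  continuousAt_pos : ContinuousAt (E 1) 0
  continuousAt_neg : ContinuousAt (E (-1)) 0

/-- The two functions touch at `k = 0` at the value zero in a cone of slope `s > 0`. -/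
structure IsConicSingularity (Epos Eneg : ℂ → ℝ) (s : ℝ) : Prop where
  slope_pos : 0 < s
  zero_pos : Epos 0 = 0
  zero_neg : Eneg 0 = 0
  tendsto_pos : Tendsto (fun k => Epos k / ‖k‖) (𝓝[≠] 0) (𝓝 s)
  tendsto_neg : Tendsto (fun k => Eneg k / ‖k‖) (𝓝[≠] 0) (𝓝 (-s))

end

end TBG

/-!
The family `H_k(α, lam)` is a bounded self-adjoint perturbation of the free Dirac operator on the
torus `ℂ/Λ`, and the theorem is first order degenerate perturbation theory at the two-dimensional
kernel of `H_0(α, lam)`, with the symmetries of the bilayer determining the first order term.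

*The cone.* The Bloch momentum enters as `T k = conj k • J + k • J'`, where `J` moves the lower
block of components to the upper one and `J'` is its adjoint. The rotation `R` commutes with `H_0`,
and the reflection `Q` (complex conjugation of the position, combined with an exchange of the
blocks) anticommutes with it; moreover `R Q = ω² Q R²` and `R J = ω J R`. If the kernel contains a
vector `φ ≠ 0` with `R φ = φ`, then it is spanned by `φ` and `Q φ`, which are eigenvectors of `R`
for different eigenvalues. Comparing eigenvalues of `R`, all matrix elements of `J` in this basis
vanish except `⟨φ, J Q φ⟩`, which is real since `J Q` is symmetric. Hence the compression of `T k`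
to the kernel has the eigenvalues `± |v_F| |k|` with `v_F = ⟨φ, J Q φ⟩ / ⟨φ, φ⟩`. If there is no
such `φ`, then `R = ω` on the kernel, the compression vanishes, and `v_F = 0`. This is
`HoneycombFamily.kernel_form`. Since the remaining spectrum has a gap, the two eigenvalues near zero
differ from those of the compression by `O(|k|²)` (`EigenBasis.abs_le_of_lt`,
`EigenBasis.le_of_trial`, `HoneycombFamily.exists_cone_bounds`).

*Analyticity.* Near a given parameter the kernel is the image of the kernel at this parameter under
an analytic family of operators that commutes with `R`, because the dimension does not change. So
`φ`, and with it the quotient defining `v_F`, can be chosen real-analytic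
(`HoneycombFamily.analyticOnNhd_vF`).

*Numbering.* An operator with compact resolvent has a Hilbert basis of eigenvectors
(`exists_eigenBasis`). The free operator has infinitely many positive and negative eigenvalues, and
this persists under bounded perturbations, so that the eigenvalues can be listed in increasing order
by the integers; near `k = 0` the list is shifted so that the two eigenvalues near zero get the
numbers `-1` and `1` (`HoneycombFamily.exists_isBlochBands`). Any two numberings list the same
eigenvalues, which gives the statement for all of them (`HoneycombFamily.cone_of_isBlochBands`).

*Fourier series.* All this is carried out for an operator on square summable sequences. A
quasi-periodic function is a character of the plane times a function on the torus, and `synth`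
identifies `L²₀` with the sequences of Fourier coefficients. Testing against plane waves and
averaging over translations shows that weak derivatives act on the coefficients by multiplication
(`coeff_eq_of_weak`), and termwise integration by parts gives the converse (`weak_of_coeff`). The
free operator and the symmetries become weighted permutations of the Fourier modes, and their
commutation relations with the potential follow by comparing matrix elements
(`IsBlochPotential.op_wperm`). The outcome is that `synth` maps the eigenspaces of `moireFamily`
onto those of `H_k(α, lam)` (`eigenspace_eq_map`).
-/

/-! ### Self-adjoint operators with compact resolvent -/

namespace TBG

section Abstract

variable {E : Type*} [NormedAddCommGroup E] [InnerProductSpace ℂ E]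

/-- The graph of the unbounded operator `G⁻¹ + B`, for bounded operators `G` (injective) and `B`:
`u` lies in the range of `G` and `(G⁻¹ + B) u = f`. -/
def OpGraph (G B : E →L[ℂ] E) (u f : E) : Prop := u = G (f - B u)

namespace OpGraph

variable {G B : E →L[ℂ] E} {u f v g : E}

lemma add (h : OpGraph G B u f) (h' : OpGraph G B v g) : OpGraph G B (u + v) (f + g) := by
  unfold OpGraph at *
  rw [map_add, add_sub_add_comm, map_add, ← h, ← h']

lemma smul (c : ℂ) (h : OpGraph G B u f) : OpGraph G B (c • u) (c • f) := by
  unfold OpGraph at *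
  rw [map_smul, ← smul_sub, map_smul, ← h]

lemma zero : OpGraph G B 0 0 := by simp [OpGraph]

lemma sub (h : OpGraph G B u f) (h' : OpGraph G B v g) : OpGraph G B (u - v) (f - g) := by
  simpa [sub_eq_add_neg] using h.add (h'.smul (-1))

lemma sum {ι : Type*} (s : Finset ι) {u f : ι → E} (h : ∀ i ∈ s, OpGraph G B (u i) (f i)) :
    OpGraph G B (∑ i ∈ s, u i) (∑ i ∈ s, f i) := by
  classical
  induction s using Finset.induction_on with
  | empty => simpa using zero
  | insert a s ha ih =>
    rw [Finset.sum_insert ha, Finset.sum_insert ha]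
    exact (h a (by simp)).add (ih fun i hi => h i (by simp [hi]))

lemma add_right_iff (T : E →L[ℂ] E) : OpGraph G (B + T) u (f + T u) ↔ OpGraph G B u f := by
  simp [OpGraph]

lemma add_right (T : E →L[ℂ] E) (h : OpGraph G B u f) : OpGraph G (B + T) u (f + T u) :=
  (add_right_iff T).2 h

lemma of_add_right (T : E →L[ℂ] E) (h : OpGraph G (B + T) u f) : OpGraph G B u (f - T u) := by
  rw [← add_right_iff T]
  simpa using h

lemma neg (h : OpGraph G B u f) : OpGraph (-G) (-B) u (-f) := by
  unfold OpGraph at *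
  rw [neg_apply, neg_apply, ← map_neg]
  convert h using 2
  abel

/-- The operator `G⁻¹ + B` is symmetric. -/
lemma inner_comm (hG : (G : E →ₗ[ℂ] E).IsSymmetric) (hB : (B : E →ₗ[ℂ] E).IsSymmetric)
    (h : OpGraph G B u f) (h' : OpGraph G B v g) : inner ℂ u g = inner ℂ f v := by
  have h1 : inner ℂ u (g - B v) = inner ℂ (f - B u) v := by
    conv_lhs => rw [show u = G (f - B u) from h]
    conv_rhs => rw [show v = G (g - B v) from h']
    exact hG _ _
  have h2 : inner ℂ (B u) v = inner ℂ u (B v) := hB u v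
  rw [inner_sub_right, inner_sub_left, h2] at h1
  exact sub_left_injective h1

/-- An eigenvector for a real eigenvalue of bounded size is the image under `G` of a vector of
bounded size. -/
lemma exists_preimage {x M : ℝ} (hx : |x| ≤ M) (h : OpGraph G B u ((x : ℂ) • u))
    (hu : ‖u‖ = 1) : ∃ w, ‖w‖ ≤ M + ‖B‖ ∧ u = G w := by
  refine ⟨_, ?_, h⟩
  refine (norm_sub_le _ _).trans (add_le_add ?_ ?_)
  · rw [norm_smul, hu, mul_one, Complex.norm_real]
    exact hx
  · simpa [hu] using B.le_opNorm u

end OpGraph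

/-- A compact operator cannot map a bounded set onto an infinite orthonormal family. -/
lemma finite_of_orthonormal_of_compact {G : E →L[ℂ] E} (hG : IsCompactOperator G) {ι : Type*}
    {v : ι → E} (hv : Orthonormal ℂ v) (C : ℝ) (h : ∀ i, ∃ w, ‖w‖ ≤ C ∧ v i = G w) :
    Finite ι := by
  by_contra hfin
  rw [not_finite_iff_infinite] at hfin
  let φ := Infinite.natEmbedding ι
  obtain ⟨K, hK, hKG⟩ := hG.image_closedBall_subset_compact C
  have hmem : ∀ n, v (φ n) ∈ K := fun n => by
    obtain ⟨w, hw, hvw⟩ := h (φ n)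
    exact hKG ⟨w, by simpa using hw, hvw.symm⟩
  obtain ⟨y, -, ψ, hψ, hlim⟩ := hK.tendsto_subseq hmem
  have hc := hlim.cauchySeq
  rw [Metric.cauchySeq_iff'] at hc
  obtain ⟨N, hN⟩ := hc 1 one_pos
  have h1 := hN (N + 1) (by omega)
  have hne : φ (ψ (N + 1)) ≠ φ (ψ N) := by
    rw [Ne, φ.injective.eq_iff, hψ.injective.eq_iff]
    omega
  have h2 : ‖v (φ (ψ (N + 1))) - v (φ (ψ N))‖ ^ 2 = 2 := by
    rw [@norm_sub_sq ℂ, hv.1, hv.1, hv.2 hne]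
    norm_num
  rw [dist_eq_norm] at h1
  simp only [Function.comp_apply] at h1
  nlinarith [norm_nonneg (v (φ (ψ (N + 1))) - v (φ (ψ N)))]

/-- Eigenvectors for different real eigenvalues are orthogonal. -/
lemma OpGraph.inner_eq_zero {G B : E →L[ℂ] E} (hG : (G : E →ₗ[ℂ] E).IsSymmetric)
    (hB : (B : E →ₗ[ℂ] E).IsSymmetric) {x y : ℝ} (hxy : x ≠ y) {u v : E}
    (h : OpGraph G B u ((x : ℂ) • u)) (h' : OpGraph G B v ((y : ℂ) • v)) : inner ℂ u v = 0 := by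
  have := OpGraph.inner_comm hG hB h h'
  rw [inner_smul_right, inner_smul_left, Complex.conj_ofReal, ← sub_eq_zero, ← sub_mul] at this
  refine (mul_eq_zero.1 this).resolve_left ?_
  exact_mod_cast sub_ne_zero.2 hxy.symm

/-- Some real number is not an eigenvalue. -/
lemma exists_not_eigenvalue {G B : E →L[ℂ] E} (hc : IsCompactOperator G)
    (hG : (G : E →ₗ[ℂ] E).IsSymmetric) (hB : (B : E →ₗ[ℂ] E).IsSymmetric) :
    ∃ μ : ℝ, ∀ u, OpGraph G B u ((μ : ℂ) • u) → u = 0 := by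
  by_contra! hcon
  choose u hu hne using hcon
  let v : Set.Icc (0 : ℝ) 1 → E := fun x => ((‖u x‖⁻¹ : ℝ) : ℂ) • u x
  have hv : ∀ x, OpGraph G B (v x) (((x : ℝ) : ℂ) • v x) := fun x => by
    simpa only [v, smul_comm ((x : ℝ) : ℂ)] using (hu x).smul ((‖u x‖⁻¹ : ℝ) : ℂ)
  have hv1 : ∀ x, ‖v x‖ = 1 := fun x => by
    simp [v, norm_smul, inv_mul_cancel₀ (norm_ne_zero_iff.2 (hne x))]
  have ho : Orthonormal ℂ v := ⟨hv1, fun x y hxy =>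
    OpGraph.inner_eq_zero hG hB (fun h => hxy (Subtype.ext h)) (hv x) (hv y)⟩
  have hfin : Finite (Set.Icc (0 : ℝ) 1) := finite_of_orthonormal_of_compact hc ho (1 + ‖B‖)
    fun x => OpGraph.exists_preimage (abs_le.2 ⟨by linarith [x.2.1], x.2.2⟩) (hv x) (hv1 x)
  exact (Set.Icc_infinite (zero_lt_one (α := ℝ))) (Set.toFinite _)

/-- The Fredholm alternative: if `G⁻¹ + B` has trivial kernel, then `1 + G B` is invertible. -/
lemma isUnit_one_add_comp [CompleteSpace E] {G B : E →L[ℂ] E} (hc : IsCompactOperator G)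
    (h : ∀ u, OpGraph G B u 0 → u = 0) : IsUnit (1 + G * B) := by
  have hGB : IsCompactOperator (G * B : E →L[ℂ] E) := hc.comp_clm B
  rcases hGB.hasEigenvalue_or_mem_resolventSet (μ := (-1 : ℂ)) (by norm_num) with h1 | h1
  · obtain ⟨u, hu⟩ := h1.exists_hasEigenvector
    refine absurd (h u ?_) hu.2
    have : G (B u) = -u := by simpa using hu.apply_eq_smul
    simp [OpGraph, this]
  · rw [spectrum.mem_resolventSet_iff, ← IsUnit.neg_iff] at h1
    convert h1 using 1
    simp [add_comm]

/-- An eigenbasis of the operator `G⁻¹ + B`: a Hilbert basis of eigenvectors with real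
eigenvalues. -/
structure EigenBasis (G B : E →L[ℂ] E) where
  /-- the index type -/
  ι : Type
  /-- the eigenvectors -/
  b : HilbertBasis ι ℂ E
  /-- the eigenvalues -/
  e : ι → ℝ
  graph : ∀ i, OpGraph G B (b i) ((e i : ℂ) • b i)

/-- The spectral theorem for `G⁻¹ + B`, where `G` is a compact injective symmetric operator and `B`
is a bounded symmetric operator. -/
theorem exists_eigenBasis [CompleteSpace E] {G B : E →L[ℂ] E} (hc : IsCompactOperator G)
    (hG : (G : E →ₗ[ℂ] E).IsSymmetric) (hinj : Function.Injective G)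
    (hB : (B : E →ₗ[ℂ] E).IsSymmetric) : Nonempty (EigenBasis G B) := by
  obtain ⟨μ, hμ⟩ := exists_not_eigenvalue hc hG hB
  -- shift by a real number outside of the spectrum and invert
  set B' : E →L[ℂ] E := B - (μ : ℂ) • 1 with hB'
  have hg : ∀ u f, OpGraph G B' u f ↔ OpGraph G B u (f + (μ : ℂ) • u) := fun u f => by
    have : f - B' u = f + (μ : ℂ) • u - B u := by simp [hB']; abel
    rw [OpGraph, OpGraph, this]
  have hB's : (B' : E →ₗ[ℂ] E).IsSymmetric := fun u v => by
    have := hB u v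
    simp only [ContinuousLinearMap.coe_coe] at this
    have h1 : inner ℂ ((μ : ℂ) • u) v = inner ℂ u ((μ : ℂ) • v) := by
      rw [inner_smul_left, inner_smul_right, Complex.conj_ofReal]
    change inner ℂ (B u - (μ : ℂ) • u) v = inner ℂ u (B v - (μ : ℂ) • v)
    rw [inner_sub_left, inner_sub_right, this, h1]
  have hu := isUnit_one_add_comp (B := B') hc (fun u h => hμ u (by simpa using (hg u 0).1 h))
  obtain ⟨S, hS⟩ := hu
  set T : E →L[ℂ] E := (↑S⁻¹ : E →L[ℂ] E) * G with hT
  have hST : ∀ f, T f + G (B' (T f)) = G f := fun f => by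
    have h1 : ((S : E →L[ℂ] E) * T) f = G f := by rw [hT, ← mul_assoc, S.mul_inv, one_mul]
    rw [hS] at h1
    simpa using h1
  have hgraph : ∀ f, OpGraph G B' (T f) f := fun f => by
    rw [OpGraph, map_sub, ← hST f]; abel
  have hTc : IsCompactOperator T := hc.clm_comp _
  have hTs : (T : E →ₗ[ℂ] E).IsSymmetric := fun u v =>
    OpGraph.inner_comm hG hB's (hgraph u) (hgraph v)
  have hT0 : ∀ f, T f = 0 → f = 0 := fun f hf => by
    have := hST f
    rw [hf] at this
    simp only [map_zero, add_zero] at this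
    exact hinj (by rw [← this, map_zero])
  let V : ℂ → Submodule ℂ E := fun τ => Module.End.eigenspace (T : Module.End ℂ E) τ
  have hfin : ∀ τ, FiniteDimensional ℂ (V τ) := fun τ => by
    rcases eq_or_ne τ 0 with rfl | hτ
    · have : V 0 = ⊥ := by
        rw [eq_bot_iff]
        intro u hu
        simpa using hT0 u (by simpa [V, Module.End.mem_eigenspace_iff] using hu)
      rw [this]
      infer_instance
    · exact ContinuousLinearMap.finite_dimensional_eigenspace hTc τ hτ
  let w : ∀ τ : ℂ, Fin (Module.finrank ℂ (V τ)) → V τ := fun τ => stdOrthonormalBasis ℂ (V τ)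
  have ho := (hTs.orthogonalFamily_eigenspaces).orthonormal_sigma_orthonormal
    (v_family := w) (fun τ => (stdOrthonormalBasis ℂ (V τ)).orthonormal)
  have hbot : (Submodule.span ℂ (Set.range
      fun a : Σ τ : ℂ, Fin (Module.finrank ℂ (V τ)) => ((w a.1 a.2 : V a.1) : E)))ᗮ = ⊥ := by
    rw [eq_bot_iff, ← ContinuousLinearMap.orthogonalComplement_iSup_eigenspaces_eq_bot hTc hTs]
    refine Submodule.orthogonal_le (iSup_le fun τ u hu => ?_)
    have h1 := (stdOrthonormalBasis ℂ (V τ)).sum_repr ⟨u, hu⟩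
    have h2 := congrArg (fun x : V τ => (x : E)) h1
    simp only [Submodule.coe_sum, Submodule.coe_smul] at h2
    rw [← h2]
    exact Submodule.sum_mem _ fun i _ => Submodule.smul_mem _ _
      (Submodule.subset_span ⟨⟨τ, i⟩, rfl⟩)
  let b := HilbertBasis.mkOfOrthogonalEqBot ho hbot
  have hb : ∀ a, b a = w a.1 a.2 := fun a => by
    exact congrFun (HilbertBasis.coe_mkOfOrthogonalEqBot ho hbot) a
  have hTb : ∀ a, T (b a) = a.1 • b a := fun a => by
    rw [hb]
    exact Module.End.mem_eigenspace_iff.1 (w a.1 a.2).2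
  have hne : ∀ a, b a ≠ 0 := fun a => b.orthonormal.ne_zero a
  have hτ0 : ∀ a : Σ τ : ℂ, Fin (Module.finrank ℂ (V τ)), a.1 ≠ 0 := fun a h0 =>
    hne a (hT0 _ (by rw [hTb, h0, zero_smul]))
  have hreal : ∀ a : Σ τ : ℂ, Fin (Module.finrank ℂ (V τ)), ((a.1.re : ℝ) : ℂ) = a.1 := fun a => by
    have hev : Module.End.HasEigenvalue (T : Module.End ℂ E) a.1 :=
      Module.End.hasEigenvalue_of_hasEigenvector
        ⟨Module.End.mem_eigenspace_iff.2 (hTb a), hne a⟩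
    exact Complex.conj_eq_iff_re.1 (hTs.conj_eigenvalue_eq_self hev)
  refine ⟨⟨_, b, fun a => a.1.re⁻¹ + μ, fun a => ?_⟩⟩
  have h1 := (hgraph (b a)).smul (a.1⁻¹)
  rw [hTb, inv_smul_smul₀ (hτ0 a), hg] at h1
  convert h1 using 1
  rw [← add_smul]
  congr 1
  push_cast
  rw [hreal]

namespace EigenBasis

variable {G B : E →L[ℂ] E} (D : EigenBasis G B)

lemma norm_b (i : D.ι) : ‖D.b i‖ = 1 := D.b.orthonormal.1 i

lemma inner_graph (hG : (G : E →ₗ[ℂ] E).IsSymmetric) (hB : (B : E →ₗ[ℂ] E).IsSymmetric)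
    {u f : E} (h : OpGraph G B u f) (i : D.ι) :
    inner ℂ (D.b i) f = D.e i * inner ℂ (D.b i) u := by
  rw [OpGraph.inner_comm hG hB (D.graph i) h, inner_smul_left, Complex.conj_ofReal]

lemma hasSum_norm_sq (u : E) : HasSum (fun i => ‖inner ℂ (D.b i) u‖ ^ 2) (‖u‖ ^ 2) := by
  have h := (D.b.hasSum_inner_mul_inner u u).mapL Complex.reCLM
  rw [Complex.reCLM_apply, ← RCLike.re_eq_complex_re, inner_self_eq_norm_sq] at h
  refine h.congr_fun fun i => ?_
  rw [Complex.reCLM_apply, ← inner_conj_symm u, ← Complex.normSq_eq_conj_mul_self,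
    Complex.ofReal_re, Complex.normSq_eq_norm_sq]

lemma hasSum_energy (hG : (G : E →ₗ[ℂ] E).IsSymmetric) (hB : (B : E →ₗ[ℂ] E).IsSymmetric)
    {u f : E} (h : OpGraph G B u f) :
    HasSum (fun i => D.e i * ‖inner ℂ (D.b i) u‖ ^ 2) (inner ℂ u f).re := by
  have h1 := (D.b.hasSum_inner_mul_inner u f).mapL Complex.reCLM
  rw [Complex.reCLM_apply] at h1
  refine h1.congr_fun fun i => ?_
  rw [Complex.reCLM_apply, D.inner_graph hG hB h, mul_left_comm, ← inner_conj_symm u,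
    ← Complex.normSq_eq_conj_mul_self, ← Complex.ofReal_mul, Complex.ofReal_re,
    Complex.normSq_eq_norm_sq]

lemma hasSum_sq (hG : (G : E →ₗ[ℂ] E).IsSymmetric) (hB : (B : E →ₗ[ℂ] E).IsSymmetric)
    {u f : E} (h : OpGraph G B u f) :
    HasSum (fun i => D.e i ^ 2 * ‖inner ℂ (D.b i) u‖ ^ 2) (‖f‖ ^ 2) := by
  refine (D.hasSum_norm_sq f).congr_fun fun i => ?_
  rw [D.inner_graph hG hB h, norm_mul, mul_pow, Complex.norm_real, Real.norm_eq_abs, sq_abs]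

/-- The spectrum is discrete. -/
lemma finite_le (hc : IsCompactOperator G) (M : ℝ) : {i | |D.e i| ≤ M}.Finite :=
  Set.finite_coe_iff.1 (finite_of_orthonormal_of_compact hc
    (v := fun i : {i | |D.e i| ≤ M} => D.b i)
    (D.b.orthonormal.comp _ Subtype.coe_injective) (M + ‖B‖)
    fun i => OpGraph.exists_preimage i.2 (D.graph i) (D.norm_b i))

lemma eq_zero_of_inner {u : E} (h : ∀ i, inner ℂ (D.b i) u = 0) : u = 0 := by
  have := D.hasSum_norm_sq u
  simp only [h, norm_zero, ne_eq, OfNat.ofNat_ne_zero, not_false_eq_true, zero_pow] at this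
  simpa using this.unique hasSum_zero

/-- If `u` is orthogonal to the eigenvectors with eigenvalues smaller than `δ`, then `G⁻¹ + B` is
bounded below by `δ` on `u`. -/
lemma norm_ge (hG : (G : E →ₗ[ℂ] E).IsSymmetric) (hB : (B : E →ₗ[ℂ] E).IsSymmetric)
    {u f : E} (h : OpGraph G B u f) {δ : ℝ} (hδ : 0 ≤ δ)
    (ho : ∀ i, |D.e i| < δ → inner ℂ (D.b i) u = 0) : δ * ‖u‖ ≤ ‖f‖ := by
  have h1 := (D.hasSum_norm_sq u).mul_left (δ ^ 2)
  have h2 := D.hasSum_sq hG hB h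
  have h3 : δ ^ 2 * ‖u‖ ^ 2 ≤ ‖f‖ ^ 2 := by
    refine hasSum_le (fun i => ?_) h1 h2
    by_cases hi : |D.e i| < δ
    · simp [ho i hi]
    · refine mul_le_mul_of_nonneg_right ?_ (sq_nonneg _)
      rw [← sq_abs (D.e i)]
      exact pow_le_pow_left₀ hδ (not_lt.1 hi) 2
  rw [← mul_pow] at h3
  exact le_of_sq_le_sq h3 (norm_nonneg _)

end EigenBasis

variable (G B : E →L[ℂ] E)

/-- The eigenspace of `G⁻¹ + B` for the eigenvalue `x`. -/
def opEigenspace (x : ℝ) : Submodule ℂ E where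
  carrier := {u | OpGraph G B u ((x : ℂ) • u)}
  zero_mem' := by simp [OpGraph]
  add_mem' h h' := by
    have := OpGraph.add h h'
    rwa [← smul_add] at this
  smul_mem' c u h := by
    have := OpGraph.smul c h
    rwa [smul_comm] at this

variable {G B}

lemma mem_opEigenspace {x : ℝ} {u : E} :
    u ∈ opEigenspace G B x ↔ OpGraph G B u ((x : ℂ) • u) := Iff.rfl

lemma mem_opEigenspace_zero {u : E} : u ∈ opEigenspace G B 0 ↔ OpGraph G B u 0 := by
  simp [mem_opEigenspace]

lemma EigenBasis.opEigenspace_eq_span (D : EigenBasis G B) (hc : IsCompactOperator G)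
    (hG : (G : E →ₗ[ℂ] E).IsSymmetric) (hB : (B : E →ₗ[ℂ] E).IsSymmetric) (x : ℝ) :
    opEigenspace G B x = Submodule.span ℂ (Set.range fun i : {i // D.e i = x} => D.b i) := by
  have hfin : Finite {i // D.e i = x} :=
    ((D.finite_le hc |x|).subset (fun i (hi : D.e i = x) => by simp [hi])).to_subtype
  have := Fintype.ofFinite {i // D.e i = x}
  refine le_antisymm (fun u hu => ?_) (Submodule.span_le.2 ?_)
  · set v := ∑ i : {i // D.e i = x}, inner ℂ (D.b i) u • D.b i with hv
    have hvs : v ∈ Submodule.span ℂ (Set.range fun i : {i // D.e i = x} => D.b i) :=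
      Submodule.sum_mem _ fun i _ => Submodule.smul_mem _ _ (Submodule.subset_span ⟨i, rfl⟩)
    have huv : u - v = 0 := by
      refine D.eq_zero_of_inner fun i => ?_
      rw [inner_sub_right]
      by_cases hi : D.e i = x
      · have h1 := (D.b.orthonormal.comp (fun j : {i // D.e i = x} => (j : D.ι))
          Subtype.coe_injective).inner_right_fintype (fun j => inner ℂ (D.b j) u) ⟨i, hi⟩
        simp only [Function.comp_apply] at h1
        rw [hv, h1, sub_self]
      · rw [OpGraph.inner_eq_zero hG hB hi (D.graph i) hu, hv, inner_sum, zero_sub, neg_eq_zero]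
        refine Finset.sum_eq_zero fun j _ => ?_
        rw [inner_smul_right, D.b.orthonormal.2 (fun h : i = j => hi (h ▸ j.2)), mul_zero]
    rw [sub_eq_zero.1 huv]
    exact hvs
  · rintro _ ⟨i, rfl⟩
    have := D.graph i
    rwa [i.2] at this

lemma EigenBasis.rank_opEigenspace (D : EigenBasis G B) (hc : IsCompactOperator G)
    (hG : (G : E →ₗ[ℂ] E).IsSymmetric) (hB : (B : E →ₗ[ℂ] E).IsSymmetric) (x : ℝ) :
    Cardinal.lift.{0} (Module.rank ℂ (opEigenspace G B x)) =
      Cardinal.lift (Cardinal.mk {i // D.e i = x}) := by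
  have hli : LinearIndependent ℂ (fun i : {i // D.e i = x} => D.b i) :=
    (D.b.orthonormal.comp _ Subtype.coe_injective).linearIndependent
  rw [D.opEigenspace_eq_span hc hG hB, rank_span hli]
  exact Cardinal.mk_range_eq_of_injective hli.injective

end Abstract

section Abstract

variable {E : Type*} [NormedAddCommGroup E] [InnerProductSpace ℂ E]

/-! ### Dimension counting and unboundedness of the spectrum -/

/-- A subspace of larger dimension contains a nonzero vector orthogonal to one of smaller
dimension. -/
lemma exists_ne_zero_orthogonal (S T : Submodule ℂ E) [FiniteDimensional ℂ S]
    [FiniteDimensional ℂ T] (h : Module.finrank ℂ T < Module.finrank ℂ S) :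
    ∃ u ∈ S, u ≠ 0 ∧ ∀ v ∈ T, inner ℂ v u = 0 := by
  have hker := LinearMap.ker_ne_bot_of_finrank_lt
    (f := (T.orthogonalProjectionOnto : E →ₗ[ℂ] T).comp S.subtype) h
  obtain ⟨u, hu, hne⟩ := (Submodule.ne_bot_iff _).1 hker
  refine ⟨u, u.2, by simpa using hne, fun v hv => ?_⟩
  have h1 : T.orthogonalProjectionOnto (u : E) = 0 := by simpa using hu
  have h2 := (Submodule.orthogonalProjectionOnto_eq_zero_iff).1 h1
  exact h2 v hv

lemma finrank_span_orthonormal {ι : Type*} {v : ι → E} (hv : Orthonormal ℂ v) (s : Finset ι) :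
    Module.finrank ℂ (Submodule.span ℂ (v '' s)) = s.card := by
  have hli : LinearIndependent ℂ (fun i : s => v i) :=
    (hv.comp _ Subtype.coe_injective).linearIndependent
  have h1 := finrank_span_eq_card hli
  rw [Fintype.card_coe] at h1
  rw [← h1, Set.image_eq_range]
  rfl

lemma exists_sum_of_mem_span {ι : Type*} {v : ι → E} {s : Finset ι} {u : E}
    (hu : u ∈ Submodule.span ℂ (v '' s)) : ∃ c : ι → ℂ, u = ∑ i ∈ s, c i • v i := by
  classical
  obtain ⟨c, hc⟩ := (Submodule.mem_span_image_finset_iff_exists_fun ℂ).1 hu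
  refine ⟨fun i => if h : i ∈ s then c ⟨i, h⟩ else 0, ?_⟩
  rw [← hc, ← Finset.sum_coe_sort s]
  exact Finset.sum_congr rfl fun i _ => by simp

lemma norm_sq_sum_orthonormal {ι : Type*} {v : ι → E} (hv : Orthonormal ℂ v) (s : Finset ι)
    (c : ι → ℂ) : ‖∑ i ∈ s, c i • v i‖ ^ 2 = ∑ i ∈ s, ‖c i‖ ^ 2 := by
  rw [← inner_self_eq_norm_sq (𝕜 := ℂ), hv.inner_sum, map_sum]
  refine Finset.sum_congr rfl fun i _ => ?_
  rw [← Complex.normSq_eq_conj_mul_self, RCLike.re_eq_complex_re, Complex.ofReal_re,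
    Complex.normSq_eq_norm_sq]

/-- If `G` has infinitely many positive eigenvalues, then the spectrum of `G⁻¹ + B` is unbounded
above: on the span of sufficiently many eigenvectors of `G` the quadratic form is too large for
the operator to have only finitely many eigenvalues above `M`. -/
lemma EigenBasis.infinite_gt {G B : E →L[ℂ] E} (D : EigenBasis G B) (hc : IsCompactOperator G)
    (hG : (G : E →ₗ[ℂ] E).IsSymmetric) (hB : (B : E →ₗ[ℂ] E).IsSymmetric)
    {κ : Type*} [Infinite κ] {v : κ → E} (hv : Orthonormal ℂ v) {τ : κ → ℝ} (hτ : ∀ m, 0 < τ m)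
    (hGv : ∀ m, G (v m) = (τ m : ℂ) • v m) (M : ℝ) : {i | M < D.e i}.Infinite := by
  intro hfin
  set M' : ℝ := |M| + ‖B‖ + 1 with hM'
  have hM'0 : 0 < M' := by positivity
  -- all but finitely many `v m` belong to large eigenvalues of `G⁻¹`
  have hsmall : {m | M' ≤ (τ m)⁻¹}.Infinite := by
    refine ((Set.infinite_univ (α := κ)).sdiff (t := {m | (τ m)⁻¹ ≤ M'}) ?_).mono ?_
    · refine Set.finite_coe_iff.1 (finite_of_orthonormal_of_compact hc
        (v := fun m : {m | (τ m)⁻¹ ≤ M'} => v m) (hv.comp _ Subtype.coe_injective) M' fun m => ?_)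
      refine ⟨(((τ m)⁻¹ : ℝ) : ℂ) • v m, ?_, ?_⟩
      · rw [norm_smul, hv.1, mul_one, Complex.norm_real, Real.norm_eq_abs,
          abs_of_pos (inv_pos.2 (hτ m))]
        exact m.2
      · rw [map_smul, hGv, smul_smul, ← Complex.ofReal_mul, inv_mul_cancel₀ (hτ m).ne',
          Complex.ofReal_one, one_smul]
    · rintro m ⟨-, hm⟩
      exact (not_le.1 (show ¬(τ m)⁻¹ ≤ M' from hm)).le
  obtain ⟨t, ht, hcard⟩ := hsmall.exists_subset_card_eq (hfin.toFinset.card + 1)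
  have : FiniteDimensional ℂ (Submodule.span ℂ (v '' t)) :=
    FiniteDimensional.span_of_finite ℂ (t.finite_toSet.image v)
  have : FiniteDimensional ℂ (Submodule.span ℂ (D.b '' hfin.toFinset)) :=
    FiniteDimensional.span_of_finite ℂ (hfin.toFinset.finite_toSet.image D.b)
  obtain ⟨u, hu, hu0, huo⟩ := exists_ne_zero_orthogonal (Submodule.span ℂ (v '' t))
    (Submodule.span ℂ (D.b '' hfin.toFinset)) (by
      rw [finrank_span_orthonormal hv, finrank_span_orthonormal D.b.orthonormal, hcard]
      exact Nat.lt_succ_self _)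
  obtain ⟨c, hcu⟩ := exists_sum_of_mem_span hu
  set f : E := ∑ m ∈ t, (c m * ((τ m)⁻¹ : ℝ)) • v m with hf
  have hgr : OpGraph G B u (f + B u) := by
    have : G f = u := by
      rw [hf, hcu, map_sum]
      refine Finset.sum_congr rfl fun m _ => ?_
      rw [map_smul, hGv, smul_smul, mul_assoc, ← Complex.ofReal_mul, inv_mul_cancel₀ (hτ m).ne',
        Complex.ofReal_one, mul_one]
    simp [OpGraph, this]
  have h1 : (inner ℂ u (f + B u)).re ≤ M * ‖u‖ ^ 2 := by
    refine hasSum_le (fun i => ?_) (D.hasSum_energy hG hB hgr) ((D.hasSum_norm_sq u).mul_left M)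
    by_cases hi : M < D.e i
    · rw [huo _ (Submodule.subset_span ⟨i, by simpa using hi, rfl⟩)]
      simp
    · exact mul_le_mul_of_nonneg_right (not_lt.1 hi) (sq_nonneg _)
  have h2 : M' * ‖u‖ ^ 2 ≤ (inner ℂ u f).re := by
    rw [hcu, norm_sq_sum_orthonormal hv, hf, hv.inner_sum, Complex.re_sum, Finset.mul_sum]
    refine Finset.sum_le_sum fun m hm => ?_
    rw [← mul_assoc, ← Complex.normSq_eq_conj_mul_self, ← Complex.ofReal_mul, Complex.ofReal_re,
      Complex.normSq_eq_norm_sq, mul_comm]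
    exact mul_le_mul_of_nonneg_left (ht hm) (sq_nonneg _)
  have h3 : -(‖B‖ * ‖u‖ ^ 2) ≤ (inner ℂ u (B u)).re := by
    have h4 : ‖inner ℂ u (B u)‖ ≤ ‖B‖ * ‖u‖ ^ 2 := by
      refine (norm_inner_le_norm _ _).trans ?_
      nlinarith [B.le_opNorm u, norm_nonneg u]
    linarith [(abs_le.1 ((Complex.abs_re_le_norm _).trans h4)).1]
  rw [inner_add_right, Complex.add_re] at h1
  have h5 : 0 < ‖u‖ ^ 2 := by positivity
  have h6 : M' * ‖u‖ ^ 2 - ‖B‖ * ‖u‖ ^ 2 ≤ M * ‖u‖ ^ 2 := by linarith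
  rw [← sub_mul] at h6
  have h7 := le_of_mul_le_mul_right h6 h5
  linarith [le_abs_self M]

/-- The eigenbasis of `-(G⁻¹ + B)`. -/
def EigenBasis.neg {G B : E →L[ℂ] E} (D : EigenBasis G B) : EigenBasis (-G) (-B) where
  ι := D.ι
  b := D.b
  e i := -D.e i
  graph i := by
    have := (D.graph i).neg
    rwa [← neg_smul, ← Complex.ofReal_neg] at this

lemma EigenBasis.infinite_lt {G B : E →L[ℂ] E} (D : EigenBasis G B) (hc : IsCompactOperator G)
    (hG : (G : E →ₗ[ℂ] E).IsSymmetric) (hB : (B : E →ₗ[ℂ] E).IsSymmetric)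
    {κ : Type*} [Infinite κ] {v : κ → E} (hv : Orthonormal ℂ v) {τ : κ → ℝ} (hτ : ∀ m, τ m < 0)
    (hGv : ∀ m, G (v m) = (τ m : ℂ) • v m) (M : ℝ) : {i | D.e i < M}.Infinite := by
  have hs : ∀ A : E →L[ℂ] E, (A : E →ₗ[ℂ] E).IsSymmetric →
      ((-A : E →L[ℂ] E) : E →ₗ[ℂ] E).IsSymmetric := fun A hA u v => by
    change inner ℂ (-(A u)) v = inner ℂ u (-(A v))
    rw [inner_neg_left, inner_neg_right]
    exact congrArg _ (hA u v)
  have h := D.neg.infinite_gt (by exact hc.neg) (hs G hG) (hs B hB) hv (τ := fun m => -τ m)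
    (fun m => neg_pos.2 (hτ m)) (fun m => by simp [hGv]) (-M)
  refine h.mono fun i (hi : -M < -D.e i) => ?_
  exact neg_lt_neg_iff.1 hi

/-! ### Sorting a discrete sequence -/

/-- A real family which is unbounded in both directions and takes only finitely many values in
each bounded interval can be listed in nondecreasing order by the integers. -/
lemma exists_monotone_equiv {ι : Type*} (e : ι → ℝ) (hfin : ∀ M, {i | |e i| ≤ M}.Finite)
    (htop : ∀ M, {i | M < e i}.Infinite) (hbot : ∀ M, {i | e i < M}.Infinite) :
    ∃ s : ℤ ≃ ι, Monotone (e ∘ s) := by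
  classical
  -- order the indices by the value of `e`, breaking ties by an arbitrary linear order
  let := linearOrderOfSTO (WellOrderingRel (α := ι))
  let f : ι → ℝ ×ₗ ι := fun i => toLex (e i, i)
  have hf : Function.Injective f := fun i j h => congrArg (fun x => (ofLex x).2) h
  let ι' : Type _ := Set.range f
  let g : ι' ≃ ι := (Equiv.ofInjective f hf).symm
  have hg : ∀ x : ι', f (g x) = x := fun x => Equiv.apply_ofInjective_symm hf x
  have hge : ∀ x y : ι', x ≤ y → e (g x) ≤ e (g y) := fun x y hxy => by
    have h1 : f (g x) ≤ f (g y) := by rw [hg, hg]; exact hxy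
    rcases Prod.Lex.le_iff.1 h1 with h | h
    · exact h.le
    · exact h.1.le
  have hgl : ∀ x y : ι', e (g x) < e (g y) → x < y := fun x y hxy =>
    not_le.1 fun h => absurd (hge _ _ h) (not_le.2 hxy)
  have : LocallyFiniteOrder ι' := LocallyFiniteOrder.ofFiniteIcc fun a b => by
    refine Set.Finite.of_finite_image (f := g) ?_ g.injective.injOn
    refine (hfin (max |e (g a)| |e (g b)|)).subset ?_
    rintro _ ⟨x, ⟨hax, hxb⟩, rfl⟩
    exact abs_le_max_abs_abs (hge _ _ hax) (hge _ _ hxb)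
  have : Nonempty ι' := by
    obtain ⟨i, -⟩ := (htop 0).nonempty
    exact ⟨g.symm i⟩
  have : NoMaxOrder ι' := ⟨fun x => by
    obtain ⟨i, hi⟩ := (htop (e (g x))).nonempty
    exact ⟨g.symm i, hgl _ _ (by simpa using hi)⟩⟩
  have : NoMinOrder ι' := ⟨fun x => by
    obtain ⟨i, hi⟩ := (hbot (e (g x))).nonempty
    exact ⟨g.symm i, hgl _ _ (by simpa using hi)⟩⟩
  let : SuccOrder ι' := LinearLocallyFiniteOrder.succOrder ι'
  let : PredOrder ι' := LinearLocallyFiniteOrder.predOrder ι'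
  let o : ι' ≃o ℤ := orderIsoIntOfLinearSuccPredArch
  exact ⟨o.symm.toEquiv.trans g, fun m n hmn => hge _ _ (o.symm.monotone hmn)⟩

end Abstract

section Abstract

variable {E : Type*} [NormedAddCommGroup E] [InnerProductSpace ℂ E]

/-! ### Perturbation of a twofold eigenvalue zero -/

/-- Discreteness of the spectrum gives a gap around zero. -/
lemma EigenBasis.exists_gap {G B : E →L[ℂ] E} (D : EigenBasis G B) (hc : IsCompactOperator G)
    (hG : (G : E →ₗ[ℂ] E).IsSymmetric) (hB : (B : E →ₗ[ℂ] E).IsSymmetric) :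
    ∃ g : ℝ, 0 < g ∧ ∀ u f, OpGraph G B u f → (∀ n ∈ opEigenspace G B 0, inner ℂ n u = 0) →
      g * ‖u‖ ≤ ‖f‖ := by
  obtain ⟨g, hg, hgap⟩ : ∃ g : ℝ, 0 < g ∧ ∀ i, |D.e i| < g → D.e i = 0 := by
    have hfin : {i | |D.e i| ≤ 1 ∧ D.e i ≠ 0}.Finite :=
      (D.finite_le hc 1).subset fun i hi => hi.1
    rcases Set.eq_empty_or_nonempty {i | |D.e i| ≤ 1 ∧ D.e i ≠ 0} with h0 | h0
    · refine ⟨1, one_pos, fun i hi => ?_⟩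
      by_contra hne
      exact Set.notMem_empty i (h0 ▸ ⟨hi.le, hne⟩)
    · obtain ⟨j, hj, hmin⟩ := Set.exists_min_image _ (fun i => |D.e i|) hfin h0
      refine ⟨|D.e j|, abs_pos.2 hj.2, fun i hi => ?_⟩
      by_contra hne
      exact absurd (hmin i ⟨hi.le.trans hj.1, hne⟩) (not_le.2 hi)
  refine ⟨g, hg, fun u f h ho => D.norm_ge hG hB h hg.le fun i hi => ho _ ?_⟩
  have := D.graph i
  rwa [hgap i hi] at this

section Perturbation

variable {G B T : E →L[ℂ] E} {g κ : ℝ}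

/-- A perturbation which is smaller than a quarter of the gap leaves exactly two eigenvalues in the
middle of the gap. -/
lemma EigenBasis.ncard_eq_two (D : EigenBasis G (B + T)) (hc : IsCompactOperator G)
    (hG : (G : E →ₗ[ℂ] E).IsSymmetric) (hB : ((B + T : E →L[ℂ] E) : E →ₗ[ℂ] E).IsSymmetric)
    (hdim : Module.finrank ℂ (opEigenspace G B 0) = 2) (hg : 0 < g)
    (hgap : ∀ u f, OpGraph G B u f → (∀ n ∈ opEigenspace G B 0, inner ℂ n u = 0) →
      g * ‖u‖ ≤ ‖f‖)
    (hT : ∀ u, ‖T u‖ ≤ κ * ‖u‖) (hκ : κ < g / 4) : {i | |D.e i| < g / 4}.ncard = 2 := by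
  have hfin : {i | |D.e i| < g / 4}.Finite := 
    (D.finite_le hc (g / 4)).subset fun i (hi : |D.e i| < g / 4) => hi.le
  have : FiniteDimensional ℂ (opEigenspace G B 0) := .of_finrank_pos (by omega)
  have : FiniteDimensional ℂ (Submodule.span ℂ (D.b '' hfin.toFinset)) :=
    FiniteDimensional.span_of_finite ℂ (hfin.toFinset.finite_toSet.image D.b)
  rw [Set.ncard_eq_toFinset_card _ hfin]
  refine le_antisymm (not_lt.1 fun hlt => ?_) (not_lt.1 fun hlt => ?_)
  · -- a combination of three eigenvectors orthogonal to the kernel contradicts the gap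
    obtain ⟨u, hu, hu0, huo⟩ := exists_ne_zero_orthogonal
      (Submodule.span ℂ (D.b '' hfin.toFinset)) (opEigenspace G B 0)
      (by rwa [finrank_span_orthonormal D.b.orthonormal, hdim])
    obtain ⟨c, hcu⟩ := exists_sum_of_mem_span hu
    have hgr : OpGraph G (B + T) u (∑ i ∈ hfin.toFinset, (c i * D.e i) • D.b i) := by
      rw [hcu]
      refine OpGraph.sum _ fun i _ => ?_
      rw [mul_smul]
      exact (D.graph i).smul (c i)
    have h1 := hgap _ _ (hgr.of_add_right T) huo
    have h2 : ‖∑ i ∈ hfin.toFinset, (c i * D.e i) • D.b i‖ ≤ g / 4 * ‖u‖ := by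
      refine le_of_sq_le_sq ?_ (by positivity)
      rw [mul_pow, hcu, norm_sq_sum_orthonormal D.b.orthonormal,
        norm_sq_sum_orthonormal D.b.orthonormal, Finset.mul_sum]
      refine Finset.sum_le_sum fun i hi => ?_
      rw [norm_mul, mul_pow, mul_comm, Complex.norm_real, Real.norm_eq_abs]
      have hi' : |D.e i| < g / 4 := by simpa using hi
      gcongr
    have h3 := norm_sub_le (∑ i ∈ hfin.toFinset, (c i * D.e i) • D.b i) (T u)
    have h4 : 0 < ‖u‖ := norm_pos_iff.2 hu0
    nlinarith [hT u, mul_pos hg h4, mul_lt_mul_of_pos_right hκ h4]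
  · -- a kernel vector orthogonal to all eigenvectors in the gap would be mapped to a large vector
    obtain ⟨n, hn, hn0, hno⟩ := exists_ne_zero_orthogonal (opEigenspace G B 0)
      (Submodule.span ℂ (D.b '' hfin.toFinset))
      (by rwa [finrank_span_orthonormal D.b.orthonormal, hdim])
    have hgr : OpGraph G (B + T) n (T n) := by
      simpa using (mem_opEigenspace_zero.1 hn).add_right T
    have h1 := D.norm_ge hG hB hgr (by positivity : 0 ≤ g / 4) fun i hi =>
      hno _ (Submodule.subset_span ⟨i, by simpa using hi, rfl⟩)
    have h4 : 0 < ‖n‖ := norm_pos_iff.2 hn0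
    nlinarith [hT n, mul_lt_mul_of_pos_right hκ h4]

/-- Upper bound for the eigenvalues in the gap: the eigenvector is close to its projection to the
kernel, where the perturbation is bounded by `s`. -/
lemma EigenBasis.abs_le_of_lt (D : EigenBasis G (B + T)) (hG : (G : E →ₗ[ℂ] E).IsSymmetric)
    (hB : (B : E →ₗ[ℂ] E).IsSymmetric)
    (hdim : Module.finrank ℂ (opEigenspace G B 0) = 2) (hg : 0 < g)
    (hgap : ∀ u f, OpGraph G B u f → (∀ n ∈ opEigenspace G B 0, inner ℂ n u = 0) →
      g * ‖u‖ ≤ ‖f‖)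
    (hT : ∀ u, ‖T u‖ ≤ κ * ‖u‖) (hκ0 : 0 ≤ κ) (hκ : κ < g / 4) {s : ℝ}
    (hs : ∀ n ∈ opEigenspace G B 0, ‖inner ℂ n (T n)‖ ≤ s * ‖n‖ ^ 2)
    {i : D.ι} (hi : |D.e i| < g / 4) : |D.e i| ≤ s + 6 / g * κ ^ 2 := by
  have : FiniteDimensional ℂ (opEigenspace G B 0) := .of_finrank_pos (by omega)
  set u := D.b i with hu
  set x := D.e i with hx
  set n := (opEigenspace G B 0).starProjection u with hn
  have hnN : n ∈ opEigenspace G B 0 := Submodule.starProjection_apply_mem _ _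
  set w := u - n with hw
  have hwN : ∀ m ∈ opEigenspace G B 0, inner ℂ m w = 0 := fun m hm =>
    (Submodule.mem_orthogonal _ _).1 (Submodule.sub_starProjection_mem_orthogonal u) m hm
  have hu1 : ‖u‖ = 1 := D.norm_b i
  have hgr : OpGraph G B u ((x : ℂ) • u - T u) := (D.graph i).of_add_right T
  have hgn := mem_opEigenspace_zero.1 hnN
  have hTu : ‖T u‖ ≤ κ := by simpa [hu1] using hT u
  have hw1 : g * ‖w‖ ≤ |x| + κ := by
    refine (hgap w _ (hgr.sub hgn) hwN).trans ?_
    rw [sub_zero]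
    refine (norm_sub_le _ _).trans (add_le_add ?_ hTu)
    rw [norm_smul, hu1, mul_one, Complex.norm_real, Real.norm_eq_abs]
  have hpyth : ‖n‖ ^ 2 + ‖w‖ ^ 2 = 1 := by
    have h := @norm_add_sq ℂ _ _ _ _ n w
    rw [hwN n hnN, hw, add_sub_cancel, hu1] at h
    simp at h
    linarith
  have hw2 : ‖w‖ ≤ 1 / 2 := by nlinarith
  have hn1 : ‖n‖ ≤ 1 := by nlinarith [norm_nonneg n, sq_nonneg ‖w‖]
  have hn2 : 3 / 4 ≤ ‖n‖ ^ 2 := by nlinarith [norm_nonneg w]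
  -- pairing the eigenvalue equation with the kernel vector `n`
  have hpair : (x : ℂ) * ((‖n‖ : ℂ) ^ 2) = inner ℂ n (T u) := by
    have h := OpGraph.inner_comm hG hB hgn hgr
    rw [inner_zero_left, inner_sub_right, sub_eq_zero, inner_smul_right] at h
    rw [← h, show u = n + w by rw [hw]; abel, inner_add_right, hwN n hnN, add_zero]
    exact congrArg _ (inner_self_eq_norm_sq_to_K n).symm
  have habs : |x| * ‖n‖ ^ 2 = ‖inner ℂ n (T u)‖ := by
    rw [← hpair]
    simp
  have hx2 : |x| ≤ 2 * κ := by
    have h1 : |x| * ‖n‖ ^ 2 ≤ κ := by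
      rw [habs]
      refine (norm_inner_le_norm _ _).trans ?_
      calc ‖n‖ * ‖T u‖ ≤ 1 * κ := by gcongr
        _ = κ := one_mul _
    nlinarith [abs_nonneg x]
  have hw3 : ‖w‖ ≤ 3 * κ / g := by
    rw [le_div_iff₀ hg]
    linarith
  have h5 : |x| * ‖n‖ ^ 2 ≤ s * ‖n‖ ^ 2 + κ * (3 * κ / g) := by
    rw [habs, show u = n + w by rw [hw]; abel, map_add, inner_add_right]
    refine (norm_add_le _ _).trans (add_le_add (hs n hnN) ?_)
    refine (norm_inner_le_norm _ _).trans ?_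
    calc ‖n‖ * ‖T w‖ ≤ 1 * (κ * (3 * κ / g)) := by
          gcongr
          exact (hT w).trans (by gcongr)
      _ = _ := one_mul _
  have h6 : (|x| - s) * ‖n‖ ^ 2 ≤ 3 / g * κ ^ 2 := by
    have : κ * (3 * κ / g) = 3 / g * κ ^ 2 := by ring
    nlinarith
  have h7 : 0 ≤ 3 / g * κ ^ 2 := by positivity
  have h8 : 6 / g * κ ^ 2 = 2 * (3 / g * κ ^ 2) := by ring
  rw [h8]
  by_contra hcon
  have h9 : 0 < |x| - s := by linarith
  nlinarith

/-- Lower bound for the largest and upper bound for the smallest eigenvalue in the gap, by a trial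
vector in the kernel: `e i ≤ x₀ + (8 / g) (e i)²` for all eigenvalues inside or outside of the
gap. -/
lemma EigenBasis.le_of_trial (D : EigenBasis G (B + T)) (hG : (G : E →ₗ[ℂ] E).IsSymmetric)
    (hB : ((B + T : E →L[ℂ] E) : E →ₗ[ℂ] E).IsSymmetric) (hg : 0 < g)
    (hT : ∀ u, ‖T u‖ ≤ κ * ‖u‖) {n : E} (hn : n ∈ opEigenspace G B 0)
    (hn1 : ‖n‖ = 1) {ε x₀ : ℝ} (hε : |ε| = 1) (hx₀ : |x₀| < g / 4)
    (hle : ∀ i, |D.e i| < g / 4 → ε * D.e i ≤ x₀) :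
    ε * (inner ℂ n (T n)).re ≤ x₀ + 8 / g * κ ^ 2 := by
  have hgr : OpGraph G (B + T) n (T n) := by
    simpa using (mem_opEigenspace_zero.1 hn).add_right T
  have h1 := (D.hasSum_energy hG hB hgr).mul_left ε
  have h2 := ((D.hasSum_norm_sq n).mul_left x₀).add ((D.hasSum_sq hG hB hgr).mul_left (8 / g))
  have hterm : ∀ i, ε * D.e i ≤ x₀ + 8 / g * D.e i ^ 2 := fun i => by
    by_cases hi : |D.e i| < g / 4
    · have := hle i hi
      have : 0 ≤ 8 / g * D.e i ^ 2 := by positivity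
      linarith
    · rw [not_lt] at hi
      have h3 : ε * D.e i ≤ |D.e i| := by
        refine (le_abs_self _).trans ?_
        rw [abs_mul, hε, one_mul]
      have h4 : 2 * |D.e i| ≤ 8 / g * D.e i ^ 2 := by
        rw [div_mul_eq_mul_div, le_div_iff₀ hg, ← sq_abs]
        nlinarith [abs_nonneg (D.e i)]
      linarith [(abs_lt.1 hx₀).1]
  have h3 : ε * (inner ℂ n (T n)).re ≤ x₀ * ‖n‖ ^ 2 + 8 / g * ‖T n‖ ^ 2 := by
    refine hasSum_le (fun i => ?_) h1 h2
    have := mul_le_mul_of_nonneg_right (hterm i) (sq_nonneg ‖inner ℂ (D.b i) n‖)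
    linarith
  have h4 : ‖T n‖ ^ 2 ≤ κ ^ 2 := by
    have := hT n
    rw [hn1, mul_one] at this
    gcongr
  rw [hn1, one_pow, mul_one] at h3
  have : 8 / g * ‖T n‖ ^ 2 ≤ 8 / g * κ ^ 2 := by gcongr
  linarith

end Perturbation

end Abstract

/-! ### The cube root of unity -/

lemma omega_pow_three : omega ^ 3 = 1 := by
  rw [omega, ← Complex.exp_nat_mul]
  convert Complex.exp_two_pi_mul_I using 2
  push_cast
  ring

lemma omega_eq : omega = -(1 / 2) + (Real.sqrt 3 / 2 : ℝ) * Complex.I := by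
  have h : (2 * Real.pi * Complex.I / 3 : ℂ) = ((2 * Real.pi / 3 : ℝ) : ℂ) * Complex.I := by
    push_cast; ring
  have hc : Real.cos (2 * Real.pi / 3) = -(1 / 2) := by
    rw [show 2 * Real.pi / 3 = Real.pi - Real.pi / 3 by ring, Real.cos_pi_sub,
      Real.cos_pi_div_three]
  have hs : Real.sin (2 * Real.pi / 3) = Real.sqrt 3 / 2 := by
    rw [show 2 * Real.pi / 3 = Real.pi - Real.pi / 3 by ring, Real.sin_pi_sub,
      Real.sin_pi_div_three]
  rw [omega, h, Complex.exp_mul_I, ← Complex.ofReal_cos, ← Complex.ofReal_sin, hc, hs]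
  push_cast
  ring

lemma omega_re : omega.re = -(1 / 2) := by
  rw [omega_eq]; simp

lemma omega_im : omega.im = Real.sqrt 3 / 2 := by
  rw [omega_eq]; simp

lemma omega_sq_add : omega ^ 2 + omega + 1 = 0 := by
  have h : (omega - 1) * (omega ^ 2 + omega + 1) = 0 := by linear_combination omega_pow_three
  refine (mul_eq_zero.1 h).resolve_left fun h1 => ?_
  have := congrArg Complex.re h1
  rw [Complex.sub_re, omega_re] at this
  norm_num at this

lemma conj_omega : conj omega = omega ^ 2 := by
  have h : omega ^ 2 = -1 - omega := by linear_combination omega_sq_add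
  rw [h]
  apply Complex.ext
  · rw [Complex.conj_re, Complex.sub_re, omega_re]; norm_num
  · rw [Complex.conj_im, Complex.sub_im]; simp

lemma omega_ne_one : omega ≠ 1 := fun h => by
  have := congrArg Complex.re h
  rw [omega_re] at this
  norm_num at this

lemma omega_sq_ne_one : omega ^ 2 ≠ 1 := fun h => by
  have h3 := omega_pow_three
  rw [pow_succ, h, one_mul] at h3
  exact omega_ne_one h3

/-! ### A two-parameter family with the symmetries of the honeycomb -/

/-- A family `G⁻¹ + B₀ + α W₁ + lam W₂` of self-adjoint operators with compact resolvent, together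
with a rotation `R` of order three which commutes with it, an operator `Q` (a reflection combined
with an exchange of sublattices) which anticommutes with it, and an operator `J` with adjoint `J'`
such that the Bloch momentum `k` enters as `conj k J + k J'`. -/
structure HoneycombFamily (E : Type*) [NormedAddCommGroup E] [InnerProductSpace ℂ E] where
  /-- the inverse of the unbounded part -/
  G : E →L[ℂ] E
  /-- the constant bounded part -/
  B₀ : E →L[ℂ] E
  /-- the potential with coefficient `α` -/
  W₁ : E →L[ℂ] E
  /-- the potential with coefficient `lam` -/
  W₂ : E →L[ℂ] E
  /-- the rotation -/
  R : E →L[ℂ] E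
  /-- the chiral reflection -/
  Q : E →L[ℂ] E
  /-- the coefficient of `conj k` -/
  J : E →L[ℂ] E
  /-- the coefficient of `k` -/
  J' : E →L[ℂ] E
  compact_G : IsCompactOperator G
  symm_G : (G : E →ₗ[ℂ] E).IsSymmetric
  injective_G : Function.Injective G
  symm_B₀ : (B₀ : E →ₗ[ℂ] E).IsSymmetric
  symm_W₁ : (W₁ : E →ₗ[ℂ] E).IsSymmetric
  symm_W₂ : (W₂ : E →ₗ[ℂ] E).IsSymmetric
  inner_R : ∀ u v, inner ℂ (R u) (R v) = inner ℂ u v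
  R_cube : ∀ u, R (R (R u)) = u
  norm_Q : ∀ u, ‖Q u‖ = ‖u‖
  R_J : ∀ u, R (J u) = omega • J (R u)
  R_Q : ∀ u, R (Q u) = omega ^ 2 • Q (R (R u))
  symm_JQ : ∀ u v, inner ℂ (J (Q u)) v = inner ℂ u (J (Q v))
  inner_J : ∀ u v, inner ℂ (J u) v = inner ℂ u (J' v)
  norm_T : ∀ (k : ℂ) u, ‖conj k • J u + k • J' u‖ ≤ ‖k‖ * ‖u‖
  graph_R : ∀ (p : ℝ × ℝ) u f, OpGraph G (B₀ + ((p.1 : ℂ) • W₁ + (p.2 : ℂ) • W₂)) u f →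
    OpGraph G (B₀ + ((p.1 : ℂ) • W₁ + (p.2 : ℂ) • W₂)) (R u) (R f)
  graph_Q : ∀ (p : ℝ × ℝ) u f, OpGraph G (B₀ + ((p.1 : ℂ) • W₁ + (p.2 : ℂ) • W₂)) u f →
    OpGraph G (B₀ + ((p.1 : ℂ) • W₁ + (p.2 : ℂ) • W₂)) (Q u) (-Q f)

namespace HoneycombFamily

variable {E : Type*} [NormedAddCommGroup E] [InnerProductSpace ℂ E] (F : HoneycombFamily E)

/-- The bounded part at the parameter `p = (α, lam)`. -/
def B (p : ℝ × ℝ) : E →L[ℂ] E := F.B₀ + ((p.1 : ℂ) • F.W₁ + (p.2 : ℂ) • F.W₂)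

/-- The perturbation by the Bloch momentum `k`. -/
def T (k : ℂ) : E →L[ℂ] E := conj k • F.J + k • F.J'

/-- The kernel at `k = 0`. -/
abbrev K (p : ℝ × ℝ) : Submodule ℂ E := opEigenspace F.G (F.B p) 0

lemma isSymmetric_add {A C : E →L[ℂ] E} (hA : (A : E →ₗ[ℂ] E).IsSymmetric)
    (hC : (C : E →ₗ[ℂ] E).IsSymmetric) : ((A + C : E →L[ℂ] E) : E →ₗ[ℂ] E).IsSymmetric :=
  fun u v => by
    have h1 := hA u v
    have h2 := hC u v
    simp only [ContinuousLinearMap.coe_coe] at h1 h2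
    change inner ℂ (A u + C u) v = inner ℂ u (A v + C v)
    rw [inner_add_left, inner_add_right, h1, h2]

lemma isSymmetric_real_smul {A : E →L[ℂ] E} (hA : (A : E →ₗ[ℂ] E).IsSymmetric) (x : ℝ) :
    (((x : ℂ) • A : E →L[ℂ] E) : E →ₗ[ℂ] E).IsSymmetric := fun u v => by
  have h1 := hA u v
  simp only [ContinuousLinearMap.coe_coe] at h1
  change inner ℂ ((x : ℂ) • A u) v = inner ℂ u ((x : ℂ) • A v)
  rw [inner_smul_left, inner_smul_right, h1, Complex.conj_ofReal]

lemma symm_B (p : ℝ × ℝ) : (F.B p : E →ₗ[ℂ] E).IsSymmetric :=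
  isSymmetric_add F.symm_B₀ (isSymmetric_add (isSymmetric_real_smul F.symm_W₁ _)
    (isSymmetric_real_smul F.symm_W₂ _))

lemma inner_J' (u v : E) : inner ℂ (F.J' u) v = inner ℂ u (F.J v) := by
  rw [← inner_conj_symm, ← F.inner_J, inner_conj_symm]

lemma T_apply (k : ℂ) (u : E) : F.T k u = conj k • F.J u + k • F.J' u := rfl

lemma symm_T (k : ℂ) : (F.T k : E →ₗ[ℂ] E).IsSymmetric := fun u v => by
  change inner ℂ (F.T k u) v = inner ℂ u (F.T k v)
  rw [T_apply, T_apply, inner_add_left, inner_add_right, inner_smul_left, inner_smul_left,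
    inner_smul_right, inner_smul_right, F.inner_J, F.inner_J', Complex.conj_conj, add_comm]

lemma inner_T (k : ℂ) (u : E) :
    inner ℂ u (F.T k u) = ((2 * (conj k * inner ℂ u (F.J u)).re : ℝ) : ℂ) := by
  rw [T_apply, inner_add_right, inner_smul_right, inner_smul_right, ← F.inner_J,
    ← inner_conj_symm (F.J u) u]
  have := Complex.add_conj (conj k * inner ℂ u (F.J u))
  rw [map_mul, Complex.conj_conj] at this
  exact this

variable {F} {p : ℝ × ℝ} {u v φ : E}

lemma R_mem (hu : u ∈ F.K p) : F.R u ∈ F.K p := by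
  rw [mem_opEigenspace_zero] at *
  have h := F.graph_R p u 0 hu
  rwa [map_zero] at h

lemma Q_mem (hu : u ∈ F.K p) : F.Q u ∈ F.K p := by
  rw [mem_opEigenspace_zero] at *
  have h := F.graph_Q p u 0 hu
  rwa [map_zero, neg_zero] at h

/-- Eigenvectors of the rotation for different eigenvalues are orthogonal. -/
lemma inner_eq_zero_of_R {a b : ℂ} (hu : F.R u = a • u) (hv : F.R v = b • v)
    (h : conj a * b ≠ 1) : inner ℂ u v = 0 := by
  have h1 := F.inner_R u v
  rw [hu, hv, inner_smul_left, inner_smul_right, ← mul_assoc, ← sub_eq_zero, ← sub_one_mul] at h1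
  exact (mul_eq_zero.1 h1).resolve_left (sub_ne_zero.2 h)

lemma R_Q_of_fixed (hφ : F.R φ = φ) : F.R (F.Q φ) = omega ^ 2 • F.Q φ := by
  rw [F.R_Q, hφ, hφ]

lemma conj_omega_sq : conj (omega ^ 2) = omega := by
  rw [map_pow, conj_omega]
  linear_combination omega * omega_pow_three

lemma inner_Q_of_fixed (hφ : F.R φ = φ) (hu : F.R u = u) : inner ℂ u (F.Q φ) = 0 :=
  inner_eq_zero_of_R (a := 1) (by rw [hu, one_smul]) (R_Q_of_fixed hφ)
    (by simpa using omega_sq_ne_one)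

/-- In a kernel of dimension two, a vector orthogonal to two nonzero orthogonal vectors
vanishes. -/
lemma eq_zero_of_orthogonal {K : Submodule ℂ E} (hdim : Module.finrank ℂ K = 2) {a b c : E}
    (ha : a ∈ K) (hb : b ∈ K) (hc : c ∈ K) (ha0 : a ≠ 0) (hb0 : b ≠ 0)
    (hab : inner ℂ a b = 0) (hac : inner ℂ a c = 0) (hbc : inner ℂ b c = 0) : c = 0 := by
  by_contra hc0
  have : FiniteDimensional ℂ K := .of_finrank_pos (by omega)
  let v : Fin 3 → K := ![⟨a, ha⟩, ⟨b, hb⟩, ⟨c, hc⟩]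
  have hsymm : ∀ {x y : E}, inner ℂ x y = 0 → inner ℂ y x = 0 := fun h =>
    inner_eq_zero_symm.1 h
  have hli : LinearIndependent ℂ v := by
    refine linearIndependent_of_ne_zero_of_inner_eq_zero (𝕜 := ℂ) ?_ ?_
    · intro i h
      have h' := congrArg (fun x : K => (x : E)) h
      fin_cases i
      · exact ha0 h'
      · exact hb0 h'
      · exact hc0 h'
    · intro i j hij
      rw [Submodule.coe_inner]
      fin_cases i <;> fin_cases j
      · exact absurd rfl hij
      · exact hab
      · exact hac
      · exact hsymm hab
      · exact absurd rfl hij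
      · exact hbc
      · exact hsymm hac
      · exact hsymm hbc
      · exact absurd rfl hij
  have := hli.fintype_card_le_finrank
  rw [hdim, Fintype.card_fin] at this
  omega

lemma Q_ne_zero (hφ : φ ≠ 0) : F.Q φ ≠ 0 := by
  rw [← norm_ne_zero_iff, F.norm_Q]
  exact norm_ne_zero_iff.2 hφ

lemma inner_sub_smul_self (hφ0 : φ ≠ 0) (u : E) :
    inner ℂ φ (u - (inner ℂ φ u / inner ℂ φ φ) • φ) = 0 := by
  rw [inner_sub_right, inner_smul_right, div_mul_cancel₀ _ (inner_self_ne_zero.2 hφ0), sub_self]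

/-- The rotation-invariant vectors in the kernel form at most a line. -/
lemma eq_smul_of_fixed (hdim : Module.finrank ℂ (F.K p) = 2) (hφK : φ ∈ F.K p)
    (hφ : F.R φ = φ) (hφ0 : φ ≠ 0) (huK : u ∈ F.K p) (hu : F.R u = u) :
    u = (inner ℂ φ u / inner ℂ φ φ) • φ := by
  set c := inner ℂ φ u / inner ℂ φ φ with hc
  have hfix : F.R (u - c • φ) = u - c • φ := by rw [map_sub, map_smul, hu, hφ]
  rw [← sub_eq_zero]
  exact eq_zero_of_orthogonal hdim hφK (Q_mem hφK)
    (Submodule.sub_mem _ huK (Submodule.smul_mem _ _ hφK)) hφ0 (Q_ne_zero hφ0)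
    (inner_Q_of_fixed hφ hφ) (inner_sub_smul_self hφ0 u)
    (inner_eq_zero_symm.1 (inner_Q_of_fixed hφ hfix))

variable (F)

open Classical in
/-- The Fermi velocity `⟨φ, J Q φ⟩ / ⟨φ, φ⟩`, for a rotation-invariant vector `φ` in the kernel; it
is zero if there is no such vector. -/
noncomputable def vF (p : ℝ × ℝ) : ℝ :=
  if h : ∃ φ ∈ F.K p, F.R φ = φ ∧ φ ≠ 0 then
    (inner ℂ h.choose (F.J (F.Q h.choose))).re / ‖h.choose‖ ^ 2 else 0

variable {F}

lemma inner_JQ_im (u : E) : (inner ℂ u (F.J (F.Q u))).im = 0 := by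
  have h := F.symm_JQ u u
  rw [← inner_conj_symm] at h
  exact Complex.conj_eq_iff_im.1 h

lemma vF_eq (hdim : Module.finrank ℂ (F.K p) = 2) (hφK : φ ∈ F.K p)
    (hφ : F.R φ = φ) (hφ0 : φ ≠ 0) :
    F.vF p = (inner ℂ φ (F.J (F.Q φ))).re / ‖φ‖ ^ 2 := by
  have h : ∃ φ ∈ F.K p, F.R φ = φ ∧ φ ≠ 0 := ⟨φ, hφK, hφ, hφ0⟩
  rw [vF, dif_pos h]
  obtain ⟨hK, hR, h0⟩ := h.choose_spec
  set ψ := h.choose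
  have hψ := eq_smul_of_fixed hdim hφK hφ hφ0 hK hR
  set c := inner ℂ φ ψ / inner ℂ φ φ
  have hc : c ≠ 0 := fun h => h0 (by rw [hψ, h, zero_smul])
  rw [hψ, map_smul, map_smul, inner_smul_left, inner_smul_right, ← mul_assoc,
    ← Complex.normSq_eq_conj_mul_self, Complex.re_ofReal_mul, norm_smul, mul_pow,
    Complex.normSq_eq_norm_sq, mul_div_mul_left]
  exact pow_ne_zero 2 (norm_ne_zero_iff.2 hc)

/-- If the kernel contains no rotation-invariant vector, then the rotation acts on it as the
scalar `ω`. -/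
lemma R_eq_omega (hno : ¬∃ φ ∈ F.K p, F.R φ = φ ∧ φ ≠ 0) (hu : u ∈ F.K p) :
    F.R u = omega • u := by
  have hzero : ∀ v ∈ F.K p, F.R v = v → v = 0 := fun v hv hR => by
    by_contra h0
    exact hno ⟨v, hv, hR, h0⟩
  have hR1 := R_mem hu
  have hR2 := R_mem hR1
  have h1 : u + F.R u + F.R (F.R u) = 0 := by
    refine hzero _ (Submodule.add_mem _ (Submodule.add_mem _ hu hR1) hR2) ?_
    rw [map_add, map_add, F.R_cube]
    abel
  set w := u + omega • F.R u + omega ^ 2 • F.R (F.R u) with hw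
  have hwK : w ∈ F.K p := Submodule.add_mem _ (Submodule.add_mem _ hu
    (Submodule.smul_mem _ _ hR1)) (Submodule.smul_mem _ _ hR2)
  have hRw : F.R w = omega ^ 2 • w := by
    rw [hw, map_add, map_add, map_smul, map_smul, F.R_cube, smul_add, smul_add, smul_smul,
      smul_smul, ← pow_succ, ← pow_add, omega_pow_three, show omega ^ (2 + 2) = omega by
        linear_combination omega * omega_pow_three, one_smul]
    abel
  have h2 : w = 0 := by
    by_contra hw0
    refine Q_ne_zero hw0 (hzero _ (Q_mem hwK) ?_)
    rw [F.R_Q, hRw, map_smul, hRw, map_smul, map_smul, smul_smul, smul_smul]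
    rw [show omega ^ 2 * omega ^ 2 * omega ^ 2 = 1 by
      linear_combination (omega ^ 3 + 1) * omega_pow_three, one_smul]
  -- eliminate the image of `u` under the square of the rotation
  have h3 : (omega ^ 2 - 1) • u + (omega ^ 2 - omega) • F.R u = 0 := by
    have : (omega ^ 2 - 1) • u + (omega ^ 2 - omega) • F.R u =
        omega ^ 2 • (u + F.R u + F.R (F.R u)) - w := by
      rw [hw]; module
    rw [this, h1, h2]
    simp
  have h4 : (omega ^ 2 - omega) • (F.R u - omega • u) = 0 := by
    rw [← h3]
    have : omega ^ 2 - 1 = -((omega ^ 2 - omega) * omega) := by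
      linear_combination omega_pow_three
    rw [this]
    module
  refine sub_eq_zero.1 ((smul_eq_zero.1 h4).resolve_left ?_)
  rw [show omega ^ 2 - omega = omega * (omega - 1) by ring]
  refine mul_ne_zero (fun h => ?_) (sub_ne_zero.2 omega_ne_one)
  have := omega_pow_three
  rw [h] at this
  norm_num at this

lemma vF_eq_zero (hno : ¬∃ φ ∈ F.K p, F.R φ = φ ∧ φ ≠ 0) : F.vF p = 0 := by
  rw [vF, dif_neg hno]

lemma exists_norm_one_mul_eq (z : ℂ) : ∃ c : ℂ, ‖c‖ = 1 ∧ z * c = (‖z‖ : ℂ) := by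
  rcases eq_or_ne z 0 with rfl | hz
  · exact ⟨1, by simp⟩
  · have h : ‖z‖ ≠ 0 := norm_ne_zero_iff.2 hz
    refine ⟨conj z / ‖z‖, ?_, ?_⟩
    · rw [norm_div, RCLike.norm_conj, Complex.norm_real, norm_norm, div_self h]
    · rw [← mul_div_assoc, Complex.mul_conj, Complex.normSq_eq_norm_sq, Complex.ofReal_pow, sq,
        mul_div_assoc, div_self (by exact_mod_cast h), mul_one]

/-- First order perturbation theory in the kernel: the compression of `T k` to the kernel has the
eigenvalues `± |v_F| |k|`. -/
lemma kernel_form (hdim : Module.finrank ℂ (F.K p) = 2) (k : ℂ) :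
    (∀ n ∈ F.K p, ‖inner ℂ n (F.T k n)‖ ≤ |F.vF p| * ‖k‖ * ‖n‖ ^ 2) ∧
      ∀ ε : ℝ, |ε| = 1 → ∃ n ∈ F.K p, ‖n‖ = 1 ∧
        ε * (inner ℂ n (F.T k n)).re = |F.vF p| * ‖k‖ := by
  by_cases hex : ∃ φ ∈ F.K p, F.R φ = φ ∧ φ ≠ 0
  · obtain ⟨φ₀, hφ₀K, hφ₀, hφ₀0⟩ := hex
    obtain ⟨φ, hφK, hφ, hφ1⟩ : ∃ φ ∈ F.K p, F.R φ = φ ∧ ‖φ‖ = 1 := by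
      refine ⟨((‖φ₀‖⁻¹ : ℝ) : ℂ) • φ₀, Submodule.smul_mem _ _ hφ₀K, by rw [map_smul, hφ₀], ?_⟩
      rw [norm_smul, Complex.norm_real, norm_inv, norm_norm,
        inv_mul_cancel₀ (norm_ne_zero_iff.2 hφ₀0)]
    have hφ0 : φ ≠ 0 := norm_ne_zero_iff.1 (by rw [hφ1]; exact one_ne_zero)
    set ψ := F.Q φ with hψ
    have hψ1 : ‖ψ‖ = 1 := by rw [hψ, F.norm_Q, hφ1]
    have hψ0 : ψ ≠ 0 := Q_ne_zero hφ0
    have hψK : ψ ∈ F.K p := Q_mem hφK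
    have hRψ : F.R ψ = omega ^ 2 • ψ := R_Q_of_fixed hφ
    have hφR : F.R φ = (1 : ℂ) • φ := by rw [hφ, one_smul]
    have hφψ : inner ℂ φ ψ = 0 := inner_Q_of_fixed hφ hφ
    have hRJφ : F.R (F.J φ) = omega • F.J φ := by rw [F.R_J, hφ]
    have hRJψ : F.R (F.J ψ) = (1 : ℂ) • F.J ψ := by
      rw [F.R_J, hRψ, map_smul, smul_smul, ← pow_succ', omega_pow_three]
    have e1 : inner ℂ φ (F.J φ) = 0 :=
      inner_eq_zero_of_R hφR hRJφ (by simpa using omega_ne_one)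
    have e2 : inner ℂ ψ (F.J φ) = 0 :=
      inner_eq_zero_of_R hRψ hRJφ (by rw [conj_omega_sq, ← sq]; exact omega_sq_ne_one)
    have e3 : inner ℂ ψ (F.J ψ) = 0 :=
      inner_eq_zero_of_R hRψ hRJψ (by rw [conj_omega_sq, mul_one]; exact omega_ne_one)
    have e4 : inner ℂ φ (F.J ψ) = (F.vF p : ℂ) := by
      rw [vF_eq hdim hφK hφ hφ0, hφ1, one_pow, div_one]
      exact Complex.ext (by rw [Complex.ofReal_re]) (by simpa using inner_JQ_im φ)
    have hφφ : inner ℂ φ φ = 1 := by rw [inner_self_eq_norm_sq_to_K, hφ1]; simp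
    have hψψ : inner ℂ ψ ψ = 1 := by rw [inner_self_eq_norm_sq_to_K, hψ1]; simp
    have hψφ : inner ℂ ψ φ = 0 := inner_eq_zero_symm.1 hφψ
    have hform : ∀ a b : ℂ, inner ℂ (a • φ + b • ψ) (F.T k (a • φ + b • ψ)) =
        ((2 * (conj k * F.vF p * (conj a * b)).re : ℝ) : ℂ) := fun a b => by
      rw [F.inner_T]
      congr 3
      rw [map_add, map_smul, map_smul, inner_add_left, inner_add_right, inner_add_right]
      simp only [inner_smul_left, inner_smul_right, e1, e2, e3, e4]
      ring_nf
    have hnorm : ∀ a b : ℂ, ‖a • φ + b • ψ‖ ^ 2 = ‖a‖ ^ 2 + ‖b‖ ^ 2 := fun a b => by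
      rw [@norm_add_sq ℂ, inner_smul_left, inner_smul_right, hφψ, norm_smul, norm_smul, hφ1, hψ1]
      simp
    refine ⟨fun n hn => ?_, fun ε hε => ?_⟩
    · set a := inner ℂ φ n
      set b := inner ℂ ψ n
      have hn' : n - (a • φ + b • ψ) = 0 := by
        refine eq_zero_of_orthogonal hdim hφK hψK (Submodule.sub_mem _ hn (Submodule.add_mem _
          (Submodule.smul_mem _ _ hφK) (Submodule.smul_mem _ _ hψK))) hφ0 hψ0 hφψ ?_ ?_
        · rw [inner_sub_right, inner_add_right, inner_smul_right, inner_smul_right, hφφ, hφψ]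
          simp [a]
        · rw [inner_sub_right, inner_add_right, inner_smul_right, inner_smul_right, hψφ, hψψ]
          simp [b]
      rw [sub_eq_zero.1 hn', hform, hnorm, Complex.norm_real, Real.norm_eq_abs, abs_mul]
      have h1 : |(conj k * F.vF p * (conj a * b)).re| ≤ ‖k‖ * |F.vF p| * (‖a‖ * ‖b‖) := by
        refine (Complex.abs_re_le_norm _).trans ?_
        simp
      have h2 : 0 ≤ ‖k‖ * |F.vF p| := by positivity
      rw [abs_two]
      nlinarith [sq_nonneg (‖a‖ - ‖b‖)]
    · obtain ⟨c, hc1, hc⟩ := exists_norm_one_mul_eq (conj k * (F.vF p : ℂ))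
      have hs : (Real.sqrt 2) ^ 2 = 2 := Real.sq_sqrt zero_le_two
      have hs0 : Real.sqrt 2 ≠ 0 := by positivity
      set a : ℝ := (Real.sqrt 2)⁻¹ with ha
      have ha2 : a ^ 2 = 1 / 2 := by rw [ha, inv_pow, hs, one_div]
      refine ⟨(a : ℂ) • φ + ((ε * a : ℝ) * c) • ψ, Submodule.add_mem _
        (Submodule.smul_mem _ _ hφK) (Submodule.smul_mem _ _ hψK), ?_, ?_⟩
      · have h := hnorm a ((ε * a : ℝ) * c)
        have hε2 : ε ^ 2 = 1 := by rw [← sq_abs, hε, one_pow]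
        rw [norm_mul, hc1, Complex.norm_real, Complex.norm_real, Real.norm_eq_abs,
          Real.norm_eq_abs, mul_one, sq_abs, sq_abs, mul_pow, hε2, ha2] at h
        refine (pow_eq_one_iff_of_nonneg (norm_nonneg _) two_ne_zero).1 (h.trans ?_)
        norm_num
      · rw [hform, Complex.ofReal_re, Complex.conj_ofReal]
        have h : conj k * (F.vF p : ℂ) * ((a : ℂ) * ((ε * a : ℝ) * c)) =
            ((ε * a ^ 2 * ‖conj k * (F.vF p : ℂ)‖ : ℝ) : ℂ) := by
          push_cast
          rw [← hc]
          ring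
        have hε2 : ε * ε = 1 := by rw [← sq, ← sq_abs, hε, one_pow]
        rw [h, Complex.ofReal_re, ha2, norm_mul, RCLike.norm_conj, Complex.norm_real,
          Real.norm_eq_abs]
        linear_combination (‖k‖ * |F.vF p|) * hε2
  · have hzero : ∀ n ∈ F.K p, inner ℂ n (F.T k n) = 0 := fun n hn => by
      have h1 := R_eq_omega hex hn
      have h2 : F.R (F.J n) = omega ^ 2 • F.J n := by
        rw [F.R_J, h1, map_smul, smul_smul, sq]
      have h3 : inner ℂ n (F.J n) = 0 := inner_eq_zero_of_R h1 h2 (by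
        rw [conj_omega, ← pow_add, show omega ^ (2 + 2) = omega by
          linear_combination omega * omega_pow_three]
        exact omega_ne_one)
      rw [F.inner_T, h3]
      simp
    rw [vF_eq_zero hex]
    refine ⟨fun n hn => by simp [hzero n hn], fun ε _ => ?_⟩
    have : Nontrivial (F.K p) := Module.nontrivial_of_finrank_pos (R := ℂ) (by omega)
    obtain ⟨n, hn⟩ := exists_ne (0 : F.K p)
    have hn0 : (n : E) ≠ 0 := by simpa using hn
    have hm : ((‖(n : E)‖⁻¹ : ℝ) : ℂ) • (n : E) ∈ F.K p := Submodule.smul_mem _ _ n.2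
    refine ⟨_, hm, ?_, ?_⟩
    · rw [norm_smul, Complex.norm_real, norm_inv, norm_norm,
        inv_mul_cancel₀ (norm_ne_zero_iff.2 hn0)]
    · rw [hzero _ hm]
      simp

end HoneycombFamily

namespace HoneycombFamily

variable {E : Type*} [NormedAddCommGroup E] [InnerProductSpace ℂ E]
  {F : HoneycombFamily E} {p q : ℝ × ℝ}

/-! ### Analytic dependence of the kernel on the parameters -/

/-- The projection to the kernel at `q` commutes with the rotation. -/
lemma starProjection_R [FiniteDimensional ℂ (F.K q)] (u : E) :
    (F.K q).starProjection (F.R u) = F.R ((F.K q).starProjection u) := by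
  refine Submodule.eq_starProjection_of_mem_orthogonal
    (R_mem (Submodule.starProjection_apply_mem _ _)) ?_
  rw [← map_sub, Submodule.mem_orthogonal]
  intro m hm
  rw [← F.R_cube m, F.inner_R]
  exact (Submodule.mem_orthogonal _ _).1 (Submodule.sub_starProjection_mem_orthogonal u) _
    (R_mem (R_mem hm))

variable (F) in
/-- The operator `1 + G (B p + P)`, with `P` the projection to the kernel at `q`; it is invertible
at `p = q`, hence near `q`. -/
noncomputable def S (q : ℝ × ℝ) [FiniteDimensional ℂ (F.K q)] (p : ℝ × ℝ) : E →L[ℂ] E :=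
  1 + F.G * (F.B p + (F.K q).starProjection)

lemma isUnit_S [CompleteSpace E] [FiniteDimensional ℂ (F.K q)] : IsUnit (F.S q q) := by
  refine isUnit_one_add_comp F.compact_G fun u hu => ?_
  -- pair the equation with the projection of `u`
  set P := (F.K q).starProjection
  have h1 := hu.of_add_right P
  have hPu : P u ∈ F.K q := Submodule.starProjection_apply_mem _ _
  have h2 := OpGraph.inner_comm F.symm_G (F.symm_B q) (mem_opEigenspace_zero.1 hPu) h1
  rw [inner_zero_left, zero_sub, inner_neg_right, neg_eq_zero, inner_self_eq_zero] at h2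
  rw [h2, sub_zero] at h1
  have h3 : P u = u := Submodule.starProjection_eq_self_iff.2 (mem_opEigenspace_zero.2 h1)
  rw [← h3, h2]

lemma S_apply_iff [FiniteDimensional ℂ (F.K q)] (u f : E) :
    F.S q p u = F.G f ↔ OpGraph F.G (F.B p + (F.K q).starProjection) u f := by
  simp only [S, OpGraph, add_apply, mul_apply_eq_comp,
    one_apply_eq_self, map_sub]
  exact ⟨fun h => by rw [← h]; abel, fun h => by nth_rewrite 1 [h]; abel⟩

lemma contDiff_S [FiniteDimensional ℂ (F.K q)] : ContDiff ℝ ω (F.S q) := by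
  have h : ∀ p, F.S q p = 1 + F.G * (F.B₀ + (p.1 • F.W₁ + p.2 • F.W₂) + (F.K q).starProjection) :=
    fun p => rfl
  rw [funext h]
  fun_prop

lemma eventually_isUnit_S [CompleteSpace E] [FiniteDimensional ℂ (F.K q)] :
    ∀ᶠ p in 𝓝 q, IsUnit (F.S q p) :=
  (contDiff_S (F := F) (q := q)).continuous.continuousAt.eventually_mem
    (Units.isOpen.mem_nhds isUnit_S)

/-- The transported vector `(1 + G (B p + P))⁻¹ G n`. -/
noncomputable def transport (F : HoneycombFamily E) (q : ℝ × ℝ) [FiniteDimensional ℂ (F.K q)]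
    (p : ℝ × ℝ) (n : E) : E := Ring.inverse (F.S q p) (F.G n)

lemma eq_transport_iff [FiniteDimensional ℂ (F.K q)] (hS : IsUnit (F.S q p)) (n u : E) :
    u = F.transport q p n ↔ OpGraph F.G (F.B p + (F.K q).starProjection) u n := by
  rw [← S_apply_iff, transport]
  constructor
  · rintro rfl
    rw [← mul_apply_eq_comp, Ring.mul_inverse_cancel _ hS,
      one_apply_eq_self]
  · intro h
    rw [← h, ← mul_apply_eq_comp, Ring.inverse_mul_cancel _ hS,
      one_apply_eq_self]

lemma transport_R [FiniteDimensional ℂ (F.K q)] (hS : IsUnit (F.S q p)) (n : E) :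
    F.R (F.transport q p n) = F.transport q p (F.R n) := by
  rw [eq_transport_iff hS]
  have h1 := ((eq_transport_iff hS n _).1 rfl).of_add_right (F.K q).starProjection
  have h2 : OpGraph F.G (F.B p) _ _ := F.graph_R p _ _ h1
  have h3 := h2.add_right (F.K q).starProjection
  rwa [map_sub, starProjection_R, sub_add_cancel] at h3

lemma transport_smul [FiniteDimensional ℂ (F.K q)] (c : ℂ) (n : E) :
    F.transport q p (c • n) = c • F.transport q p n := by
  simp [transport]

lemma transport_add [FiniteDimensional ℂ (F.K q)] (m n : E) :
    F.transport q p (m + n) = F.transport q p m + F.transport q p n := by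
  simp [transport]

lemma transport_injective [FiniteDimensional ℂ (F.K q)] (hS : IsUnit (F.S q p)) {n : E}
    (hn : F.transport q p n = 0) : n = 0 := by
  have h := (eq_transport_iff hS n _).1 rfl
  rw [hn, OpGraph, map_zero, sub_zero] at h
  exact F.injective_G (by rw [← h, map_zero])

/-- If the kernels at `p` and `q` have the same finite dimension, then the kernel at `p` consists
of the transported vectors. -/
lemma mem_K_iff [FiniteDimensional ℂ (F.K q)] (hS : IsUnit (F.S q p))
    (hdim : Module.finrank ℂ (F.K p) = Module.finrank ℂ (F.K q)) (u : E) :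
    u ∈ F.K p ↔ ∃ n ∈ F.K q, u = F.transport q p n := by
  let t : E →ₗ[ℂ] E :=
    { toFun := F.transport q p, map_add' := transport_add, map_smul' := transport_smul }
  have ht : Function.Injective t := LinearMap.ker_eq_bot.1
    (LinearMap.ker_eq_bot'.2 fun n hn => transport_injective hS hn)
  have hle : F.K p ≤ (F.K q).map t := fun u hu => by
    refine ⟨_, Submodule.starProjection_apply_mem (F.K q) u, ?_⟩
    refine Eq.symm ((eq_transport_iff hS _ _).2 ?_)
    simpa using (mem_opEigenspace_zero.1 hu).add_right (F.K q).starProjection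
  have hfin : FiniteDimensional ℂ ((F.K q).map t) := inferInstance
  have heq : F.K p = (F.K q).map t := by
    refine Submodule.eq_of_le_of_finrank_eq hle ?_
    rw [hdim]
    exact (LinearEquiv.finrank_eq (Submodule.equivMapOfInjective t ht (F.K q)))
  rw [heq]
  exact ⟨fun ⟨n, hn, h⟩ => ⟨n, hn, h.symm⟩, fun ⟨n, hn, h⟩ => ⟨n, hn, h.symm⟩⟩

lemma contDiffAt_transport [CompleteSpace E] [FiniteDimensional ℂ (F.K q)] (n : E) :
    ContDiffAt ℝ ω (fun p => F.transport q p n) q := by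
  obtain ⟨x, hx⟩ := isUnit_S (F := F) (q := q)
  have h1 : ContDiffAt ℝ ω (fun p => Ring.inverse (F.S q p)) q := by
    refine ContDiffAt.comp (g := Ring.inverse) q ?_ (contDiff_S (F := F) (q := q)).contDiffAt
    rw [← hx]
    exact contDiffAt_ringInverse ℝ x
  exact ((ContinuousLinearMap.apply ℂ E (F.G n)).restrictScalars ℝ).contDiff.contDiffAt.comp q h1

lemma transport_self [CompleteSpace E] [FiniteDimensional ℂ (F.K q)] {n : E} (hn : n ∈ F.K q) :
    F.transport q q n = n := by
  refine Eq.symm ((eq_transport_iff isUnit_S n n).2 ?_)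
  have := (mem_opEigenspace_zero.1 hn).add_right (F.K q).starProjection
  rwa [zero_add, Submodule.starProjection_eq_self_iff.2 hn] at this

/-- The Fermi velocity depends analytically on the parameters as long as the kernel has dimension
two. -/
theorem analyticOnNhd_vF [CompleteSpace E] {Ω : Set (ℝ × ℝ)} (hΩ : IsOpen Ω)
    (hdim : ∀ p ∈ Ω, Module.finrank ℂ (F.K p) = 2) : AnalyticOnNhd ℝ F.vF Ω := by
  intro q hq
  have : FiniteDimensional ℂ (F.K q) := .of_finrank_pos (by rw [hdim q hq]; norm_num)
  have hnear : ∀ᶠ p in 𝓝 q, p ∈ Ω ∧ IsUnit (F.S q p) :=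
    (hΩ.eventually_mem hq).and eventually_isUnit_S
  by_cases hex : ∃ φ ∈ F.K q, F.R φ = φ ∧ φ ≠ 0
  · obtain ⟨φ, hφK, hφ, hφ0⟩ := hex
    have hanalytic : ContDiffAt ℝ ω (fun p => (inner ℂ (F.transport q p φ)
        (F.J (F.Q (F.transport q p φ)))).re / ‖F.transport q p φ‖ ^ 2) q := by
      have h := contDiffAt_transport (F := F) (q := q) φ
      have hJQ : ContDiffAt ℝ ω (fun p => F.J (F.Q (F.transport q p φ))) q :=
        ((F.J * F.Q).restrictScalars ℝ).contDiff.contDiffAt.comp q h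
      refine ContDiffAt.div ?_ (h.norm_sq ℂ) ?_
      · exact Complex.reCLM.contDiff.contDiffAt.comp q (h.inner ℂ hJQ)
      · rw [transport_self hφK]
        exact pow_ne_zero 2 (norm_ne_zero_iff.2 hφ0)
    refine hanalytic.analyticAt.congr ?_
    filter_upwards [hnear] with p hp
    refine (vF_eq (hdim p hp.1) ?_ ?_ ?_).symm
    · exact (mem_K_iff hp.2 (by rw [hdim p hp.1, hdim q hq]) _).2 ⟨φ, hφK, rfl⟩
    · rw [transport_R hp.2, hφ]
    · exact fun h => hφ0 (transport_injective hp.2 h)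
  · refine (analyticAt_const (v := (0 : ℝ))).congr ?_
    filter_upwards [hnear] with p hp
    refine (vF_eq_zero ?_).symm
    rintro ⟨φ, hφK, hφ, hφ0⟩
    obtain ⟨n, hn, rfl⟩ := (mem_K_iff hp.2 (by rw [hdim p hp.1, hdim q hq]) _).1 hφK
    rw [transport_R hp.2, R_eq_omega hex hn, transport_smul] at hφ
    have : (omega - 1) • F.transport q p n = 0 := by rw [sub_smul, one_smul, hφ, sub_self]
    exact hφ0 ((smul_eq_zero.1 this).resolve_left (sub_ne_zero.2 omega_ne_one))

/-! ### The eigenvalues near zero for small Bloch momentum -/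

/-- For small `k` there are exactly two eigenvalues in a fixed neighbourhood of zero, the larger
one is at least `|v_F| |k| - O(|k|²)`, the smaller one is at most `-|v_F| |k| + O(|k|²)`, and both
have modulus at most `|v_F| |k| + O(|k|²)`. -/
theorem exists_cone_bounds [CompleteSpace E] (hdim : Module.finrank ℂ (F.K p) = 2) :
    ∃ δ > 0, ∃ r > 0, ∃ C : ℝ, ∀ k : ℂ, ‖k‖ < r → ∀ D : EigenBasis F.G (F.B p + F.T k),
      {i | |D.e i| < δ}.ncard = 2 ∧
      (∀ i, |D.e i| < δ → |D.e i| ≤ |F.vF p| * ‖k‖ + C * ‖k‖ ^ 2) ∧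
      ∀ ε x₀ : ℝ, |ε| = 1 → |x₀| < δ → (∀ i, |D.e i| < δ → ε * D.e i ≤ x₀) →
        |F.vF p| * ‖k‖ ≤ x₀ + C * ‖k‖ ^ 2 := by
  obtain ⟨D₀⟩ := exists_eigenBasis F.compact_G F.symm_G F.injective_G (F.symm_B p)
  obtain ⟨g, hg, hgap⟩ := D₀.exists_gap F.compact_G F.symm_G (F.symm_B p)
  refine ⟨g / 4, by positivity, g / 4, by positivity, 8 / g, fun k hk D => ?_⟩
  have hsymm := isSymmetric_add (F.symm_B p) (F.symm_T k)
  obtain ⟨hform, htrial⟩ := kernel_form hdim k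
  refine ⟨D.ncard_eq_two F.compact_G F.symm_G hsymm hdim hg hgap (F.norm_T k) hk,
    fun i hi => ?_, fun ε x₀ hε hx₀ hle => ?_⟩
  · refine (D.abs_le_of_lt F.symm_G (F.symm_B p) hdim hg hgap (F.norm_T k) (norm_nonneg k) hk
      hform hi).trans ?_
    gcongr
    norm_num
  · obtain ⟨n, hn, hn1, heq⟩ := htrial ε hε
    rw [← heq]
    exact D.le_of_trial F.symm_G hsymm hg (F.norm_T k) hn hn1 hε hx₀ hle

end HoneycombFamily

/-! ### Numberings of the bands -/

/-- Two families with the same multiplicities agree up to a bijection of the index sets. -/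
lemma exists_equiv_of_multiplicity {ι κ : Type} (e : ι → ℝ) (f : κ → ℝ)
    (h : ∀ x, Cardinal.mk {i // e i = x} = Cardinal.mk {j // f j = x}) :
    ∃ s : ι ≃ κ, ∀ i, f (s i) = e i := by
  have s := fun x => (Cardinal.eq.1 (h x)).some
  refine ⟨(Equiv.sigmaFiberEquiv e).symm.trans ((Equiv.sigmaCongrRight fun x => s x).trans
    (Equiv.sigmaFiberEquiv f)), fun i => ?_⟩
  exact (s (e i) ⟨i, rfl⟩).2

/-- The order isomorphism from the nonzero integers to the integers which maps `-1` to `0` and `1`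
to `1`. -/
def nonzeroEquiv : {j : ℤ // j ≠ 0} ≃ ℤ where
  toFun j := if 0 < (j : ℤ) then j else j + 1
  invFun m := if h : 0 < m then ⟨m, h.ne'⟩ else ⟨m - 1, by omega⟩
  left_inv j := by
    obtain ⟨j, hj⟩ := j
    by_cases h : 0 < j
    · simp [h]
    · have : ¬0 < j + 1 := by omega
      simp [h, this]
  right_inv m := by
    by_cases h : 0 < m
    · simp [h]
    · simp only [h, dif_neg, not_false_eq_true]
      rw [if_neg (by omega), sub_add_cancel]

lemma nonzeroEquiv_le {i j : {j : ℤ // j ≠ 0}} (h : (i : ℤ) ≤ j) :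
    nonzeroEquiv i ≤ nonzeroEquiv j := by
  obtain ⟨i, hi⟩ := i
  obtain ⟨j, hj⟩ := j
  simp only [nonzeroEquiv, Equiv.coe_fn_mk]
  simp only at h
  split_ifs <;> omega

/-- If a nondecreasing sequence on `ℤ` has exactly two terms in `(-δ, δ)`, then these are the first
two terms above `-δ`. -/
lemma abs_lt_of_isLeast {e : ℤ → ℝ} (he : Monotone e) {δ : ℝ}
    (hcard : {m | |e m| < δ}.ncard = 2) {a : ℤ} (ha : -δ < e a) (hmin : ∀ m, -δ < e m → a ≤ m) :
    |e a| < δ ∧ |e (a + 1)| < δ := by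
  have h1 : ∀ m, |e m| < δ → a ≤ m := fun m hm => hmin m (abs_lt.1 hm).1
  have h2 : |e a| < δ := by
    by_contra hcon
    have h3 : δ ≤ e a := not_lt.1 fun h => hcon (abs_lt.2 ⟨ha, h⟩)
    have : {m | |e m| < δ} = ∅ := Set.eq_empty_iff_forall_notMem.2 fun m hm =>
      absurd (abs_lt.1 hm).2 (not_lt.2 (h3.trans (he (h1 m hm))))
    rw [this, Set.ncard_empty] at hcard
    omega
  refine ⟨h2, ?_⟩
  by_contra hcon
  have h3 : δ ≤ e (a + 1) :=
    not_lt.1 fun h => hcon (abs_lt.2 ⟨ha.trans_le (he (by omega)), h⟩)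
  have : {m | |e m| < δ} ⊆ {a} := fun m hm => by
    by_contra hne
    have h4 : a + 1 ≤ m := by
      have := h1 m hm
      have h5 : m ≠ a := hne
      omega
    exact absurd (abs_lt.1 hm).2 (not_lt.2 (h3.trans (he h4)))
  have := Set.ncard_le_ncard this
  rw [hcard, Set.ncard_singleton] at this
  omega

namespace HoneycombFamily

variable {E : Type} [NormedAddCommGroup E] [InnerProductSpace ℂ E]
  {F : HoneycombFamily E} {p : ℝ × ℝ} {U V : ℂ → ℂ}

lemma exists_eigenBasis_T [CompleteSpace E] (F : HoneycombFamily E) (p : ℝ × ℝ) (k : ℂ) :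
    Nonempty (EigenBasis F.G (F.B p + F.T k)) :=
  exists_eigenBasis F.compact_G F.symm_G F.injective_G (isSymmetric_add (F.symm_B p) (F.symm_T k))

lemma rank_eq {k : ℂ} (D : EigenBasis F.G (F.B p + F.T k)) (x : ℝ) :
    Module.rank ℂ (opEigenspace F.G (F.B p + F.T k) x) = Cardinal.mk {i // D.e i = x} := by
  simpa using D.rank_opEigenspace F.compact_G F.symm_G
    (isSymmetric_add (F.symm_B p) (F.symm_T k)) x

/-- Every numbering of the bands has a cone at zero momentum. -/
theorem cone_of_isBlochBands [CompleteSpace E] (hdim : Module.finrank ℂ (F.K p) = 2)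
    (hrank : ∀ k x, Module.rank ℂ (eigenspace U V p.1 p.2 k x) =
      Module.rank ℂ (opEigenspace F.G (F.B p + F.T k) x))
    {e : ℤ → ℂ → ℝ} (he : IsBlochBands U V p.1 p.2 e) :
    (fun k : ℂ => e 1 k - |F.vF p| * ‖k‖) =O[𝓝 0] (fun k : ℂ => ‖k‖ ^ 2) ∧
      (fun k : ℂ => e (-1) k - (-(|F.vF p| * ‖k‖))) =O[𝓝 0] (fun k : ℂ => ‖k‖ ^ 2) := by
  obtain ⟨δ, hδ, r, hr, C, h⟩ := exists_cone_bounds hdim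
  have h1 : ∀ᶠ k in 𝓝 (0 : ℂ), |e 1 k| < δ := by
    have := he.continuousAt_pos.abs
    refine this.eventually_lt continuousAt_const ?_
    rwa [he.zero_pos, abs_zero]
  have h2 : ∀ᶠ k in 𝓝 (0 : ℂ), |e (-1) k| < δ := by
    have := he.continuousAt_neg.abs
    refine this.eventually_lt continuousAt_const ?_
    rwa [he.zero_neg, abs_zero]
  have h3 : ∀ᶠ k in 𝓝 (0 : ℂ), ‖k‖ < r :=
    continuous_norm.continuousAt.eventually_lt continuousAt_const (by simpa using hr)
  have key : ∀ᶠ k in 𝓝 (0 : ℂ), |e 1 k - |F.vF p| * ‖k‖| ≤ C * ‖k‖ ^ 2 ∧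
      |e (-1) k - (-(|F.vF p| * ‖k‖))| ≤ C * ‖k‖ ^ 2 := by
    filter_upwards [h1, h2, h3] with k hk1 hk2 hkr
    obtain ⟨D⟩ := exists_eigenBasis_T F p k
    obtain ⟨hcard, hupper, hlower⟩ := h k hkr D
    obtain ⟨s, hs⟩ := exists_equiv_of_multiplicity (fun j : {j : ℤ // j ≠ 0} => e j k) D.e
      fun x => by
        rw [← rank_eq D, ← hrank, ← he.multiplicity k x]
        exact Cardinal.mk_congr (Equiv.subtypeSubtypeEquivSubtypeInter _ (fun j => e j k = x))
    -- the bands `±1` are the two eigenvalues near zero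
    have hpm : ∀ i, |D.e i| < δ → D.e i = e 1 k ∨ D.e i = e (-1) k := fun i hi => by
      set i₁ := s ⟨1, by norm_num⟩
      set i₂ := s ⟨-1, by norm_num⟩
      have hne : i₁ ≠ i₂ := fun h => by
        have := congrArg Subtype.val (s.injective h)
        norm_num at this
      have hsub : ({i₁, i₂} : Set D.ι) ⊆ {i | |D.e i| < δ} := by
        rintro _ (rfl | rfl)
        · change |D.e i₁| < δ
          rwa [hs]
        · change |D.e i₂| < δ
          rwa [hs]
      have heq := Set.eq_of_subset_of_ncard_le hsub (by rw [hcard, Set.ncard_pair hne])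
        (Set.finite_of_ncard_ne_zero (by rw [hcard]; norm_num))
      have hmem : i ∈ ({i₁, i₂} : Set D.ι) := by rw [heq]; exact hi
      rcases hmem with rfl | rfl
      · exact Or.inl (hs _)
      · exact Or.inr (hs _)
    have hle : e (-1) k ≤ e 1 k := he.mono k _ _ (by norm_num) (by norm_num) (by norm_num)
    have hu1 : |e 1 k| ≤ |F.vF p| * ‖k‖ + C * ‖k‖ ^ 2 := by
      have := hupper (s ⟨1, by norm_num⟩)
      rw [hs] at this
      exact this hk1
    have hu2 : |e (-1) k| ≤ |F.vF p| * ‖k‖ + C * ‖k‖ ^ 2 := by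
      have := hupper (s ⟨-1, by norm_num⟩)
      rw [hs] at this
      exact this hk2
    have hl1 := hlower 1 (e 1 k) abs_one hk1 fun i hi => by
      rcases hpm i hi with h | h <;> linarith
    have hl2 := hlower (-1) (-e (-1) k) (by norm_num) (by rwa [abs_neg]) fun i hi => by
      rcases hpm i hi with h | h <;> linarith
    rw [abs_le] at hu1 hu2 ⊢
    rw [abs_le]
    exact ⟨⟨by linarith, by linarith⟩, ⟨by linarith, by linarith⟩⟩
  refine ⟨IsBigO.of_bound C ?_, IsBigO.of_bound C ?_⟩
  · filter_upwards [key] with k hk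
    rw [Real.norm_eq_abs, norm_pow, norm_norm]
    exact hk.1
  · filter_upwards [key] with k hk
    rw [Real.norm_eq_abs, norm_pow, norm_norm]
    exact hk.2

/-- A numbering of the bands exists: for each `k` the sorted list of eigenvalues is shifted so that
the first eigenvalue above `-δ` has the number `-1`, for a fixed small `δ > 0`. -/
theorem exists_isBlochBands [CompleteSpace E] (hdim : Module.finrank ℂ (F.K p) = 2)
    (hrank : ∀ k x, Module.rank ℂ (eigenspace U V p.1 p.2 k x) =
      Module.rank ℂ (opEigenspace F.G (F.B p + F.T k) x))
    {v w : ℕ → E} (hv : Orthonormal ℂ v) (hw : Orthonormal ℂ w) {τ σ : ℕ → ℝ}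
    (hτ : ∀ m, 0 < τ m) (hσ : ∀ m, σ m < 0) (hGv : ∀ m, F.G (v m) = (τ m : ℂ) • v m)
    (hGw : ∀ m, F.G (w m) = (σ m : ℂ) • w m) :
    ∃ e : ℤ → ℂ → ℝ, IsBlochBands U V p.1 p.2 e := by
  obtain ⟨δ, hδ, r, hr, C, h⟩ := exists_cone_bounds hdim
  have D := fun k => (exists_eigenBasis_T F p k).some
  have hsymm := fun k => isSymmetric_add (F.symm_B p) (F.symm_T k)
  choose s hs using fun k => exists_monotone_equiv (D k).e ((D k).finite_le F.compact_G)
    ((D k).infinite_gt F.compact_G F.symm_G (hsymm k) hv hτ hGv)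
    ((D k).infinite_lt F.compact_G F.symm_G (hsymm k) hw hσ hGw)
  have hleast : ∀ k, ∃ a : ℤ, -δ < (D k).e (s k a) ∧ ∀ m, -δ < (D k).e (s k m) → a ≤ m :=
      fun k => by
    obtain ⟨i, hi⟩ := ((D k).infinite_lt F.compact_G F.symm_G (hsymm k) hw hσ hGw (-δ)).nonempty
    obtain ⟨j, hj⟩ := ((D k).infinite_gt F.compact_G F.symm_G (hsymm k) hv hτ hGv (-δ)).nonempty
    refine Int.exists_least_of_bdd ⟨(s k).symm i, fun m hm => ?_⟩
      ⟨(s k).symm j, by simpa using hj⟩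
    by_contra hcon
    have := hs k (not_le.1 hcon).le
    simp only [Function.comp_apply, Equiv.apply_symm_apply] at this
    have hi' : (D k).e i < -δ := hi
    linarith
  choose a ha hmin using hleast
  let t : ∀ k : ℂ, {j : ℤ // j ≠ 0} ≃ (D k).ι := fun k =>
    nonzeroEquiv.trans ((Equiv.addLeft (a k)).trans (s k))
  let e : ℤ → ℂ → ℝ := fun j k => if hj : j ≠ 0 then (D k).e (t k ⟨j, hj⟩) else 0
  have hej : ∀ (j : {j : ℤ // j ≠ 0}) k, e j k = (D k).e (t k j) := fun j k => by
    simp only [e]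
    rw [dif_pos j.2]
  have hneg : ∀ k, e (-1) k = (D k).e (s k (a k)) := fun k => by
    simp [e, t, nonzeroEquiv]
  have hpos : ∀ k, e 1 k = (D k).e (s k (a k + 1)) := fun k => by
    simp [e, t, nonzeroEquiv]
  have hsmall : ∀ k, ‖k‖ < r → |e (-1) k| ≤ |F.vF p| * ‖k‖ + C * ‖k‖ ^ 2 ∧
      |e 1 k| ≤ |F.vF p| * ‖k‖ + C * ‖k‖ ^ 2 := fun k hk => by
    obtain ⟨hcard, hupper, -⟩ := h k hk (D k)
    have hcard' : {m : ℤ | |((D k).e ∘ s k) m| < δ}.ncard = 2 := by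
      rw [← hcard, ← Set.ncard_image_of_injective _ (s k).injective]
      congr 1
      ext i
      exact ⟨fun ⟨m, hm, hmi⟩ => hmi ▸ hm, fun hi => ⟨(s k).symm i, by simpa using hi, by simp⟩⟩
    obtain ⟨h1, h2⟩ := abs_lt_of_isLeast (hs k) hcard' (ha k) (hmin k)
    rw [hneg, hpos]
    exact ⟨hupper _ h1, hupper _ h2⟩
  have hlim : Tendsto (fun k : ℂ => |F.vF p| * ‖k‖ + C * ‖k‖ ^ 2) (𝓝 0) (𝓝 0) := by
    have : Continuous fun k : ℂ => |F.vF p| * ‖k‖ + C * ‖k‖ ^ 2 := by fun_prop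
    simpa using this.tendsto 0
  have h3 : ∀ᶠ k in 𝓝 (0 : ℂ), ‖k‖ < r :=
    continuous_norm.continuousAt.eventually_lt continuousAt_const (by simpa using hr)
  have hz : e (-1) 0 = 0 ∧ e 1 0 = 0 := by
    have := hsmall 0 (by simpa using hr)
    simpa using this
  refine ⟨e, ?_, ?_, hz.2, hz.1, ?_, ?_⟩
  · intro k i j hi hj hij
    rw [hej ⟨i, hi⟩, hej ⟨j, hj⟩]
    exact hs k (add_le_add_right (nonzeroEquiv_le (i := ⟨i, hi⟩) (j := ⟨j, hj⟩) hij) (a k))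
  · intro k x
    rw [hrank, rank_eq (D k)]
    refine Cardinal.mk_congr ?_
    refine (Equiv.subtypeSubtypeEquivSubtypeInter _ (fun j => e j k = x)).symm.trans ?_
    exact (t k).subtypeEquiv fun j => by rw [hej]
  · rw [ContinuousAt, hz.2]
    exact squeeze_zero_norm' (h3.mono fun k hk => (hsmall k hk).2) hlim
  · rw [ContinuousAt, hz.1]
    exact squeeze_zero_norm' (h3.mono fun k hk => (hsmall k hk).1) hlim

end HoneycombFamily

/-- A linear asymptotic with quadratic error gives the slope. -/
lemma tendsto_div_norm {f : ℂ → ℝ} {s : ℝ}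
    (h : (fun k : ℂ => f k - s * ‖k‖) =O[𝓝 0] (fun k : ℂ => ‖k‖ ^ 2)) :
    Tendsto (fun k => f k / ‖k‖) (𝓝[≠] 0) (𝓝 s) := by
  obtain ⟨C, hC⟩ := h.bound
  rw [tendsto_iff_norm_sub_tendsto_zero]
  have hlim : Tendsto (fun k : ℂ => C * ‖k‖) (𝓝[≠] 0) (𝓝 0) := by
    have : Continuous fun k : ℂ => C * ‖k‖ := by fun_prop
    simpa using (this.tendsto 0).mono_left nhdsWithin_le_nhds
  refine squeeze_zero' (Eventually.of_forall fun _ => norm_nonneg _) ?_ hlim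
  filter_upwards [hC.filter_mono nhdsWithin_le_nhds, self_mem_nhdsWithin] with k hk hk0
  have hk' : 0 < ‖k‖ := norm_pos_iff.2 hk0
  have : f k / ‖k‖ - s = (f k - s * ‖k‖) / ‖k‖ := by field_simp
  rw [this, norm_div, norm_norm, div_le_iff₀ hk']
  rw [norm_pow, norm_norm] at hk
  linarith [sq ‖k‖, mul_assoc C ‖k‖ ‖k‖]

lemma isConicSingularity {U V : ℂ → ℂ} {α lam : ℝ} {e : ℤ → ℂ → ℝ}
    (he : IsBlochBands U V α lam e) {s : ℝ} (hs : 0 < s)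
    (h1 : (fun k : ℂ => e 1 k - s * ‖k‖) =O[𝓝 0] (fun k : ℂ => ‖k‖ ^ 2))
    (h2 : (fun k : ℂ => e (-1) k - (-(s * ‖k‖))) =O[𝓝 0] (fun k : ℂ => ‖k‖ ^ 2)) :
    IsConicSingularity (e 1) (e (-1)) s where
  slope_pos := hs
  zero_pos := he.zero_pos
  zero_neg := he.zero_neg
  tendsto_pos := tendsto_div_norm h1
  tendsto_neg := tendsto_div_norm (s := -s) (by simpa only [neg_mul] using h2)

/-! ### Weighted permutations of square summable sequences -/

section WeightedPermutation

variable {ι : Type*}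

/-- Square summable sequences. -/
abbrev SqSum (ι : Type*) : Type _ := lp (fun _ : ι => ℂ) 2

lemma summable_norm_sq (x : SqSum ι) : Summable fun i => ‖x i‖ ^ 2 := by
  have := (lp.memℓp x).summable (by norm_num)
  simpa using this

lemma memℓp_of_summable {f : ι → ℂ} (h : Summable fun i => ‖f i‖ ^ 2) : Memℓp f 2 := by
  refine memℓp_gen ?_
  simpa using h

lemma norm_sq_eq_tsum (x : SqSum ι) : ‖x‖ ^ 2 = ∑' i, ‖x i‖ ^ 2 := by
  have := lp.norm_rpow_eq_tsum (p := 2) (by norm_num) x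
  simpa using this

lemma summable_weighted (σ : ι ≃ ι) {c : ι → ℂ} {M : ℝ} (hc : ∀ i, ‖c i‖ ≤ M) (x : SqSum ι) :
    Summable fun i => ‖c i * x (σ i)‖ ^ 2 := by
  refine Summable.of_nonneg_of_le (fun i => sq_nonneg _) (fun i => ?_)
    (((σ.summable_iff (f := fun i => ‖x i‖ ^ 2)).2 (summable_norm_sq x)).mul_left (M ^ 2))
  rw [norm_mul, mul_pow]
  have := hc i
  simp only [Function.comp_apply]
  gcongr

/-- The operator `(T x) i = c i * x (σ i)` for a permutation `σ` and bounded weights `c`. -/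
noncomputable def wperm (σ : ι ≃ ι) (c : ι → ℂ) (M : ℝ) (hc : ∀ i, ‖c i‖ ≤ M) :
    SqSum ι →L[ℂ] SqSum ι :=
  LinearMap.mkContinuous
    { toFun := fun x => ⟨fun i => c i * x (σ i), memℓp_of_summable (summable_weighted σ hc x)⟩
      map_add' := fun x y => by
        ext i
        exact mul_add _ _ _
      map_smul' := fun a x => by
        ext i
        exact mul_left_comm _ _ _ } |M| fun x => by
    refine le_of_sq_le_sq ?_ (by positivity)
    rw [mul_pow, norm_sq_eq_tsum, norm_sq_eq_tsum, ← tsum_mul_left,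
      ← σ.tsum_eq (fun i => |M| ^ 2 * ‖x i‖ ^ 2)]
    refine Summable.tsum_le_tsum (fun i => ?_) (summable_weighted σ hc x)
      ((σ.summable_iff (f := fun i => |M| ^ 2 * ‖x i‖ ^ 2)).2 ((summable_norm_sq x).mul_left _))
    have h1 : ‖c i‖ ≤ |M| := (hc i).trans (le_abs_self M)
    change ‖c i * x (σ i)‖ ^ 2 ≤ _
    rw [norm_mul, mul_pow]
    gcongr

variable {σ : ι ≃ ι} {c : ι → ℂ} {M : ℝ} {hc : ∀ i, ‖c i‖ ≤ M}

@[simp]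
lemma wperm_apply (x : SqSum ι) (i : ι) : wperm σ c M hc x i = c i * x (σ i) := rfl

lemma norm_wperm_le (h0 : 0 ≤ M) : ‖wperm σ c M hc‖ ≤ M := by
  exact (LinearMap.mkContinuous_norm_le _ (abs_nonneg M) _).trans_eq (abs_of_nonneg h0)

/-- The adjoint of a weighted permutation. -/
lemma inner_wperm {σ' : ι ≃ ι} {c' : ι → ℂ} {M' : ℝ} {hc' : ∀ i, ‖c' i‖ ≤ M'}
    (h : ∀ i, σ' (σ i) = i) (h' : ∀ i, c' (σ i) = conj (c i)) (x y : SqSum ι) :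
    inner ℂ (wperm σ c M hc x) y = inner ℂ x (wperm σ' c' M' hc' y) := by
  rw [lp.inner_eq_tsum, lp.inner_eq_tsum,
    ← σ.tsum_eq (fun i => inner ℂ (x i) (wperm σ' c' M' hc' y i))]
  refine tsum_congr fun i => ?_
  simp only [wperm_apply, RCLike.inner_apply, map_mul, h, h']
  ring

lemma isSymmetric_wperm (h : ∀ i, σ (σ i) = i) (h' : ∀ i, c (σ i) = conj (c i)) :
    (wperm σ c M hc : SqSum ι →ₗ[ℂ] SqSum ι).IsSymmetric :=
  fun x y => inner_wperm h h' x y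

/-- A permutation with weights of modulus one is an isometry. -/
lemma inner_wperm_wperm (h : ∀ i, ‖c i‖ = 1) (x y : SqSum ι) :
    inner ℂ (wperm σ c M hc x) (wperm σ c M hc y) = inner ℂ x y := by
  rw [lp.inner_eq_tsum, lp.inner_eq_tsum, ← σ.tsum_eq (fun i => inner ℂ (x i) (y i))]
  refine tsum_congr fun i => ?_
  simp only [wperm_apply, RCLike.inner_apply, map_mul]
  have : c i * conj (c i) = 1 := by
    rw [Complex.mul_conj, Complex.normSq_eq_norm_sq, h]
    simp
  linear_combination (y (σ i) * conj (x (σ i))) * this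

lemma lp_single_apply [DecidableEq ι] (i j : ι) (a : ℂ) :
    (lp.single (E := fun _ : ι => ℂ) 2 i a : SqSum ι) j = if j = i then a else 0 := by
  by_cases h : j = i
  · subst h
    simp
  · rw [lp.single_apply_ne _ _ _ h, if_neg h]

/-- Evaluation at an index, as a continuous linear functional. -/
noncomputable def evalCLM (i : ι) : SqSum ι →L[ℂ] ℂ :=
  LinearMap.mkContinuous
    { toFun := fun x => x i, map_add' := fun _ _ => rfl, map_smul' := fun _ _ => rfl } 1
    fun x => by
      rw [one_mul]
      exact lp.norm_apply_le_norm (by norm_num) x i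

@[simp]
lemma evalCLM_apply (i : ι) (x : SqSum ι) : evalCLM i x = x i := rfl

/-- A weighted permutation with weights tending to zero is a compact operator. -/
lemma isCompactOperator_wperm (h : Tendsto c cofinite (𝓝 0)) :
    IsCompactOperator (wperm σ c M hc) := by
  classical
  refine (isClosed_setOfPred_isCompactOperator (𝕜₁ := ℂ) (σ₁₂ := RingHom.id ℂ)).closure_subset
    (Metric.mem_closure_iff.2 fun ε hε => ?_)
  have hfin : {i | ¬‖c i‖ < ε / 2}.Finite := by
    have := (Metric.tendsto_nhds.1 h (ε / 2) (by positivity))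
    simpa [dist_zero_right] using this
  set s := hfin.toFinset with hs
  -- cut off the weights outside of a finite set
  let A : ι → SqSum ι →L[ℂ] SqSum ι := fun i =>
    (ContinuousLinearMap.toSpanSingleton ℂ
      (lp.single (E := fun _ : ι => ℂ) 2 i (c i) : SqSum ι)).comp (evalCLM (σ i))
  refine ⟨∑ i ∈ s, A i, ?_, ?_⟩
  · refine (compactOperator (RingHom.id ℂ) (SqSum ι) (SqSum ι)).sum_mem fun i _ => ?_
    exact (isCompactOperator_of_locallyCompactSpace_dom (evalCLM (σ i))).clm_comp
      (ContinuousLinearMap.toSpanSingleton ℂ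
        (lp.single (E := fun _ : ι => ℂ) 2 i (c i) : SqSum ι))
  · have heq : wperm σ c M hc - ∑ i ∈ s, A i =
        wperm σ (fun i => if i ∈ s then 0 else c i) (ε / 2) (fun i => by
          by_cases hi : i ∈ s
          · simp only [hi, if_true, norm_zero]
            positivity
          · simp only [hi, if_false]
            simp only [hs, Set.Finite.mem_toFinset, Set.mem_ofPred_eq, not_not] at hi
            exact hi.le) := by
      ext x j
      have h1 : ((∑ i ∈ s, A i) x : SqSum ι) j = ∑ i ∈ s, if j = i then c i * x (σ i) else 0 := by
        rw [sum_apply, ← evalCLM_apply, map_sum]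
        refine Finset.sum_congr rfl fun i _ => ?_
        simp only [A, ContinuousLinearMap.comp_apply, evalCLM_apply,
          ContinuousLinearMap.toSpanSingleton_apply, lp.coeFn_smul, Pi.smul_apply, lp_single_apply,
          smul_eq_mul, mul_ite, mul_zero]
        rw [mul_comm]
      rw [sub_apply, lp.coeFn_sub, Pi.sub_apply, h1, wperm_apply, wperm_apply,
        Finset.sum_ite_eq]
      by_cases hj : j ∈ s <;> simp [hj]
    rw [dist_eq_norm, heq]
    exact (norm_wperm_le (by positivity)).trans_lt (by linarith)

/-- Two operators with the same matrix elements agree. -/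
lemma clm_ext_single [DecidableEq ι] {S T : SqSum ι →L[ℂ] SqSum ι}
    (h : ∀ i j, S (lp.single (E := fun _ : ι => ℂ) 2 j 1) i =
      T (lp.single (E := fun _ : ι => ℂ) 2 j 1) i) : S = T := by
  ext x i
  have hx := lp.hasSum_single (p := 2) (E := fun _ : ι => ℂ) (by norm_num) x
  have hS := (hx.mapL S).mapL (evalCLM i)
  have hT := (hx.mapL T).mapL (evalCLM i)
  have : (fun j => evalCLM i (S (lp.single (E := fun _ : ι => ℂ) 2 j (x j)))) =
      fun j => evalCLM i (T (lp.single (E := fun _ : ι => ℂ) 2 j (x j))) := by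
    funext j
    have hj : (lp.single (E := fun _ : ι => ℂ) 2 j (x j) : SqSum ι) =
        x j • lp.single (E := fun _ : ι => ℂ) 2 j 1 := by
      ext l
      rw [lp.coeFn_smul, Pi.smul_apply, lp_single_apply, lp_single_apply]
      simp
    rw [hj, map_smul, map_smul, map_smul, map_smul, evalCLM_apply, evalCLM_apply, h]
  rw [this] at hS
  exact hS.unique hT

end WeightedPermutation

/-! ### The torus of the lattice -/

/-- The quotient `ℂ/Λ`, in the coordinates given by the basis `1, ω` of `Λ`. -/
abbrev Torus : Type := Fin 2 → UnitAddCircle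

/-- The normalized Haar measure of the torus. -/
noncomputable def torusMeasure : Measure Torus :=
  Measure.pi fun _ => AddCircle.haarAddCircle

local notation "μT" => torusMeasure

instance : IsProbabilityMeasure μT := by unfold torusMeasure; infer_instance

instance : Measure.IsAddHaarMeasure μT := by unfold torusMeasure; infer_instance

lemma sqrt_three_ne_zero : Real.sqrt 3 ≠ 0 := by positivity

/-- The coordinates with respect to the real basis `1, ω` of `ℂ`. -/
noncomputable def latticeCoord : ℂ ≃L[ℝ] (Fin 2 → ℝ) :=
  LinearEquiv.toContinuousLinearEquiv
    { toFun := fun z => ![z.re + z.im / Real.sqrt 3, 2 * z.im / Real.sqrt 3]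
      invFun := fun x => x 0 + x 1 * omega
      map_add' := fun z w => by
        ext i
        fin_cases i
        · simp; ring
        · simp; ring
      map_smul' := fun c z => by
        ext i
        fin_cases i
        · simp; ring
        · simp; ring
      left_inv := fun z => by
        have h := sqrt_three_ne_zero
        apply Complex.ext
        · simp [omega_re]; field_simp; ring
        · simp [omega_im]; field_simp
      right_inv := fun x => by
        have h := sqrt_three_ne_zero
        ext i
        fin_cases i
        · simp [omega_re, omega_im]; field_simp; ring
        · simp [omega_im]; field_simp }

lemma latticeCoord_zero (z : ℂ) : latticeCoord z 0 = z.re + z.im / Real.sqrt 3 := rfl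

lemma latticeCoord_one (z : ℂ) : latticeCoord z 1 = 2 * z.im / Real.sqrt 3 := rfl

lemma latticeCoord_symm (x : Fin 2 → ℝ) : latticeCoord.symm x = x 0 + x 1 * omega := rfl

lemma latticeCoord_latticePt (m n : ℤ) : latticeCoord (latticePt m n) = ![(m : ℝ), (n : ℝ)] := by
  have h : latticePt m n = latticeCoord.symm ![(m : ℝ), (n : ℝ)] := by
    rw [latticeCoord_symm]
    simp [latticePt]
  rw [h, ContinuousLinearEquiv.apply_symm_apply]

/-- The projection of the plane onto the torus. -/
noncomputable def proj (z : ℂ) : Torus := fun i => (latticeCoord z i : ℝ)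

/-- The section of the projection with values in a fundamental cell. -/
noncomputable def sec (t : Torus) : ℂ :=
  latticeCoord.symm fun i => (AddCircle.equivIoc 1 0 (t i) : ℝ)

lemma proj_sec (t : Torus) : proj (sec t) = t := by
  ext i
  rw [proj, sec, ContinuousLinearEquiv.apply_symm_apply]
  exact (AddCircle.equivIoc 1 0).symm_apply_apply (t i)

lemma proj_add (z w : ℂ) : proj (z + w) = proj z + proj w := by
  ext i
  simp [proj]

lemma proj_latticePt (m n : ℤ) : proj (latticePt m n) = 0 := by
  ext i
  rw [proj, latticeCoord_latticePt, Pi.zero_apply, AddCircle.coe_eq_zero_iff]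
  fin_cases i
  · exact ⟨m, by simp⟩
  · exact ⟨n, by simp⟩

lemma proj_add_latticePt (z : ℂ) (m n : ℤ) : proj (z + latticePt m n) = proj z := by
  rw [proj_add, proj_latticePt, add_zero]

lemma continuous_proj : Continuous proj :=
  continuous_pi fun i => (AddCircle.continuous_mk' (1 : ℝ)).comp
    ((continuous_apply i).comp latticeCoord.continuous)

lemma exists_latticePt_of_proj_eq {z w : ℂ} (h : proj z = proj w) :
    ∃ m n : ℤ, w = z + latticePt m n := by
  have h1 : ∀ i, ∃ m : ℤ, latticeCoord w i = latticeCoord z i + m := fun i => by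
    have h2 : ((latticeCoord w i - latticeCoord z i : ℝ) : UnitAddCircle) = 0 := by
      rw [AddCircle.coe_sub, sub_eq_zero]
      exact (congrFun h i).symm
    obtain ⟨m, hm⟩ := (AddCircle.coe_eq_zero_iff (1 : ℝ)).1 h2
    refine ⟨m, ?_⟩
    rw [zsmul_eq_mul, mul_one] at hm
    linarith
  obtain ⟨m, hm⟩ := h1 0
  obtain ⟨n, hn⟩ := h1 1
  refine ⟨m, n, latticeCoord.injective ?_⟩
  rw [map_add, latticeCoord_latticePt]
  ext i
  fin_cases i
  · exact hm
  · exact hn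

lemma exists_sec_proj (z : ℂ) : ∃ m n : ℤ, sec (proj z) = z + latticePt m n :=
  exists_latticePt_of_proj_eq (proj_sec (proj z)).symm

lemma measurable_equivIoc :
    Measurable fun (t : Torus) (i : Fin 2) => (AddCircle.equivIoc 1 0 (t i) : ℝ) :=
  measurable_pi_lambda _ fun i => measurable_subtype_coe.comp
    ((AddCircle.measurableEquivIoc 1 0).measurable.comp (measurable_pi_apply i))

lemma measurable_sec : Measurable sec :=
  latticeCoord.symm.continuous.measurable.comp measurable_equivIoc

/-- The half-open unit square with corner `a`. -/
def unitSquare (a : Fin 2 → ℝ) : Set (Fin 2 → ℝ) := Set.univ.pi fun i => Set.Ioc (a i) (a i + 1)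

lemma measurableSet_unitSquare (a : Fin 2 → ℝ) : MeasurableSet (unitSquare a) :=
  MeasurableSet.univ_pi fun _ => measurableSet_Ioc

lemma measurePreserving_mk_unitSquare (a : Fin 2 → ℝ) :
    MeasurePreserving (fun (x : Fin 2 → ℝ) (i : Fin 2) => ((x i : ℝ) : UnitAddCircle))
      (volume.restrict (unitSquare a)) μT := by
  rw [unitSquare, volume_pi, Measure.restrict_pi_pi]
  refine measurePreserving_pi _ _ fun i => ?_
  have h := AddCircle.measurePreserving_mk 1 (a i)
  rw [AddCircle.volume_eq_smul_haarAddCircle, ENNReal.ofReal_one, one_smul] at h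
  exact h

lemma measurePreserving_equivIoc :
    MeasurePreserving (fun (t : Torus) (i : Fin 2) => (AddCircle.equivIoc 1 0 (t i) : ℝ)) μT
      (volume.restrict (unitSquare 0)) := by
  refine ⟨measurable_equivIoc, ?_⟩
  rw [← (measurePreserving_mk_unitSquare 0).map_eq,
    Measure.map_map measurable_equivIoc (measurePreserving_mk_unitSquare 0).measurable]
  conv_rhs => rw [← Measure.map_id (μ := volume.restrict (unitSquare 0))]
  refine Measure.map_congr ?_
  filter_upwards [ae_restrict_mem (measurableSet_unitSquare 0)] with x hx
  funext i
  exact AddCircle.equivIoc_coe_of_mem (p := (1 : ℝ)) (a := 0) (hx i (Set.mem_univ i))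

lemma exists_volume_eq_smul :
    ∃ c : NNReal, (volume : Measure ℂ) = c • Measure.map latticeCoord.symm volume := by
  have := latticeCoord.symm.isAddHaarMeasure_map (volume : Measure (Fin 2 → ℝ))
  exact ⟨_, Measure.isAddLeftInvariant_eq_smul _ _⟩

lemma exists_map_eq_smul_volume :
    ∃ c : NNReal, Measure.map latticeCoord.symm volume = c • (volume : Measure ℂ) := by
  have := latticeCoord.symm.isAddHaarMeasure_map (volume : Measure (Fin 2 → ℝ))
  exact ⟨_, Measure.isAddLeftInvariant_eq_smul _ _⟩

/-- The Haar measure of the torus is dominated by the Lebesgue measure of a compact set. -/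
lemma exists_map_sec_le :
    ∃ K : Set ℂ, IsCompact K ∧ ∃ c : NNReal, Measure.map sec μT ≤ c • volume.restrict K := by
  obtain ⟨c, hc⟩ := exists_map_eq_smul_volume
  set K := latticeCoord.symm '' (Set.univ.pi fun _ => Set.Icc (0 : ℝ) 1) with hK
  have hcomp : IsCompact K :=
    (isCompact_univ_pi fun _ => isCompact_Icc).image latticeCoord.symm.continuous
  refine ⟨K, hcomp, c, ?_⟩
  have h1 : Measure.map sec μT =
      Measure.map latticeCoord.symm (volume.restrict (unitSquare 0)) := by
    rw [← measurePreserving_equivIoc.map_eq,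
      Measure.map_map latticeCoord.symm.continuous.measurable measurable_equivIoc]
    rfl
  have h2 : unitSquare 0 ⊆ latticeCoord.symm ⁻¹' K := fun x hx =>
    ⟨x, fun i _ => by simpa using Set.Ioc_subset_Icc_self (hx i (Set.mem_univ i)), rfl⟩
  rw [h1]
  calc Measure.map latticeCoord.symm (volume.restrict (unitSquare 0))
      ≤ Measure.map latticeCoord.symm (volume.restrict (latticeCoord.symm ⁻¹' K)) :=
        Measure.map_mono (Measure.restrict_mono h2 le_rfl) latticeCoord.symm.continuous.measurable
    _ = (Measure.map latticeCoord.symm volume).restrict K :=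
        (Measure.restrict_map latticeCoord.symm.continuous.measurable hcomp.measurableSet).symm
    _ = c • volume.restrict K := by rw [hc, Measure.restrict_smul]

lemma quasiMeasurePreserving_sec : Measure.QuasiMeasurePreserving sec μT volume := by
  obtain ⟨K, -, c, h⟩ := exists_map_sec_le
  refine ⟨measurable_sec, (Measure.absolutelyContinuous_of_le h).trans ?_⟩
  exact (Measure.absolutelyContinuous_of_le Measure.restrict_le_self).smul_left _

/-- The Lebesgue measure of a compact set is dominated by the Haar measure of the torus. -/
lemma exists_map_proj_le {K : Set ℂ} (hK : IsCompact K) :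
    ∃ C : NNReal, Measure.map proj (volume.restrict K) ≤ C • μT := by
  have hm := continuous_proj.measurable
  refine hK.induction_on (p := fun K => ∃ C : NNReal, Measure.map proj (volume.restrict K) ≤ C • μT)
    ⟨0, by simp⟩ ?_ ?_ ?_
  · rintro s t hst ⟨C, hC⟩
    exact ⟨C, (Measure.map_mono (Measure.restrict_mono hst le_rfl) hm).trans hC⟩
  · rintro s t ⟨C, hC⟩ ⟨D, hD⟩
    refine ⟨C + D, ?_⟩
    calc Measure.map proj (volume.restrict (s ∪ t))
        ≤ Measure.map proj (volume.restrict s + volume.restrict t) :=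
          Measure.map_mono (Measure.restrict_union_le s t) hm
      _ ≤ (C + D) • μT := by
          rw [Measure.map_add _ _ hm, add_smul]
          exact add_le_add hC hD
  · intro z _
    obtain ⟨c, hc⟩ := exists_volume_eq_smul
    set a : Fin 2 → ℝ := fun i => latticeCoord z i - 1 / 2 with ha
    refine ⟨latticeCoord ⁻¹' unitSquare a, mem_nhdsWithin_of_mem_nhds ?_, c, ?_⟩
    · refine latticeCoord.continuous.continuousAt.preimage_mem_nhds ?_
      refine set_pi_mem_nhds Set.finite_univ fun i _ => Ioc_mem_nhds ?_ ?_
      · simp only [ha]; linarith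
      · simp only [ha]; linarith
    · have hms := latticeCoord.continuous.measurable (measurableSet_unitSquare a)
      have h1 : latticeCoord.symm ⁻¹' (latticeCoord ⁻¹' unitSquare a) = unitSquare a := by
        ext x; simp
      have h2 : (volume : Measure ℂ).restrict (latticeCoord ⁻¹' unitSquare a) =
          c • Measure.map latticeCoord.symm (volume.restrict (unitSquare a)) := by
        rw [hc, Measure.restrict_smul,
          Measure.restrict_map latticeCoord.symm.continuous.measurable hms, h1]
      rw [h2, Measure.map_smul, Measure.map_map hm latticeCoord.symm.continuous.measurable,
        ← (measurePreserving_mk_unitSquare a).map_eq]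
      refine le_of_eq ?_
      congr 2
      funext x i
      simp [proj]

lemma quasiMeasurePreserving_proj : Measure.QuasiMeasurePreserving proj volume μT := by
  refine ⟨continuous_proj.measurable, Measure.AbsolutelyContinuous.mk fun s hs h0 => ?_⟩
  rw [Measure.map_apply continuous_proj.measurable hs]
  refine measure_null_of_locally_null _ fun z _ => ?_
  obtain ⟨K, hK, hz⟩ := exists_compact_mem_nhds z
  obtain ⟨C, hC⟩ := exists_map_proj_le hK
  refine ⟨K ∩ proj ⁻¹' s, ?_, ?_⟩
  · exact inter_mem (mem_nhdsWithin_of_mem_nhds hz) self_mem_nhdsWithin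
  · have := hC s
    rw [Measure.map_apply continuous_proj.measurable hs,
      Measure.restrict_apply (continuous_proj.measurable hs), Measure.smul_apply, h0, smul_zero,
      Set.inter_comm] at this
    exact le_antisymm this bot_le

/-! ### Fourier series on the torus -/

/-- The Hilbert basis of characters of the torus. -/
noncomputable def torusBasis : HilbertBasis (Fin 2 → ℤ) ℂ (Lp ℂ 2 μT) := UnitAddTorus.mFourierBasis

lemma torusBasis_repr (f : Lp ℂ 2 μT) (m : Fin 2 → ℤ) :
    torusBasis.repr f m = ∫ t, UnitAddTorus.mFourier (-m) t * f t ∂μT :=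
  UnitAddTorus.mFourierBasis_repr f m

lemma coe_torusBasis (m : Fin 2 → ℤ) :
    (torusBasis m : Lp ℂ 2 μT) =ᵐ[μT] UnitAddTorus.mFourier m := by
  have : torusBasis m = UnitAddTorus.mFourierLp 2 m := congrFun UnitAddTorus.coe_mFourierBasis m
  rw [this]
  exact UnitAddTorus.coeFn_mFourierLp 2 m

lemma norm_mFourier_apply (m : Fin 2 → ℤ) (t : Torus) : ‖UnitAddTorus.mFourier m t‖ = 1 := by
  simp only [UnitAddTorus.mFourier, ContinuousMap.coe_mk, fourier_apply, norm_prod,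
    Circle.norm_coe, Finset.prod_const_one]

lemma integrable_Lp (f : Lp ℂ 2 μT) : Integrable f μT := (Lp.memLp f).integrable (by norm_num)

lemma integrable_mFourier_mul {f : Torus → ℂ} (hf : Integrable f μT) (m : Fin 2 → ℤ) :
    Integrable (fun t => UnitAddTorus.mFourier m t * f t) μT :=
  hf.bdd_mul (c := 1) (UnitAddTorus.mFourier m).continuous.aestronglyMeasurable
    (Eventually.of_forall fun t => (norm_mFourier_apply m t).le)

/-! ### Integrals of periodic functions against test functions -/

lemma aestronglyMeasurable_comp_proj {f : Torus → ℂ} (hf : AEStronglyMeasurable f μT) :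
    AEStronglyMeasurable (fun z => f (proj z)) volume :=
  hf.comp_quasiMeasurePreserving quasiMeasurePreserving_proj

lemma memLp_comp_proj {f : Torus → ℂ} {p : ENNReal} (hf : MemLp f p μT) {K : Set ℂ}
    (hK : IsCompact K) : MemLp (fun z => f (proj z)) p (volume.restrict K) := by
  obtain ⟨C, hC⟩ := exists_map_proj_le hK
  have h1 : MemLp f p (Measure.map proj (volume.restrict K)) :=
    hf.of_measure_le_smul (c := C) (by simp) (by simpa using hC)
  exact (memLp_map_measure_iff h1.1 continuous_proj.measurable.aemeasurable).1 h1

lemma locallyIntegrable_comp_proj {f : Torus → ℂ} (hf : Integrable f μT) :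
    LocallyIntegrable (fun z => f (proj z)) volume := by
  rw [locallyIntegrable_iff]
  intro s hs
  exact memLp_one_iff_integrable.1 (memLp_comp_proj (memLp_one_iff_integrable.2 hf) hs)

lemma integrable_comp_proj_mul {f : Torus → ℂ} (hf : Integrable f μT) {φ : ℂ → ℂ}
    (h1 : Continuous φ) (h2 : HasCompactSupport φ) : Integrable (fun z => f (proj z) * φ z) := by
  have := (locallyIntegrable_comp_proj hf).integrable_smul_left_of_hasCompactSupport h1 h2
  simpa [mul_comm] using this

/-- Averaging the integral of a periodic function against the translates of a test function. -/
lemma integral_integral_translate {g : Torus → ℂ} (hg : Integrable g μT) {φ : ℂ → ℂ}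
    (h1 : Continuous φ) (h2 : HasCompactSupport φ) :
    ∫ t, (∫ z, g (proj z) * φ (z - sec t)) ∂μT = (∫ t, g t ∂μT) * ∫ z, φ z := by
  -- a strongly measurable version makes the integrand measurable on the product
  wlog hm : StronglyMeasurable g generalizing g with H
  · have hae := hg.1.ae_eq_mk
    rw [integral_congr_ae hae, ← H (hg.congr hae) hg.1.stronglyMeasurable_mk]
    refine integral_congr_ae (Eventually.of_forall fun t => integral_congr_ae ?_)
    filter_upwards [quasiMeasurePreserving_proj.ae hae] with z hz
    rw [hz]
  have e1 : ∀ t, ∫ z, g (proj z) * φ (z - sec t) = ∫ z, g (proj z + t) * φ z := fun t => by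
    rw [← integral_add_right_eq_self (fun z => g (proj z) * φ (z - sec t)) (sec t)]
    refine integral_congr_ae (Eventually.of_forall fun z => ?_)
    simp only [proj_add, proj_sec, add_sub_cancel_right]
  simp only [e1]
  have hi : Integrable φ := h1.integrable_of_hasCompactSupport h2
  have hmeas : StronglyMeasurable fun q : ℂ × Torus => g (proj q.1 + q.2) :=
    hm.comp_measurable ((continuous_proj.comp continuous_fst).add continuous_snd).measurable
  have hint : Integrable (Function.uncurry fun (z : ℂ) (t : Torus) => g (proj z + t) * φ z)
      (volume.prod μT) := by
    rw [integrable_prod_iff]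
    · refine ⟨Eventually.of_forall fun z => ?_, ?_⟩
      · exact (hg.comp_add_left (proj z)).mul_const (φ z)
      · have : ∀ z, ∫ t, ‖g (proj z + t) * φ z‖ ∂μT = (∫ t, ‖g t‖ ∂μT) * ‖φ z‖ := fun z => by
          simp only [norm_mul]
          rw [integral_mul_const, integral_add_left_eq_self (fun t => ‖g t‖)]
        simp only [Function.uncurry_apply_pair, this]
        exact hi.norm.const_mul _
    · exact (hmeas.mul (h1.stronglyMeasurable.comp_measurable measurable_fst)).aestronglyMeasurable
  rw [← integral_integral_swap hint]
  have e2 : ∀ z, ∫ t, g (proj z + t) * φ z ∂μT = (∫ t, g t ∂μT) * φ z := fun z => by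
    rw [integral_mul_const, integral_add_left_eq_self]
  simp only [e2]
  exact integral_const_mul _ _

/-- The integral of the periodic extension of a square integrable function against a continuous
function with compact support, as a continuous linear functional. -/
lemma exists_testFunctional {ψ : ℂ → ℂ} (h1 : Continuous ψ) (h2 : HasCompactSupport ψ) :
    ∃ ℓ : Lp ℂ 2 μT →L[ℂ] ℂ, ∀ v : Lp ℂ 2 μT, ℓ v = ∫ z, v (proj z) * ψ z := by
  obtain ⟨C, hC⟩ := exists_map_proj_le h2
  obtain ⟨M, hM⟩ := h1.bounded_above_of_compact_support h2
  have hM0 : 0 ≤ M := (norm_nonneg _).trans (hM 0)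
  refine ⟨LinearMap.mkContinuous
    { toFun := fun v => ∫ z, v (proj z) * ψ z
      map_add' := fun v w => ?_
      map_smul' := fun c v => ?_ } (C * M) fun v => ?_, fun v => rfl⟩
  · rw [← integral_add (integrable_comp_proj_mul (integrable_Lp v) h1 h2)
      (integrable_comp_proj_mul (integrable_Lp w) h1 h2)]
    refine integral_congr_ae ?_
    filter_upwards [quasiMeasurePreserving_proj.ae (Lp.coeFn_add v w)] with z hz
    rw [hz, Pi.add_apply, add_mul]
  · rw [RingHom.id_apply, smul_eq_mul, ← integral_const_mul]
    refine integral_congr_ae ?_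
    filter_upwards [quasiMeasurePreserving_proj.ae (Lp.coeFn_smul c v)] with z hz
    rw [hz, Pi.smul_apply, smul_eq_mul, mul_assoc]
  · change ‖∫ z, v (proj z) * ψ z‖ ≤ _
    have hv := integrable_Lp v
    have e1 : ∫ z, v (proj z) * ψ z = ∫ z in tsupport ψ, v (proj z) * ψ z := by
      refine (setIntegral_eq_integral_of_forall_compl_eq_zero fun z hz => ?_).symm
      rw [image_eq_zero_of_notMem_tsupport hz, mul_zero]
    have hvK := (locallyIntegrable_comp_proj hv).integrableOn_isCompact h2
    have e2 : ∫ z in tsupport ψ, ‖v (proj z)‖ ≤ C * ∫ t, ‖v t‖ ∂μT := by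
      have hm := continuous_proj.measurable.aemeasurable (μ := volume.restrict (tsupport ψ))
      have hvm : AEStronglyMeasurable (fun t => ‖v t‖)
          (Measure.map proj (volume.restrict (tsupport ψ))) :=
        hv.1.norm.mono_ac ((Measure.absolutelyContinuous_of_le hC).trans
          (Measure.AbsolutelyContinuous.rfl.smul_left _))
      rw [← integral_map hm hvm]
      calc ∫ t, ‖v t‖ ∂(Measure.map proj (volume.restrict (tsupport ψ)))
          ≤ ∫ t, ‖v t‖ ∂(C • μT) :=
            integral_mono_measure hC (Eventually.of_forall fun t => norm_nonneg _)
              (hv.norm.smul_measure_nnreal)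
        _ = C * ∫ t, ‖v t‖ ∂μT := by
            rw [integral_smul_nnreal_measure]; rfl
    -- the total mass of the torus is one
    have e3 : ∫ t, ‖v t‖ ∂μT ≤ ‖v‖ := by
      rw [Lp.norm_def, integral_norm_eq_lintegral_enorm hv.1, ← eLpNorm_one_eq_lintegral_enorm]
      exact ENNReal.toReal_mono (Lp.eLpNorm_ne_top v)
        (eLpNorm_le_eLpNorm_of_exponent_le (by norm_num) hv.1)
    calc ‖∫ z, v (proj z) * ψ z‖ ≤ ∫ z in tsupport ψ, ‖v (proj z) * ψ z‖ := by
          rw [e1]; exact norm_integral_le_integral_norm _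
      _ ≤ ∫ z in tsupport ψ, ‖v (proj z)‖ * M := by
          refine integral_mono_of_nonneg (Eventually.of_forall fun z => norm_nonneg _)
            (hvK.norm.mul_const M) (Eventually.of_forall fun z => ?_)
          simp only [norm_mul]
          gcongr
          exact hM z
      _ ≤ C * ‖v‖ * M := by
          rw [integral_mul_const]
          gcongr
          exact e2.trans (by gcongr)
      _ = C * M * ‖v‖ := by ring

/-! ### Plane waves and Bloch functions -/

/-- The two layers carry the quasi-momenta `4π/3` and `0`. -/
noncomputable def layerShift : Fin 2 → ℝ := ![4 * Real.pi / 3, 0]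

/-- The factor which turns periodic functions into quasi-periodic functions. -/
noncomputable def gauge (l : Fin 2) (z : ℂ) : ℂ :=
  Complex.exp (Complex.I * (layerShift l * z.re : ℝ))

/-- The plane wave `z ↦ exp (i ⟨p, z⟩)`. -/
noncomputable def planeWave (p z : ℂ) : ℂ := Complex.exp (Complex.I * (pairing p z : ℝ))

/-- The momentum of the mode `m` in the layer `l`. -/
noncomputable def mom (l : Fin 2) (m : Fin 2 → ℤ) : ℂ :=
  ⟨2 * Real.pi * m 0 + layerShift l, 2 * Real.pi * (m 0 + 2 * m 1) / Real.sqrt 3⟩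

lemma pairing_eq (a b : ℂ) : pairing a b = a.re * b.re + a.im * b.im := by
  simp [pairing]

lemma norm_gauge (l : Fin 2) (z : ℂ) : ‖gauge l z‖ = 1 := by
  rw [gauge, mul_comm]; exact Complex.norm_exp_ofReal_mul_I _

lemma gauge_ne_zero (l : Fin 2) (z : ℂ) : gauge l z ≠ 0 := Complex.exp_ne_zero _

lemma contDiff_gauge (l : Fin 2) : ContDiff ℝ ∞ (gauge l) := by
  unfold gauge
  have h : ContDiff ℝ ∞ fun z : ℂ => (layerShift l * z.re : ℝ) :=
    contDiff_const.mul Complex.reCLM.contDiff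
  exact (contDiff_const.mul (Complex.ofRealCLM.contDiff.comp h)).cexp

lemma continuous_gauge (l : Fin 2) : Continuous (gauge l) := (contDiff_gauge l).continuous

lemma hasFDerivAt_planeWave (p z : ℂ) :
    ∃ L : ℂ →L[ℝ] ℂ, HasFDerivAt (planeWave p) L z ∧
      ∀ a, L a = Complex.I * (pairing p a : ℝ) * planeWave p z := by
  have h : HasFDerivAt (fun z : ℂ => Complex.I * (pairing p z : ℂ))
      (Complex.I • (Complex.ofRealCLM.comp (p.re • Complex.reCLM + p.im • Complex.imCLM))) z := by
    have h1 : (fun z : ℂ => Complex.I * (pairing p z : ℂ)) = fun z =>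
        (Complex.I • (Complex.ofRealCLM.comp (p.re • Complex.reCLM + p.im • Complex.imCLM))) z := by
      funext z
      simp [pairing_eq, mul_add]
    rw [h1]
    exact ContinuousLinearMap.hasFDerivAt _
  refine ⟨_, h.cexp, fun a => ?_⟩
  simp [planeWave, pairing_eq, mul_add]
  ring

lemma contDiff_planeWave (p : ℂ) : ContDiff ℝ ∞ (planeWave p) := by
  unfold planeWave
  have h : ContDiff ℝ ∞ fun z : ℂ => (pairing p z : ℝ) := by
    simp only [pairing_eq]
    exact (contDiff_const.mul Complex.reCLM.contDiff).add
      (contDiff_const.mul Complex.imCLM.contDiff)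
  exact (contDiff_const.mul (Complex.ofRealCLM.contDiff.comp h)).cexp

lemma planeWave_add (p q z : ℂ) : planeWave (p + q) z = planeWave p z * planeWave q z := by
  rw [planeWave, planeWave, planeWave, ← Complex.exp_add, pairing_eq, pairing_eq, pairing_eq]
  congr 1
  simp
  ring

lemma planeWave_zero (z : ℂ) : planeWave 0 z = 1 := by simp [planeWave, pairing]

/-- The plane waves are the characters of the torus, up to the factor of the layer. -/
lemma gauge_mul_mFourier (l : Fin 2) (m : Fin 2 → ℤ) (z : ℂ) :
    gauge l z * UnitAddTorus.mFourier m (proj z) = planeWave (mom l m) z := by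
  have h3 := sqrt_three_ne_zero
  have e : UnitAddTorus.mFourier m (proj z) =
      Complex.exp (2 * Real.pi * Complex.I * m 0 * latticeCoord z 0) *
        Complex.exp (2 * Real.pi * Complex.I * m 1 * latticeCoord z 1) := by
    simp [UnitAddTorus.mFourier, proj]
  rw [e, gauge, planeWave, ← Complex.exp_add, ← Complex.exp_add, pairing_eq, latticeCoord_zero,
    latticeCoord_one, mom]
  congr 1
  push_cast
  ring

lemma mFourier_neg_proj (l : Fin 2) (m : Fin 2 → ℤ) (z : ℂ) :
    UnitAddTorus.mFourier (-m) (proj z) = gauge l z * planeWave (-mom l m) z := by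
  have h1 : planeWave (mom l m) z * planeWave (-mom l m) z = 1 := by
    rw [← planeWave_add, add_neg_cancel, planeWave_zero]
  have h2 : UnitAddTorus.mFourier m (proj z) * UnitAddTorus.mFourier (-m) (proj z) = 1 := by
    rw [← UnitAddTorus.mFourier_add, add_neg_cancel, UnitAddTorus.mFourier_zero]
    rfl
  rw [← gauge_mul_mFourier] at h1
  linear_combination (gauge l z * planeWave (-mom l m) z) * h2 -
    UnitAddTorus.mFourier (-m) (proj z) * h1

lemma fderiv_planeWave (p z a : ℂ) :
    fderiv ℝ (planeWave p) z a = Complex.I * (pairing p a : ℝ) * planeWave p z := by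
  obtain ⟨L, hL, hLa⟩ := hasFDerivAt_planeWave p z
  rw [hL.fderiv, hLa]

/-- Integration by parts against a plane wave. -/
lemma integral_planeWave_mul_fderiv {φ : ℂ → ℂ} (h : ContDiff ℝ ∞ φ) (hc : HasCompactSupport φ)
    (p a : ℂ) : ∫ z, planeWave p z * fderiv ℝ φ z a =
      -(Complex.I * (pairing p a : ℝ)) * ∫ z, planeWave p z * φ z := by
  have hp := (contDiff_planeWave p).continuous
  have hi : Integrable fun z => planeWave p z * φ z :=
    (hp.mul h.continuous).integrable_of_hasCompactSupport hc.mul_left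
  have e : ∀ z, fderiv ℝ (planeWave p) z a * φ z =
      Complex.I * (pairing p a : ℝ) * (planeWave p z * φ z) := fun z => by
    rw [fderiv_planeWave, mul_assoc]
  rw [integral_mul_fderiv_eq_neg_fderiv_mul_of_integrable]
  · simp only [e]
    rw [integral_const_mul, neg_mul]
  · simp only [e]
    exact hi.const_mul _
  · exact (hp.mul (continuous_fderiv_apply h a)).integrable_of_hasCompactSupport
      (hc.fderiv_apply ℝ a).mul_left
  · exact hi
  · exact fun z _ => (contDiff_planeWave p).differentiable (by simp) z
  · exact fun z _ => h.differentiable (by simp) z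

lemma integral_fderiv_eq_zero {φ : ℂ → ℂ} (h : ContDiff ℝ ∞ φ) (hc : HasCompactSupport φ) (a : ℂ) :
    ∫ z, fderiv ℝ φ z a = 0 := by
  have h0 := integral_planeWave_mul_fderiv h hc 0 a
  simpa [planeWave_zero, pairing] using h0

/-! ### Weak derivatives and Fourier coefficients -/

/-- A first order differential relation, tested against smooth functions, between two
quasi-periodic functions gives the corresponding relation between the Fourier coefficients. It is
applied to the products of `exp (-i ⟨p, z⟩)` with the translates of a fixed bump function, and
averaged over the translations. -/
lemma coeff_eq_of_weak {l : Fin 2} {f v : Torus → ℂ} (hf : Integrable f μT) (hv : Integrable v μT)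
    {c₁ c₂ : ℂ} (h : ∀ φ : ℂ → ℂ, ContDiff ℝ ∞ φ → HasCompactSupport φ →
      ∫ z, gauge l z * f (proj z) * φ z =
        ∫ z, gauge l z * v (proj z) * (c₁ * fderiv ℝ φ z 1 + c₂ * fderiv ℝ φ z Complex.I))
    (m : Fin 2 → ℤ) :
    ∫ t, UnitAddTorus.mFourier (-m) t * f t ∂μT =
      -(Complex.I * (c₁ * (mom l m).re + c₂ * (mom l m).im)) *
        ∫ t, UnitAddTorus.mFourier (-m) t * v t ∂μT := by
  set p := mom l m with hp
  let b : ContDiffBump (0 : ℂ) := ⟨1, 2, one_pos, one_lt_two⟩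
  set η : ℂ → ℂ := fun z => (b z : ℂ) with hη
  have hηs : ContDiff ℝ ∞ η := Complex.ofRealCLM.contDiff.comp b.contDiff
  have hηc : HasCompactSupport η := b.hasCompactSupport.comp_left (g := fun x : ℝ => (x : ℂ)) rfl
  have hη0 : ∫ z, η z ≠ 0 := by
    have h1 : ∫ z, η z = ((∫ z, b z : ℝ) : ℂ) := integral_ofReal
    rw [h1]
    exact_mod_cast (b.integral_pos (μ := volume)).ne'
  have hd1 := continuous_fderiv_apply hηs 1
  have hdI := continuous_fderiv_apply hηs Complex.I
  set q : ℂ := Complex.I * (c₁ * p.re + c₂ * p.im) with hq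
  set ψ : ℂ → ℂ := fun z => c₁ * fderiv ℝ η z 1 + c₂ * fderiv ℝ η z Complex.I - q * η z with hψ
  have hψs : Continuous ψ := ((continuous_const.mul hd1).add (continuous_const.mul hdI)).sub
    (continuous_const.mul hηs.continuous)
  have hψc : HasCompactSupport ψ :=
    (((hηc.fderiv_apply ℝ 1).mul_left).add ((hηc.fderiv_apply ℝ Complex.I).mul_left)).sub
      hηc.mul_left
  have i1 := (hd1.integrable_of_hasCompactSupport (μ := volume) (hηc.fderiv_apply ℝ 1)).const_mul c₁
  have i2 := (hdI.integrable_of_hasCompactSupport (μ := volume)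
    (hηc.fderiv_apply ℝ Complex.I)).const_mul c₂
  have i3 := (hηs.continuous.integrable_of_hasCompactSupport (μ := volume) hηc).const_mul q
  have hψi : ∫ z, ψ z = -q * ∫ z, η z := by
    have h1 : ∫ z, ψ z = (∫ z, (c₁ * fderiv ℝ η z 1 + c₂ * fderiv ℝ η z Complex.I)) -
        ∫ z, q * η z := integral_sub (i1.add i2) i3
    rw [h1, integral_add i1 i2, integral_const_mul, integral_const_mul, integral_const_mul,
      integral_fderiv_eq_zero hηs hηc, integral_fderiv_eq_zero hηs hηc]
    ring
  -- the relation for the test function `exp (-i ⟨p, z⟩) η (z - sec t)`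
  have key : ∀ t, ∫ z, UnitAddTorus.mFourier (-m) (proj z) * f (proj z) * η (z - sec t) =
      ∫ z, UnitAddTorus.mFourier (-m) (proj z) * v (proj z) * ψ (z - sec t) := fun t => by
    have hτs : ContDiff ℝ ∞ fun z => η (z - sec t) := hηs.comp (contDiff_id.sub contDiff_const)
    have hτc : HasCompactSupport fun z => η (z - sec t) := by
      have := hηc.comp_homeomorph (Homeomorph.addRight (-sec t))
      simpa [Function.comp_def, sub_eq_add_neg] using this
    have hτd : ∀ z a, fderiv ℝ (fun z => η (z - sec t)) z a = fderiv ℝ η (z - sec t) a :=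
      fun z a => by simp only [sub_eq_add_neg, fderiv_comp_add_right]
    have hφ := h (fun z => planeWave (-p) z * η (z - sec t))
      ((contDiff_planeWave (-p)).mul hτs) hτc.mul_left
    have hder : ∀ z a, fderiv ℝ (fun z => planeWave (-p) z * η (z - sec t)) z a =
        planeWave (-p) z * (fderiv ℝ η (z - sec t) a -
          Complex.I * (pairing p a : ℝ) * η (z - sec t)) := fun z a => by
      rw [fderiv_fun_mul ((contDiff_planeWave (-p)).differentiable (by simp) z)
        (hτs.differentiable (by simp) z)]
      simp only [add_apply, smul_apply, smul_eq_mul, fderiv_planeWave, hτd]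
      rw [show pairing (-p) a = -pairing p a by simp [pairing_eq]; ring]
      push_cast
      ring
    convert hφ using 1
    · refine integral_congr_ae (Eventually.of_forall fun z => ?_)
      simp only [mFourier_neg_proj l, ← hp]
      ring
    · refine integral_congr_ae (Eventually.of_forall fun z => ?_)
      simp only [mFourier_neg_proj l, ← hp, hder, hψ, hq]
      simp only [pairing_eq, Complex.one_re, Complex.one_im, Complex.I_re, Complex.I_im, mul_one,
        mul_zero, add_zero, zero_add]
      ring
  have a1 := integral_integral_translate (integrable_mFourier_mul hf (-m)) hηs.continuous hηc
  have a2 := integral_integral_translate (integrable_mFourier_mul hv (-m)) hψs hψc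
  simp only [key] at a1
  rw [a1, hψi] at a2
  refine mul_right_cancel₀ hη0 ?_
  linear_combination a2

/-- A function whose Fourier coefficients are those of the derivative is a weak derivative. -/
lemma weak_of_coeff {l : Fin 2} {v d : Lp ℂ 2 μT} {a : ℂ}
    (h : ∀ m, torusBasis.repr d m =
      Complex.I * (pairing (mom l m) a : ℝ) * torusBasis.repr v m)
    {φ : ℂ → ℂ} (hφ : ContDiff ℝ ∞ φ) (hc : HasCompactSupport φ) :
    ∫ z, gauge l z * v (proj z) * fderiv ℝ φ z a = -∫ z, gauge l z * d (proj z) * φ z := by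
  have hg := continuous_gauge l
  obtain ⟨ℓ, hℓ⟩ := exists_testFunctional (hg.mul (continuous_fderiv_apply hφ a))
    (hc.fderiv_apply ℝ a).mul_left
  obtain ⟨ℓ', hℓ'⟩ := exists_testFunctional (hg.mul hφ.continuous) hc.mul_left
  have hb : ∀ m, ℓ (torusBasis m) =
      -(Complex.I * (pairing (mom l m) a : ℝ)) * ℓ' (torusBasis m) := fun m => by
    have e : ∀ φ : ℂ → ℂ, ∫ z, (torusBasis m : Lp ℂ 2 μT) (proj z) * (gauge l z * φ z) =
        ∫ z, planeWave (mom l m) z * φ z := fun φ => by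
      refine integral_congr_ae ?_
      filter_upwards [quasiMeasurePreserving_proj.ae (coe_torusBasis m)] with z hz
      rw [hz, ← gauge_mul_mFourier]
      ring
    rw [hℓ, hℓ']
    refine (e _).trans ((integral_planeWave_mul_fderiv hφ hc _ a).trans ?_)
    congr 1
    exact (e φ).symm
  have s1 := (torusBasis.hasSum_repr v).mapL ℓ
  have s2 := ((torusBasis.hasSum_repr d).mapL ℓ').neg
  have e : (fun m => ℓ (torusBasis.repr v m • torusBasis m)) =
      fun m => -ℓ' (torusBasis.repr d m • torusBasis m) := by
    funext m
    rw [map_smul, map_smul, hb, h, smul_eq_mul, smul_eq_mul]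
    ring
  rw [e] at s1
  have := s1.unique s2
  rw [hℓ, hℓ'] at this
  convert this using 1
  · refine integral_congr_ae (Eventually.of_forall fun z => ?_)
    simp only [Pi.mul_apply]
    ring
  · congr 1
    refine integral_congr_ae (Eventually.of_forall fun z => ?_)
    simp only [Pi.mul_apply]
    ring

/-! ### Quasi-periodic functions -/

/-- The layer of a component. -/
def layer : Idx → Fin 2 := Sum.elim id id

/-- The factor `gauge` is invariant under the modified translations. -/
lemma gauge_add_latticePt (i : Idx) (m n : ℤ) (z : ℂ) :
    layerPhase m n i * gauge (layer i) (z + latticePt m n) = gauge (layer i) z := by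
  have key : omega ^ (m + n) * gauge 0 (z + latticePt m n) = gauge 0 z := by
    have h1 : omega ^ (m + n) = Complex.exp ((m + n : ℤ) * (2 * Real.pi * Complex.I / 3)) := by
      rw [Complex.exp_int_mul]; rfl
    have h2 : (z + latticePt m n).re = z.re + m - n / 2 := by
      simp [latticePt, omega_re]; ring
    have h3 : gauge 0 z * Complex.exp (m * (2 * Real.pi * Complex.I)) = gauge 0 z := by
      rw [Complex.exp_int_mul_two_pi_mul_I, mul_one]
    rw [← h3, h1, gauge, gauge, ← Complex.exp_add, ← Complex.exp_add, h2]
    congr 1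
    simp only [layerShift, Matrix.cons_val_zero]
    push_cast
    ring
  have key1 : 1 * gauge 1 (z + latticePt m n) = gauge 1 z := by
    simp [gauge, layerShift]
  rcases i with a | a <;> fin_cases a
  · exact key
  · exact key1
  · exact key
  · exact key1

lemma measurable_gauge (l : Fin 2) : Measurable (gauge l) := (continuous_gauge l).measurable

lemma aestronglyMeasurable_gauge_mul (l : Fin 2) (v : Lp ℂ 2 μT) :
    AEStronglyMeasurable (fun z => gauge l z * v (proj z)) volume :=
  (continuous_gauge l).aestronglyMeasurable.mul
    (aestronglyMeasurable_comp_proj (Lp.aestronglyMeasurable v))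

/-- The quasi-periodic function in the layer `l` which corresponds to a function on the torus. -/
noncomputable def bloch (l : Fin 2) : Lp ℂ 2 μT →ₗ[ℂ] (ℂ →ₘ[(volume : Measure ℂ)] ℂ) where
  toFun v := AEEqFun.mk _ (aestronglyMeasurable_gauge_mul l v)
  map_add' v w := by
    refine (AEEqFun.mk_eq_mk.2 ?_).trans (AEEqFun.mk_add_mk _ _
      (aestronglyMeasurable_gauge_mul l v) (aestronglyMeasurable_gauge_mul l w)).symm
    filter_upwards [quasiMeasurePreserving_proj.ae (Lp.coeFn_add v w)] with z hz
    rw [hz, Pi.add_apply, Pi.add_apply, mul_add]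
  map_smul' c v := by
    refine (AEEqFun.mk_eq_mk.2 ?_).trans (AEEqFun.smul_mk c _
      (aestronglyMeasurable_gauge_mul l v))
    filter_upwards [quasiMeasurePreserving_proj.ae (Lp.coeFn_smul c v)] with z hz
    rw [hz, Pi.smul_apply, smul_eq_mul, mul_left_comm]
    rfl

lemma coe_bloch (l : Fin 2) (v : Lp ℂ 2 μT) :
    ∀ᵐ z : ℂ, bloch l v z = gauge l z * v (proj z) :=
  AEEqFun.coeFn_mk _ (aestronglyMeasurable_gauge_mul l v)

/-- A property which holds almost everywhere in the plane after projection holds almost everywhere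
on the torus. -/
lemma ae_torus_of_ae_proj {P : Torus → Prop} (h : ∀ᵐ z : ℂ, P (proj z)) : ∀ᵐ t ∂μT, P t := by
  filter_upwards [quasiMeasurePreserving_sec.ae h] with t ht
  rwa [proj_sec] at ht

lemma injective_bloch (l : Fin 2) : Function.Injective (bloch l) := by
  refine (injective_iff_map_eq_zero _).2 fun v hv => ?_
  have h0 : ∀ᵐ z : ℂ, bloch l v z = 0 := by
    rw [hv]; exact AEEqFun.coeFn_zero
  have h3 : ∀ᵐ t ∂μT, v t = 0 := ae_torus_of_ae_proj <| by
    filter_upwards [h0, coe_bloch l v] with z h1 h2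
    rw [h1] at h2
    exact (mul_eq_zero.1 h2.symm).resolve_left (gauge_ne_zero l z)
  exact Lp.ext (EventuallyEq.trans h3 (Lp.coeFn_zero ℂ 2 μT).symm)

lemma isL2Loc_bloch (l : Fin 2) (v : Lp ℂ 2 μT) : IsL2Loc (bloch l v) := fun s hs => by
  refine MemLp.ae_eq (ae_restrict_of_ae ((coe_bloch l v).mono fun z hz => hz.symm)) ?_
  refine (memLp_comp_proj (Lp.memLp v) hs).of_le
    ((aestronglyMeasurable_gauge_mul l v).restrict) (Eventually.of_forall fun z => ?_)
  rw [norm_mul, norm_gauge, one_mul]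

lemma bloch_translate (i : Idx) (v : Lp ℂ 2 μT) (m n : ℤ) :
    ∀ᵐ z : ℂ, layerPhase m n i * bloch (layer i) v (z + latticePt m n) = bloch (layer i) v z := by
  filter_upwards [coe_bloch (layer i) v, ae_translate (latticePt m n) (coe_bloch (layer i) v)]
    with z h1 h2
  rw [h1, h2, proj_add_latticePt, ← mul_assoc, gauge_add_latticePt]

/-- Every locally square integrable quasi-periodic function comes from the torus. -/
lemma exists_bloch_eq {i : Idx} {u : ℂ →ₘ[(volume : Measure ℂ)] ℂ} (hu : IsL2Loc u)
    (hper : ∀ m n : ℤ, ∀ᵐ z : ℂ, layerPhase m n i * u (z + latticePt m n) = u z) :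
    ∃ v, bloch (layer i) v = u := by
  set l := layer i with hl
  set g : Torus → ℂ := fun t => (gauge l (sec t))⁻¹ * u (sec t) with hg
  have hmem : MemLp g 2 μT := by
    obtain ⟨K, hK, c, hc⟩ := exists_map_sec_le
    have h1 : MemLp u 2 (Measure.map sec μT) :=
      (hu K hK).of_measure_le_smul (c := c) (by simp) (by simpa using hc)
    have h2 := (memLp_map_measure_iff h1.1 measurable_sec.aemeasurable).1 h1
    refine h2.of_le (((measurable_gauge l).comp measurable_sec).inv.aestronglyMeasurable.mul h2.1)
      (Eventually.of_forall fun t => ?_)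
    rw [hg, norm_mul, norm_inv, norm_gauge, inv_one, one_mul]
    rfl
  refine ⟨hmem.toLp g, AEEqFun.ext ?_⟩
  have hall : ∀ᵐ z : ℂ, ∀ m n : ℤ, layerPhase m n i * u (z + latticePt m n) = u z :=
    ae_all_iff.2 fun m => ae_all_iff.2 fun n => hper m n
  filter_upwards [coe_bloch l (hmem.toLp g), quasiMeasurePreserving_proj.ae hmem.coeFn_toLp,
    hall] with z h1 h2 h3
  rw [h1, h2, hg]
  obtain ⟨m, n, hmn⟩ := exists_sec_proj z
  have h4 := gauge_add_latticePt i m n z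
  rw [← hl] at h4
  simp only [hmn]
  rw [← h3 m n, ← h4]
  have := gauge_ne_zero l (z + latticePt m n)
  field_simp

/-! ### The Hilbert space of Fourier coefficients -/

/-- The Fourier modes of the four components. -/
abbrev Mode : Type := Idx × (Fin 2 → ℤ)

/-- The coefficients of one component. -/
noncomputable def row (i : Idx) : SqSum Mode →L[ℂ] SqSum (Fin 2 → ℤ) :=
  LinearMap.mkContinuous
    { toFun := fun x => ⟨fun m => x (i, m), memℓp_of_summable
        ((summable_norm_sq x).comp_injective (Prod.mk_right_injective i))⟩
      map_add' := fun x y => by ext m; rfl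
      map_smul' := fun c x => by ext m; rfl } 1 fun x => by
    rw [one_mul]
    refine le_of_sq_le_sq ?_ (norm_nonneg x)
    rw [norm_sq_eq_tsum, norm_sq_eq_tsum]
    exact Summable.tsum_le_tsum_of_inj (fun m => (i, m)) (Prod.mk_right_injective i)
      (fun _ _ => sq_nonneg _) (fun _ => le_rfl)
      ((summable_norm_sq x).comp_injective (Prod.mk_right_injective i)) (summable_norm_sq x)

/-- The function on the torus with the coefficients of one component. -/
noncomputable def component (i : Idx) : SqSum Mode →L[ℂ] Lp ℂ 2 μT :=
  (torusBasis.repr.symm.toContinuousLinearEquiv : SqSum (Fin 2 → ℤ) →L[ℂ] Lp ℂ 2 μT).comp (row i)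

lemma repr_component (i : Idx) (x : SqSum Mode) (m : Fin 2 → ℤ) :
    torusBasis.repr (component i x) m = x (i, m) := by
  have : torusBasis.repr (component i x) = row i x :=
    LinearIsometryEquiv.apply_symm_apply torusBasis.repr (row i x)
  rw [this]
  rfl

lemma component_ext {x y : SqSum Mode} (h : ∀ i, component i x = component i y) : x = y := by
  ext ⟨i, m⟩
  rw [← repr_component, ← repr_component, h]

/-- The spinor with given Fourier coefficients. -/
noncomputable def synth : SqSum Mode →ₗ[ℂ] Spinor :=
  LinearMap.pi fun i => (bloch (layer i)).comp (component i : SqSum Mode →ₗ[ℂ] Lp ℂ 2 μT)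

lemma synth_apply (x : SqSum Mode) (i : Idx) : synth x i = bloch (layer i) (component i x) := rfl

lemma coe_synth (x : SqSum Mode) (i : Idx) :
    ∀ᵐ z : ℂ, synth x i z = gauge (layer i) z * component i x (proj z) := coe_bloch _ _

lemma injective_synth : Function.Injective synth := fun _ _ h =>
  component_ext fun i => injective_bloch (layer i) (congrFun h i)

lemma memL20_synth (x : SqSum Mode) : MemL20 (synth x) :=
  ⟨fun _ => isL2Loc_bloch _ _, fun m n i => bloch_translate i _ m n⟩

/-- Every element of `L²₀` has Fourier coefficients. -/
lemma exists_synth_eq {u : Spinor} (hu : MemL20 u) : ∃ x, synth x = u := by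
  choose v hv using fun i => exists_bloch_eq (hu.1 i) fun m n => hu.2 m n i
  have hs : Summable fun q : Mode => ‖torusBasis.repr (v q.1) q.2‖ ^ 2 := by
    refine (summable_prod_of_nonneg fun _ => sq_nonneg _).2
      ⟨fun i => summable_norm_sq (torusBasis.repr (v i)), Summable.of_finite⟩
  refine ⟨⟨fun q => torusBasis.repr (v q.1) q.2, memℓp_of_summable hs⟩, ?_⟩
  funext i
  rw [synth_apply, ← hv i]
  congr 1
  refine torusBasis.repr.injective ?_
  ext m
  exact repr_component i _ m

lemma component_single (i j : Idx) (m : Fin 2 → ℤ) :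
    component i (lp.single (E := fun _ : Mode => ℂ) 2 (j, m) 1) =
      if i = j then torusBasis m else 0 := by
  refine torusBasis.repr.injective ?_
  ext n
  rw [repr_component, lp_single_apply]
  by_cases h : i = j
  · subst h
    rw [if_pos rfl, torusBasis.repr_self, lp_single_apply]
    simp
  · simp [h]

/-- The coefficients of a function on the torus, placed in one component. -/
noncomputable def embed (i : Idx) : Lp ℂ 2 μT →L[ℂ] SqSum Mode :=
  ContinuousLinearMap.adjoint (component i)

lemma inner_embed (i : Idx) (v : Lp ℂ 2 μT) (x : SqSum Mode) :
    inner ℂ (embed i v) x = inner ℂ v (component i x) :=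
  ContinuousLinearMap.adjoint_inner_left _ _ _

lemma component_embed (i j : Idx) (v : Lp ℂ 2 μT) :
    component i (embed j v) = if i = j then v else 0 := by
  refine torusBasis.repr.injective ?_
  ext m
  have h1 : embed j v (i, m) =
      inner ℂ (lp.single (E := fun _ : Mode => ℂ) 2 (i, m) 1) (embed j v) := by
    rw [lp.inner_single_left]
    simp
  rw [repr_component, h1, ← inner_conj_symm, inner_embed, inner_conj_symm, component_single]
  by_cases h : i = j
  · subst h
    rw [if_pos rfl, if_pos rfl, torusBasis.repr_apply_apply]
  · rw [if_neg h, if_neg fun h' => h h'.symm]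
    simp

/-! ### Multiplication operators on the torus -/

lemma memLp_mul {a : Torus → ℂ} (ha : Measurable a) {M : ℝ} (hM : ∀ t, ‖a t‖ ≤ M)
    (v : Lp ℂ 2 μT) : MemLp (fun t => a t * v t) 2 μT :=
  MemLp.of_le_mul (c := M) (Lp.memLp v) (ha.aestronglyMeasurable.mul (Lp.aestronglyMeasurable v))
    (Eventually.of_forall fun t => by
      rw [norm_mul]
      exact mul_le_mul_of_nonneg_right (hM t) (norm_nonneg _))

/-- Multiplication by a bounded measurable function. -/
noncomputable def mulOp (a : Torus → ℂ) (ha : Measurable a) (M : ℝ) (hM : ∀ t, ‖a t‖ ≤ M) :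
    Lp ℂ 2 μT →L[ℂ] Lp ℂ 2 μT :=
  LinearMap.mkContinuous
    { toFun := fun v => (memLp_mul ha hM v).toLp _
      map_add' := fun v w => by
        rw [← MemLp.toLp_add]
        refine MemLp.toLp_congr _ _ ?_
        filter_upwards [Lp.coeFn_add v w] with t ht
        rw [ht, Pi.add_apply, Pi.add_apply, mul_add]
      map_smul' := fun c v => by
        rw [RingHom.id_apply, ← MemLp.toLp_const_smul]
        refine MemLp.toLp_congr _ _ ?_
        filter_upwards [Lp.coeFn_smul c v] with t ht
        rw [ht, Pi.smul_apply, Pi.smul_apply, smul_eq_mul, smul_eq_mul, mul_left_comm] } M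
    fun v => by
      refine Lp.norm_le_mul_norm_of_ae_le_mul ?_
      filter_upwards [(memLp_mul ha hM v).coeFn_toLp] with t ht
      change ‖((memLp_mul ha hM v).toLp _ : Lp ℂ 2 μT) t‖ ≤ _
      rw [ht, norm_mul]
      exact mul_le_mul_of_nonneg_right (hM t) (norm_nonneg _)

lemma coe_mulOp {a : Torus → ℂ} (ha : Measurable a) {M : ℝ} (hM : ∀ t, ‖a t‖ ≤ M)
    (v : Lp ℂ 2 μT) : mulOp a ha M hM v =ᵐ[μT] fun t => a t * v t :=
  (memLp_mul ha hM v).coeFn_toLp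

lemma inner_mulOp {a b : Torus → ℂ} {ha : Measurable a} {M : ℝ} {hM : ∀ t, ‖a t‖ ≤ M}
    {hb : Measurable b} {N : ℝ} {hN : ∀ t, ‖b t‖ ≤ N} (h : ∀ t, b t = conj (a t))
    (v w : Lp ℂ 2 μT) : inner ℂ (mulOp a ha M hM v) w = inner ℂ v (mulOp b hb N hN w) := by
  rw [L2.inner_def, L2.inner_def]
  refine integral_congr_ae ?_
  filter_upwards [coe_mulOp ha hM v, coe_mulOp hb hN w] with t h1 h2
  simp only [h1, h2, h, RCLike.inner_apply, map_mul]
  ring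

/-! ### Periodic functions and symmetries of the torus -/

lemma sec_comp_proj {g : ℂ → ℂ} (hg : ∀ (m n : ℤ) z, g (z + latticePt m n) = g z) (z : ℂ) :
    g (sec (proj z)) = g z := by
  obtain ⟨m, n, h⟩ := exists_sec_proj z
  rw [h, hg]

lemma exists_norm_sec_le {g : ℂ → ℂ} (hg : Continuous g) : ∃ M : ℝ, ∀ t, ‖g (sec t)‖ ≤ M := by
  have hcomp : IsCompact (latticeCoord.symm '' (Set.univ.pi fun _ => Set.Icc (0 : ℝ) 1)) :=
    (isCompact_univ_pi fun _ => isCompact_Icc).image latticeCoord.symm.continuous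
  obtain ⟨M, hM⟩ := hcomp.exists_bound_of_continuousOn hg.continuousOn
  refine ⟨M, fun t => hM _ ⟨_, fun i _ => ?_, rfl⟩⟩
  have := (AddCircle.equivIoc 1 0 (t i)).2
  exact ⟨this.1.le, by simpa using this.2⟩

/-- The map `τ` of the plane induces a measure preserving map of the torus. -/
def DescendsToTorus (τ : ℂ → ℂ) : Prop :=
  ∃ s : Torus → Torus, MeasurePreserving s μT μT ∧ ∀ z, proj (τ z) = s (proj z)

lemma integral_sec_comp {τ : ℂ → ℂ} (hτ : DescendsToTorus τ) {g : ℂ → ℂ} (hc : Continuous g)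
    (hg : ∀ (m n : ℤ) z, g (z + latticePt m n) = g z) :
    ∫ t, g (τ (sec t)) ∂μT = ∫ t, g (sec t) ∂μT := by
  obtain ⟨s, hs, h⟩ := hτ
  have hm : Measurable fun t => g (sec t) := hc.measurable.comp measurable_sec
  have e : ∀ t, g (τ (sec t)) = g (sec (s t)) := fun t => by
    rw [← sec_comp_proj hg, h, proj_sec]
  simp only [e]
  rw [← integral_map (f := fun t => g (sec t)) hs.measurable.aemeasurable hm.aestronglyMeasurable,
    hs.map_eq]

/-- An integral matrix of determinant `± 1` acts on the torus. -/
lemma descendsToTorus_of_linear {τ : ℂ → ℂ} (a b c d : ℤ)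
    (h : ∀ z, latticeCoord (τ z) = ![a * latticeCoord z 0 + b * latticeCoord z 1,
      c * latticeCoord z 0 + d * latticeCoord z 1])
    (hdet : (a * d - b * c) * (a * d - b * c) = 1) : DescendsToTorus τ := by
  let s : Torus →+ Torus :=
    { toFun := fun t => ![a • t 0 + b • t 1, c • t 0 + d • t 1]
      map_zero' := by ext i; fin_cases i <;> simp
      map_add' := fun t t' => by
        ext i
        fin_cases i
        · simp only [Pi.add_apply, smul_add, Fin.zero_eta, Matrix.cons_val_zero]; abel
        · simp only [Pi.add_apply, smul_add, Fin.mk_one, Matrix.cons_val_one,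
            Matrix.cons_val_zero]; abel }
  have hs : Continuous s := by
    refine continuous_pi fun i => ?_
    fin_cases i
    · exact ((continuous_apply 0).zsmul a).add ((continuous_apply 1).zsmul b)
    · exact ((continuous_apply 0).zsmul c).add ((continuous_apply 1).zsmul d)
  refine ⟨s, AddMonoidHom.measurePreserving hs (fun t => ?_) rfl, fun z => ?_⟩
  · set D := a * d - b * c with hD
    refine ⟨![(D * d) • t 0 + (-(D * b)) • t 1, (-(D * c)) • t 0 + (D * a) • t 1], ?_⟩
    ext i
    fin_cases i
    · change a • ((D * d) • t 0 + (-(D * b)) • t 1) + b • ((-(D * c)) • t 0 + (D * a) • t 1) = t 0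
      have : a • ((D * d) • t 0 + (-(D * b)) • t 1) + b • ((-(D * c)) • t 0 + (D * a) • t 1) =
          (D * D) • t 0 := by rw [hD]; module
      rw [this, hdet, one_smul]
    · change c • ((D * d) • t 0 + (-(D * b)) • t 1) + d • ((-(D * c)) • t 0 + (D * a) • t 1) = t 1
      have : c • ((D * d) • t 0 + (-(D * b)) • t 1) + d • ((-(D * c)) • t 0 + (D * a) • t 1) =
          (D * D) • t 1 := by rw [hD]; module
      rw [this, hdet, one_smul]
  · ext i
    fin_cases i
    · simp [proj, h, s]
    · simp [proj, h, s]

lemma descendsToTorus_omega : DescendsToTorus fun z => omega * z := by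
  refine descendsToTorus_of_linear 0 (-1) 1 (-1) (fun z => ?_) (by norm_num)
  have h3 := sqrt_three_ne_zero
  have h4 : Real.sqrt 3 * Real.sqrt 3 = 3 := Real.mul_self_sqrt (by norm_num)
  ext i
  fin_cases i
  · simp [latticeCoord_zero, latticeCoord_one, omega_re, omega_im]
    field_simp
    linear_combination (-z.im) * h4
  · simp [latticeCoord_zero, latticeCoord_one, omega_re, omega_im]
    field_simp
    ring

lemma descendsToTorus_conj : DescendsToTorus fun z => conj z := by
  refine descendsToTorus_of_linear 1 (-1) 0 (-1) (fun z => ?_) (by norm_num)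
  ext i
  fin_cases i
  · simp [latticeCoord_zero, latticeCoord_one]
    ring
  · simp [latticeCoord_one]
    ring

/-! ### Matrix potentials -/

/-- A continuous matrix potential with the quasi-periodicity of the bilayer. -/
structure IsBlochPotential (A : ℂ → Matrix Idx Idx ℂ) : Prop where
  continuous : ∀ i j, Continuous fun z => A z i j
  translate : ∀ (m n : ℤ) z i j,
    layerPhase m n i * A (z + latticePt m n) i j = A z i j * layerPhase m n j

namespace IsBlochPotential

variable {A : ℂ → Matrix Idx Idx ℂ}

/-- The periodic function `conj (gauge i) * A i j * gauge j`. -/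
noncomputable def periodic (_ : IsBlochPotential A) (i j : Idx) (z : ℂ) : ℂ :=
  conj (gauge (layer i) z) * A z i j * gauge (layer j) z

lemma conj_gauge_mul (l : Fin 2) (z : ℂ) : conj (gauge l z) * gauge l z = 1 := by
  rw [← Complex.normSq_eq_conj_mul_self, Complex.normSq_eq_norm_sq, norm_gauge]
  norm_num

lemma periodic_add (hA : IsBlochPotential A) (i j : Idx) (m n : ℤ) (z : ℂ) :
    hA.periodic i j (z + latticePt m n) = hA.periodic i j z := by
  have h1 := gauge_add_latticePt i m n z
  have h2 := gauge_add_latticePt j m n z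
  have h3 := hA.translate m n z i j
  have h4 := conj_gauge_mul (layer i) z
  have h5 := conj_gauge_mul (layer i) (z + latticePt m n)
  unfold periodic
  set w := z + latticePt m n
  refine mul_left_cancel₀ (mul_ne_zero (gauge_ne_zero (layer i) z) (gauge_ne_zero (layer i) w)) ?_
  linear_combination gauge (layer i) z * A w i j * gauge (layer j) w * h5 -
    gauge (layer i) w * A z i j * gauge (layer j) z * h4 - A w i j * gauge (layer j) w * h1 +
    gauge (layer i) w * gauge (layer j) w * h3 + A z i j * gauge (layer i) w * h2

lemma continuous_periodic (hA : IsBlochPotential A) (i j : Idx) :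
    Continuous (hA.periodic i j) :=
  ((Complex.continuous_conj.comp (continuous_gauge _)).mul (hA.continuous i j)).mul
    (continuous_gauge _)

lemma measurable_periodic_sec (hA : IsBlochPotential A) (i j : Idx) :
    Measurable fun t => hA.periodic i j (sec t) :=
  (hA.continuous_periodic i j).measurable.comp measurable_sec

lemma exists_bound (hA : IsBlochPotential A) (i j : Idx) :
    ∃ M : ℝ, ∀ t, ‖hA.periodic i j (sec t)‖ ≤ M :=
  exists_norm_sec_le (hA.continuous_periodic i j)

/-- One entry of the potential as an operator on functions on the torus. -/
noncomputable def entry (hA : IsBlochPotential A) (i j : Idx) : Lp ℂ 2 μT →L[ℂ] Lp ℂ 2 μT :=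
  mulOp _ (hA.measurable_periodic_sec i j) (hA.exists_bound i j).choose
    (hA.exists_bound i j).choose_spec

lemma coe_entry (hA : IsBlochPotential A) (i j : Idx) (v : Lp ℂ 2 μT) :
    hA.entry i j v =ᵐ[μT] fun t => hA.periodic i j (sec t) * v t := coe_mulOp _ _ v

/-- The potential as an operator on Fourier coefficients. -/
noncomputable def op (hA : IsBlochPotential A) : SqSum Mode →L[ℂ] SqSum Mode :=
  ∑ i, ∑ j, (embed i).comp ((hA.entry i j).comp (component j))

lemma op_apply (hA : IsBlochPotential A) (x : SqSum Mode) :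
    hA.op x = ∑ i, ∑ j, embed i (hA.entry i j (component j x)) := by
  simp [op]

lemma component_op (hA : IsBlochPotential A) (i : Idx) (x : SqSum Mode) :
    component i (hA.op x) = ∑ j, hA.entry i j (component j x) := by
  rw [op_apply, map_sum]
  simp only [map_sum, component_embed]
  rw [Finset.sum_eq_single i (fun b _ hb => by simp [Ne.symm hb]) (fun h => by simp at h)]
  simp

/-- In position space the operator is the multiplication by the matrix potential. -/
lemma synth_op (hA : IsBlochPotential A) (x : SqSum Mode) (i : Idx) :
    ∀ᵐ z : ℂ, synth (hA.op x) i z = ∑ j, A z i j * synth x j z := by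
  have h1 : ∀ᵐ t ∂μT, component i (hA.op x) t = ∑ j, hA.entry i j (component j x) t := by
    rw [component_op]
    exact Lp.coeFn_finsetSum _ _
  have h2 : ∀ᵐ t ∂μT, ∀ j, hA.entry i j (component j x) t =
      hA.periodic i j (sec t) * component j x t := ae_all_iff.2 fun j => hA.coe_entry i j _
  filter_upwards [coe_synth (hA.op x) i, ae_all_iff.2 fun j => coe_synth x j,
    quasiMeasurePreserving_proj.ae h1, quasiMeasurePreserving_proj.ae h2] with z e1 e2 e3 e4
  rw [e1, e3, Finset.mul_sum]
  refine Finset.sum_congr rfl fun j _ => ?_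
  rw [e4, e2, sec_comp_proj (hA.periodic_add i j), periodic]
  linear_combination A z i j * gauge (layer j) z * component j x (proj z) *
    conj_gauge_mul (layer i) z

lemma isSymmetric_op (hA : IsBlochPotential A) (hH : ∀ z, (A z).IsHermitian) :
    (hA.op : SqSum Mode →ₗ[ℂ] SqSum Mode).IsSymmetric := fun x y => by
  change inner ℂ (hA.op x) y = inner ℂ x (hA.op y)
  rw [← inner_conj_symm x, op_apply, op_apply, sum_inner, sum_inner, map_sum]
  simp only [sum_inner, inner_embed, map_sum, inner_conj_symm]
  rw [Finset.sum_comm]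
  refine Finset.sum_congr rfl fun j _ => Finset.sum_congr rfl fun i _ => ?_
  refine inner_mulOp (fun t => ?_) _ _
  simp only [periodic, map_mul, Complex.conj_conj]
  rw [← (hH (sec t)).apply i j]
  simp only [RCLike.star_def, Complex.conj_conj]
  ring

/-- The integrand of a matrix element of the potential between plane waves. -/
noncomputable def element (_ : IsBlochPotential A) (q q' : Mode) (z : ℂ) : ℂ :=
  planeWave (-mom (layer q.1) q.2) z * A z q.1 q'.1 * planeWave (mom (layer q'.1) q'.2) z

lemma element_eq (hA : IsBlochPotential A) (q q' : Mode) (z : ℂ) :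
    hA.element q q' z = UnitAddTorus.mFourier (-q.2) (proj z) *
      (hA.periodic q.1 q'.1 z * UnitAddTorus.mFourier q'.2 (proj z)) := by
  rw [mFourier_neg_proj (layer q.1), element, ← gauge_mul_mFourier, periodic]
  linear_combination -planeWave (-mom (layer q.1) q.2) z * A z q.1 q'.1 * gauge (layer q'.1) z *
    UnitAddTorus.mFourier q'.2 (proj z) * conj_gauge_mul (layer q.1) z

lemma element_add (hA : IsBlochPotential A) (q q' : Mode) (m n : ℤ) (z : ℂ) :
    hA.element q q' (z + latticePt m n) = hA.element q q' z := by
  rw [element_eq, element_eq, proj_add_latticePt, periodic_add]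

lemma continuous_element (hA : IsBlochPotential A) (q q' : Mode) :
    Continuous (hA.element q q') :=
  ((contDiff_planeWave _).continuous.mul (hA.continuous _ _)).mul (contDiff_planeWave _).continuous

/-- The matrix elements of the potential with respect to the plane waves. -/
lemma op_single (hA : IsBlochPotential A) (q q' : Mode) :
    hA.op (lp.single (E := fun _ : Mode => ℂ) 2 q' 1) q = ∫ t, hA.element q q' (sec t) ∂μT := by
  obtain ⟨i, m⟩ := q
  obtain ⟨j, n⟩ := q'
  rw [← repr_component, component_op, Finset.sum_eq_single j
    (fun b _ hb => by rw [component_single, if_neg hb, map_zero]) (fun h => by simp at h),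
    component_single, if_pos rfl, torusBasis_repr]
  refine integral_congr_ae ?_
  filter_upwards [hA.coe_entry i j (torusBasis n), coe_torusBasis n] with t h1 h2
  rw [h1, h2, element_eq, proj_sec]

/-- A symmetry of the potential under a map `τ` of the plane gives a commutation relation with the
corresponding weighted permutation of the Fourier modes. -/
lemma op_wperm (hA : IsBlochPotential A) {τ : ℂ → ℂ} (hτ : DescendsToTorus τ)
    {s : Mode ≃ Mode} {c : Mode → ℂ} {M : ℝ} {hc : ∀ q, ‖c q‖ ≤ M}
    {θ : Idx → Idx} {r : Idx → ℂ} (hs : ∀ q, (s q).1 = θ q.1) (hr : ∀ q, c q = r q.1)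
    (hmom : ∀ q z, pairing (mom (layer (s q).1) (s q).2) (τ z) = pairing (mom (layer q.1) q.2) z)
    {ε : ℂ} (hε : ∀ z i j, ε * (r i * A (τ z) (θ i) (θ j)) = A z i j * r j) (x : SqSum Mode) :
    hA.op (wperm s c M hc x) = ε • wperm s c M hc (hA.op x) := by
  have : hA.op.comp (wperm s c M hc) = ε • (wperm s c M hc).comp hA.op := by
    refine clm_ext_single fun q q' => ?_
    obtain ⟨q', rfl⟩ := s.surjective q'
    have h1 : wperm s c M hc (lp.single (E := fun _ : Mode => ℂ) 2 (s q') 1) =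
        r q'.1 • lp.single (E := fun _ : Mode => ℂ) 2 q' 1 := by
      ext p
      rw [wperm_apply, lp.coeFn_smul, Pi.smul_apply, lp_single_apply, lp_single_apply]
      by_cases hp : p = q'
      · simp [hp, hr]
      · simp [hp]
    have hneg : ∀ a b : ℂ, pairing (-a) b = -pairing a b := fun a b => by
      simp [pairing]
    rw [ContinuousLinearMap.comp_apply, h1, map_smul, lp.coeFn_smul, Pi.smul_apply, op_single,
      smul_apply, ContinuousLinearMap.comp_apply, lp.coeFn_smul, Pi.smul_apply, wperm_apply,
      op_single, ← integral_sec_comp hτ (hA.continuous_element (s q) (s q')) (hA.element_add _ _),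
      smul_eq_mul, smul_eq_mul, ← integral_const_mul, ← integral_const_mul, ← integral_const_mul]
    refine integral_congr_ae (Eventually.of_forall fun t => ?_)
    have h2 := hε (sec t) q.1 q'.1
    simp only [element, planeWave, hneg, hmom]
    simp only [hs, hr]
    linear_combination -(Complex.exp (Complex.I * ((-pairing (mom (layer q.1) q.2) (sec t) : ℝ))) *
      Complex.exp (Complex.I * (pairing (mom (layer q'.1) q'.2) (sec t) : ℝ))) * h2
  exact congrArg (fun T : SqSum Mode →L[ℂ] SqSum Mode => T x) this

end IsBlochPotential

/-! ### The tunnelling potential -/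

namespace IsTunnelling

variable {U V : ℂ → ℂ}

/-- The phases of the potentials are inverse to those of the components in the first layer. -/
lemma phase_mul (m n : ℤ) :
    omega ^ (m + n) * Complex.exp (Complex.I * (pairing (latticePt m n) bigK : ℝ)) = 1 := by
  have h := gauge_add_latticePt (Sum.inl 0) m n 0
  have h1 : gauge 0 (latticePt m n) =
      Complex.exp (Complex.I * (pairing (latticePt m n) bigK : ℝ)) := by
    have hK : bigK = ((4 * Real.pi / 3 : ℝ) : ℂ) := by rw [bigK]; push_cast; rfl
    rw [gauge, pairing_eq, hK, Complex.ofReal_re, Complex.ofReal_im, mul_zero, add_zero,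
      mul_comm (latticePt m n).re]
    rfl
  have h0 : gauge 0 0 = 1 := by simp [gauge]
  rw [zero_add] at h
  rw [← h1, ← h0]
  exact h

lemma conj_phase_mul (m n : ℤ) :
    conj (omega ^ (m + n)) * omega ^ (m + n) = 1 := by
  have h := congrArg (fun z => z * conj z) (phase_mul m n)
  have h1 : Complex.exp (Complex.I * (pairing (latticePt m n) bigK : ℝ)) *
      conj (Complex.exp (Complex.I * (pairing (latticePt m n) bigK : ℝ))) = 1 := by
    rw [Complex.mul_conj, Complex.normSq_eq_norm_sq, mul_comm, Complex.norm_exp_ofReal_mul_I]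
    norm_num
  simp only [map_mul, map_one, mul_one] at h
  linear_combination h - conj (omega ^ (m + n)) * omega ^ (m + n) * h1

lemma U_phase (h : IsTunnelling U V) (m n : ℤ) (z : ℂ) :
    omega ^ (m + n) * U (z + latticePt m n) = U z := by
  rw [h.U_translate, ← mul_assoc, phase_mul, one_mul]

lemma V_phase (h : IsTunnelling U V) (m n : ℤ) (z : ℂ) :
    omega ^ (m + n) * V (z + latticePt m n) = V z := by
  rw [h.V_translate, ← mul_assoc, phase_mul, one_mul]

lemma U_neg_phase (h : IsTunnelling U V) (m n : ℤ) (z : ℂ) :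
    U (-(z + latticePt m n)) = U (-z) * omega ^ (m + n) := by
  have h1 := h.U_phase m n (-(z + latticePt m n))
  rw [show -(z + latticePt m n) + latticePt m n = -z by ring] at h1
  rw [← h1, mul_comm]

lemma conj_phase (m n : ℤ) {a b : ℂ} (h : omega ^ (m + n) * a = b) :
    conj a = conj b * omega ^ (m + n) := by
  rw [← h, map_mul]
  linear_combination -conj a * conj_phase_mul m n

lemma conj_phase' (m n : ℤ) {a b : ℂ} (h : a = b * omega ^ (m + n)) :
    omega ^ (m + n) * conj a = conj b := by
  rw [h, map_mul]
  linear_combination conj b * conj_phase_mul m n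

lemma isBlochPotential (h : IsTunnelling U V) (α lam : ℝ) :
    IsBlochPotential (zerothOrder U V α lam 0) where
  continuous i j := by
    have hU := h.smooth_U.continuous
    have hV := h.smooth_V.continuous
    have hU' : Continuous fun z => U (-z) := hU.comp continuous_neg
    rcases i with i | i <;> rcases j with j | j <;> fin_cases i <;> fin_cases j <;>
      simp [zerothOrder, matU, matC, Matrix.fromBlocks] <;> fun_prop
  translate m n z i j := by
    have h1 := h.U_phase m n z
    have h2 := h.U_neg_phase m n z
    have h3 := h.V_phase m n z
    have h4 := conj_phase m n h1
    have h5 := conj_phase' m n h2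
    have h6 := conj_phase m n h3
    rcases i with i | i <;> rcases j with j | j <;> fin_cases i <;> fin_cases j <;>
      simp [zerothOrder, matU, matC, Matrix.fromBlocks, layerPhase, -neg_add_rev]
    all_goals first
      | linear_combination (lam : ℂ) * h3 | linear_combination (lam : ℂ) * h6
      | linear_combination (α : ℂ) * h1 | linear_combination (α : ℂ) * h2
      | linear_combination (α : ℂ) * h4 | linear_combination (α : ℂ) * h5

lemma isHermitian (U V : ℂ → ℂ) (α lam : ℝ) (z : ℂ) : (zerothOrder U V α lam 0 z).IsHermitian := by
  ext i j
  rcases i with i | i <;> rcases j with j | j <;> fin_cases i <;> fin_cases j <;>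
      simp [zerothOrder, matU, matC, Matrix.fromBlocks]

/-- The weights of the rotation: `ω²` cancels the factor `ω` in `U (ω z) = ω U z`. -/
noncomputable def rotWeight : Idx → ℂ := Sum.elim (fun _ => 1) fun _ => omega ^ 2

/-- The weights of the chiral reflection. The sign alternates between the layers and between the
blocks, so that the off-diagonal matrices `C` and `D` change their sign. -/
def reflWeight : Idx → ℂ := Sum.elim ![1, -1] ![-1, 1]

lemma rotate (h : IsTunnelling U V) (α lam : ℝ) (z : ℂ) (i j : Idx) :
    (1 : ℂ) * (rotWeight i * zerothOrder U V α lam 0 (omega * z) i j) =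
      zerothOrder U V α lam 0 z i j * rotWeight j := by
  have h1 := h.U_rotate z
  have h2 : U (-(omega * z)) = omega * U (-z) := by rw [← mul_neg, h.U_rotate]
  have h3 := h.V_rotate z
  have h4 := conj_omega
  have h5 := omega_pow_three
  rcases i with i | i <;> rcases j with j | j <;> fin_cases i <;> fin_cases j <;>
      simp [zerothOrder, matU, matC, Matrix.fromBlocks, rotWeight, h1, h2, h3, h4]
  all_goals first
    | ring1
    | linear_combination (α : ℂ) * U z * h5
    | linear_combination (α : ℂ) * U (-z) * h5

lemma reflect (h : IsTunnelling U V) (α lam : ℝ) (z : ℂ) (i j : Idx) :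
    (-1 : ℂ) * (reflWeight i * zerothOrder U V α lam 0 (conj z) i.swap j.swap) =
      zerothOrder U V α lam 0 z i j * reflWeight j := by
  have h1 : U (conj z) = -conj (U (-z)) := by
    rw [← Complex.conj_conj (U (conj z)), h.U_reflect, map_neg]
  have h2 : U (-conj z) = -conj (U z) := by
    have := h.U_reflect (-z)
    rw [map_neg, neg_neg] at this
    rw [← Complex.conj_conj (U (-conj z)), this, map_neg]
  have h3 := h.V_conj z
  rcases i with i | i <;> rcases j with j | j <;> fin_cases i <;> fin_cases j <;>
      simp [zerothOrder, matU, matC, Matrix.fromBlocks, reflWeight, h1, h2, ← h3]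

end IsTunnelling

/-! ### Symmetries of the Fourier modes -/

/-- The action of the rotation on the modes of a layer; `s` is the offset of the layer. -/
def rotMode (s : ℤ) : (Fin 2 → ℤ) ≃ (Fin 2 → ℤ) where
  toFun m := ![-m 0 - m 1 - s, m 0 + s]
  invFun m := ![m 1 - s, -m 0 - m 1]
  left_inv m := by
    ext i
    fin_cases i
    · simp
    · simp; ring
  right_inv m := by
    ext i
    fin_cases i
    · simp
    · simp

/-- The action of the complex conjugation on the modes. -/
def conjMode : (Fin 2 → ℤ) ≃ (Fin 2 → ℤ) where
  toFun m := ![m 0, -m 0 - m 1]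
  invFun m := ![m 0, -m 0 - m 1]
  left_inv m := by
    ext i
    fin_cases i
    · simp
    · simp
  right_inv m := by
    ext i
    fin_cases i
    · simp
    · simp

/-- The offset of the modes of a layer. -/
def layerOffset : Fin 2 → ℤ := ![1, 0]

lemma layerShift_eq (l : Fin 2) : layerShift l = 2 * Real.pi * (2 / 3 * layerOffset l) := by
  fin_cases l
  · simp [layerShift, layerOffset]; ring
  · simp [layerShift, layerOffset]

lemma mom_rotMode (l : Fin 2) (m : Fin 2 → ℤ) :
    mom l (rotMode (layerOffset l) m) = omega * mom l m := by
  have h3 := sqrt_three_ne_zero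
  have h4 : Real.sqrt 3 * Real.sqrt 3 = 3 := Real.mul_self_sqrt (by norm_num)
  apply Complex.ext
  · simp [mom, rotMode, Complex.mul_re, omega_re, omega_im, layerShift_eq]
    field_simp
    ring
  · simp [mom, rotMode, Complex.mul_im, omega_re, omega_im, layerShift_eq]
    field_simp
    linear_combination -((m 0 : ℝ) * 3 + 2 * (layerOffset l : ℝ)) * h4

lemma mom_conjMode (l : Fin 2) (m : Fin 2 → ℤ) : mom l (conjMode m) = conj (mom l m) := by
  apply Complex.ext
  · simp [mom, conjMode]
  · simp [mom, conjMode]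
    ring

/-- The exchange of the two blocks of components. -/
def modeFlip : Mode ≃ Mode := (Equiv.sumComm _ _).prodCongr (Equiv.refl _)

/-- The rotation of the modes. -/
def modeRot : Mode ≃ Mode :=
  Equiv.prodShear (Equiv.refl _) fun i => rotMode (layerOffset (layer i))

/-- The reflection of the modes, combined with the exchange of the blocks. -/
def modeRefl : Mode ≃ Mode := (Equiv.sumComm _ _).prodCongr conjMode

lemma layer_swap (i : Idx) : layer i.swap = layer i := by cases i <;> rfl

lemma modeFlip_apply (q : Mode) : modeFlip q = (q.1.swap, q.2) := rfl

lemma modeRot_apply (q : Mode) : modeRot q = (q.1, rotMode (layerOffset (layer q.1)) q.2) := rfl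

lemma modeRefl_apply (q : Mode) : modeRefl q = (q.1.swap, conjMode q.2) := rfl

lemma modeFlip_modeFlip (q : Mode) : modeFlip (modeFlip q) = q := by
  simp [modeFlip_apply]

lemma modeRot_modeFlip (q : Mode) : modeRot (modeFlip q) = modeFlip (modeRot q) := by
  simp [modeFlip_apply, modeRot_apply, layer_swap]

lemma modeRefl_modeFlip (q : Mode) : modeRefl (modeFlip q) = modeFlip (modeRefl q) := rfl

lemma modeRot_cube (q : Mode) : modeRot (modeRot (modeRot q)) = q := by
  obtain ⟨i, m⟩ := q
  simp only [modeRot_apply, Prod.mk.injEq, true_and]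
  ext j
  fin_cases j
  · simp [rotMode]; ring
  · simp [rotMode]; ring

lemma modeRefl_modeRot (q : Mode) : modeRefl (modeRot q) = modeRot (modeRot (modeRefl q)) := by
  obtain ⟨i, m⟩ := q
  simp only [modeRot_apply, modeRefl_apply, Prod.mk.injEq, true_and, layer_swap]
  ext j
  fin_cases j
  · simp [rotMode, conjMode]; ring
  · simp [rotMode, conjMode]; ring

/-- The symbol of the free operator: it maps the amplitude of the mode `q` to the amplitude of the
mode `modeFlip q`, multiplied by `symbol q`. -/
noncomputable def symbol (q : Mode) : ℂ :=
  Sum.elim (fun a => mom a q.2) (fun a => conj (mom a q.2)) q.1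

lemma symbol_modeFlip (q : Mode) : symbol (modeFlip q) = conj (symbol q) := by
  obtain ⟨i | i, m⟩ := q
  · rfl
  · exact (Complex.conj_conj _).symm

lemma norm_symbol (q : Mode) : ‖symbol q‖ = ‖mom (layer q.1) q.2‖ := by
  obtain ⟨i | i, m⟩ := q
  · rfl
  · exact RCLike.norm_conj _

lemma symbol_modeRefl (q : Mode) : symbol (modeRefl q) = symbol q := by
  obtain ⟨i | i, m⟩ := q
  · change conj (mom i (conjMode m)) = mom i m
    rw [mom_conjMode, Complex.conj_conj]
  · change mom i (conjMode m) = conj (mom i m)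
    rw [mom_conjMode]

open IsTunnelling in
lemma symbol_modeRot (q : Mode) :
    rotWeight q.1.swap * symbol (modeRot q) = rotWeight q.1 * symbol q := by
  obtain ⟨i | i, m⟩ := q
  · change omega ^ 2 * mom i (rotMode (layerOffset i) m) = 1 * mom i m
    rw [mom_rotMode]
    linear_combination mom i m * omega_pow_three
  · change 1 * conj (mom i (rotMode (layerOffset i) m)) = omega ^ 2 * conj (mom i m)
    rw [mom_rotMode, map_mul, conj_omega, one_mul]

/-- Only finitely many momenta lie in a given disc. -/
lemma tendsto_norm_symbol : Tendsto (fun q => ‖symbol q‖) cofinite atTop := by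
  refine tendsto_atTop.2 fun C => ?_
  obtain ⟨N, hN⟩ := exists_int_gt (2 * |C| + 1)
  refine ((Set.finite_univ (α := Idx)).prod (Set.Finite.pi' fun _ : Fin 2 =>
    Set.finite_Icc (-N) N)).subset fun q hq => ⟨Set.mem_univ _, ?_⟩
  have hq' : ‖mom (layer q.1) q.2‖ < C := by
    rw [← norm_symbol]
    simpa using hq
  have hC := hq'.trans_le (le_abs_self C)
  have hpi := Real.pi_gt_three
  have hre := ((Complex.abs_re_le_norm _).trans_lt hC)
  have him := ((Complex.abs_im_le_norm _).trans_lt hC)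
  have h3 : Real.sqrt 3 ≤ 2 := Real.sqrt_le_iff.2 ⟨by norm_num, by norm_num⟩
  have h3' : 0 < Real.sqrt 3 := by positivity
  have hs : 0 ≤ (layerOffset (layer q.1) : ℝ) ∧ (layerOffset (layer q.1) : ℝ) ≤ 1 := by
    generalize layer q.1 = l
    fin_cases l <;> simp [layerOffset]
  have hC0 := abs_nonneg C
  set s : ℝ := (layerOffset (layer q.1) : ℝ)
  have h0 : |(q.2 0 : ℝ) + 2 / 3 * s| < |C| := by
    have e : (mom (layer q.1) q.2).re = 2 * Real.pi * ((q.2 0 : ℝ) + 2 / 3 * s) := by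
      simp only [mom, layerShift_eq]; ring
    rw [e, abs_mul, abs_of_pos (by positivity)] at hre
    nlinarith [abs_nonneg ((q.2 0 : ℝ) + 2 / 3 * s)]
  have h1 : |(q.2 0 : ℝ) + 2 * q.2 1| < |C| := by
    have e : (mom (layer q.1) q.2).im = 2 * Real.pi / Real.sqrt 3 * ((q.2 0 : ℝ) + 2 * q.2 1) := by
      simp only [mom]; ring
    have e1 : 1 ≤ 2 * Real.pi / Real.sqrt 3 := by
      rw [le_div_iff₀ h3']; linarith
    rw [e, abs_mul, abs_of_pos (by positivity)] at him
    nlinarith [abs_nonneg ((q.2 0 : ℝ) + 2 * q.2 1)]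
  rw [abs_lt] at h0 h1
  intro j
  fin_cases j
  · constructor
    · have : (-N : ℝ) < q.2 0 := by linarith
      exact_mod_cast this.le
    · have : (q.2 0 : ℝ) < N := by linarith
      exact_mod_cast this.le
  · constructor
    · have : (-N : ℝ) < q.2 1 := by linarith
      exact_mod_cast this.le
    · have : (q.2 1 : ℝ) < N := by linarith
      exact_mod_cast this.le

/-! ### The free operator on Fourier coefficients -/

/-- The graph of the free operator: `d` is the image of `y` under the Dirac operator with
`α = lam = k = 0`. -/
def FreeGraph (y d : SqSum Mode) : Prop := ∀ q, d (modeFlip q) = symbol q * y q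

/-- The weights of the inverse of the free operator; where the symbol vanishes it is replaced by
one. -/
noncomputable def invSymbol (q : Mode) : ℂ := if symbol q = 0 then 1 else (symbol q)⁻¹

lemma tendsto_invSymbol : Tendsto invSymbol cofinite (𝓝 0) := by
  have h : Tendsto (fun q => ‖symbol q‖⁻¹) cofinite (𝓝 0) :=
    tendsto_inv_atTop_zero.comp tendsto_norm_symbol
  rw [tendsto_zero_iff_norm_tendsto_zero]
  refine h.congr' ?_
  filter_upwards [tendsto_norm_symbol.eventually_gt_atTop 0] with q hq
  rw [invSymbol, if_neg (norm_pos_iff.1 hq), norm_inv]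

lemma exists_invSymbol_bound : ∃ M : ℝ, ∀ q, ‖invSymbol q‖ ≤ M := by
  obtain ⟨M, hM⟩ := tendsto_invSymbol.norm.bddAbove_range_of_cofinite
  exact ⟨M, fun q => hM ⟨q, rfl⟩⟩

lemma invSymbol_ne_zero (q : Mode) : invSymbol q ≠ 0 := by
  unfold invSymbol
  split_ifs with h
  · exact one_ne_zero
  · exact inv_ne_zero h

lemma invSymbol_modeFlip (q : Mode) : invSymbol (modeFlip q) = conj (invSymbol q) := by
  by_cases h : symbol q = 0
  · simp [invSymbol, symbol_modeFlip, h]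
  · simp [invSymbol, symbol_modeFlip, h]

/-- The inverse of the free operator, modified on its kernel. -/
noncomputable def freeInverse : SqSum Mode →L[ℂ] SqSum Mode :=
  wperm modeFlip invSymbol exists_invSymbol_bound.choose exists_invSymbol_bound.choose_spec

lemma freeInverse_apply (x : SqSum Mode) (q : Mode) :
    freeInverse x q = invSymbol q * x (modeFlip q) := rfl

lemma isSymmetric_freeInverse :
    (freeInverse : SqSum Mode →ₗ[ℂ] SqSum Mode).IsSymmetric :=
  isSymmetric_wperm modeFlip_modeFlip invSymbol_modeFlip

lemma injective_freeInverse : Function.Injective freeInverse := by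
  refine (injective_iff_map_eq_zero _).2 fun x hx => ?_
  ext q
  have h := freeInverse_apply x (modeFlip q)
  rw [hx, modeFlip_modeFlip] at h
  exact (mul_eq_zero.1 h.symm).resolve_left (invSymbol_ne_zero _)

/-- A block exchange with weights `a` on the upper and `b` on the lower block. -/
noncomputable def blockOp (a b : ℂ) : SqSum Mode →L[ℂ] SqSum Mode :=
  wperm modeFlip (fun q => Sum.elim (fun _ => a) (fun _ => b) q.1) (max ‖a‖ ‖b‖) fun q => by
    obtain ⟨i | i, m⟩ := q
    · exact le_max_left _ _
    · exact le_max_right _ _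

lemma blockOp_apply (a b : ℂ) (x : SqSum Mode) (q : Mode) :
    blockOp a b x q = Sum.elim (fun _ => a) (fun _ => b) q.1 * x (modeFlip q) := rfl

lemma smul_blockOp_add (a b : ℂ) (x : SqSum Mode) :
    a • blockOp 1 0 x + b • blockOp 0 1 x = blockOp a b x := by
  ext ⟨i, m⟩
  rw [lp.coeFn_add, Pi.add_apply, lp.coeFn_smul, lp.coeFn_smul, Pi.smul_apply, Pi.smul_apply,
    blockOp_apply, blockOp_apply, blockOp_apply]
  cases i <;> simp

/-- The compensation for the modification of the free operator on its kernel. -/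
noncomputable def kernelSwap : SqSum Mode →L[ℂ] SqSum Mode :=
  wperm modeFlip (fun q => if symbol q = 0 then 1 else 0) 1 fun q => by split_ifs <;> simp

lemma kernelSwap_apply (x : SqSum Mode) (q : Mode) :
    kernelSwap x q = (if symbol q = 0 then 1 else 0) * x (modeFlip q) := rfl

lemma isSymmetric_neg_kernelSwap :
    ((-kernelSwap : SqSum Mode →L[ℂ] SqSum Mode) : SqSum Mode →ₗ[ℂ] SqSum Mode).IsSymmetric := by
  have h : (kernelSwap : SqSum Mode →ₗ[ℂ] SqSum Mode).IsSymmetric :=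
    isSymmetric_wperm modeFlip_modeFlip fun q => by
      by_cases h : symbol q = 0 <;> simp [symbol_modeFlip, h]
  intro x y
  have := h x y
  simp only [ContinuousLinearMap.coe_coe] at this
  change inner ℂ (-kernelSwap x) y = inner ℂ x (-kernelSwap y)
  rw [inner_neg_left, inner_neg_right, this]

/-- The graph of `freeInverse⁻¹ - kernelSwap + W` is that of the free operator plus `W`: on the
modes with vanishing symbol the two modifications cancel. -/
lemma opGraph_iff (W : SqSum Mode →L[ℂ] SqSum Mode) (u f : SqSum Mode) :
    OpGraph freeInverse (-kernelSwap + W) u f ↔ FreeGraph u (f - W u) := by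
  have key : ∀ q, u q = freeInverse (f - (-kernelSwap + W) u) q ↔
      (f - W u) (modeFlip q) = symbol q * u q := fun q => by
    have e : (f - (-kernelSwap + W) u) (modeFlip q) =
        (f - W u) (modeFlip q) + (if symbol q = 0 then 1 else 0) * u q := by
      have : f - (-kernelSwap + W) u = (f - W u) + kernelSwap u := by
        rw [add_apply, neg_apply]; abel
      rw [this, lp.coeFn_add, Pi.add_apply, kernelSwap_apply, modeFlip_modeFlip, symbol_modeFlip]
      simp
    rw [freeInverse_apply, e]
    by_cases h : symbol q = 0
    · simp [invSymbol, h]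
    · simp only [invSymbol, h, if_false, zero_mul, add_zero]
      rw [eq_inv_mul_iff_mul_eq₀ h, eq_comm]
  constructor
  · intro h q
    exact (key q).1 (congrArg (fun x : SqSum Mode => x q) h)
  · intro h
    refine lp.ext (funext fun q => (key q).2 (h q))

/-! ### The symmetry operators -/

open IsTunnelling

lemma norm_omega : ‖omega‖ = 1 := by
  have h := congrArg norm omega_pow_three
  rw [norm_pow, norm_one] at h
  exact (pow_eq_one_iff_of_nonneg (norm_nonneg _) (by norm_num)).1 h

lemma norm_rotWeight (i : Idx) : ‖rotWeight i‖ = 1 := by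
  cases i <;> simp [rotWeight, norm_omega]

lemma norm_reflWeight (i : Idx) : ‖reflWeight i‖ = 1 := by
  rcases i with a | a <;> fin_cases a <;> simp [reflWeight]

lemma reflWeight_swap (i : Idx) : reflWeight i.swap = -reflWeight i := by
  rcases i with a | a <;> fin_cases a <;> simp [reflWeight]

lemma conj_reflWeight (i : Idx) : conj (reflWeight i) = reflWeight i := by
  rcases i with a | a <;> fin_cases a <;> simp [reflWeight]

lemma rotWeight_cube (i : Idx) : rotWeight i * (rotWeight i * rotWeight i) = 1 := by
  cases i
  · simp [rotWeight]
  · simp only [rotWeight, Sum.elim_inr]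
    linear_combination (omega ^ 3 + 1) * omega_pow_three

lemma rotWeight_eq (i : Idx) :
    rotWeight i = omega ^ 2 * (rotWeight i.swap * rotWeight i.swap) := by
  cases i
  · simp only [rotWeight, Sum.swap_inl, Sum.elim_inl, Sum.elim_inr]
    linear_combination -(omega ^ 3 + 1) * omega_pow_three
  · simp [rotWeight]

/-- The rotation by the angle `2π/3`. -/
noncomputable def rotation : SqSum Mode →L[ℂ] SqSum Mode :=
  wperm modeRot (fun q => rotWeight q.1) 1 fun q => (norm_rotWeight q.1).le

/-- The complex conjugation of the position, combined with an exchange of the sublattices. -/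
noncomputable def reflection : SqSum Mode →L[ℂ] SqSum Mode :=
  wperm modeRefl (fun q => reflWeight q.1) 1 fun q => (norm_reflWeight q.1).le

lemma rotation_apply (x : SqSum Mode) (q : Mode) :
    rotation x q = rotWeight q.1 * x (modeRot q) := rfl

lemma reflection_apply (x : SqSum Mode) (q : Mode) :
    reflection x q = reflWeight q.1 * x (modeRefl q) := rfl

lemma FreeGraph.rotation {y d : SqSum Mode} (h : FreeGraph y d) :
    FreeGraph (rotation y) (rotation d) := fun q => by
  rw [rotation_apply, rotation_apply, modeRot_modeFlip, h]
  change rotWeight q.1.swap * _ = _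
  rw [← mul_assoc, symbol_modeRot]
  ring

lemma FreeGraph.reflection {y d : SqSum Mode} (h : FreeGraph y d) :
    FreeGraph (reflection y) (-reflection d) := fun q => by
  rw [lp.coeFn_neg, Pi.neg_apply, reflection_apply, reflection_apply, modeRefl_modeFlip, h,
    symbol_modeRefl]
  change -(reflWeight q.1.swap * _) = _
  rw [reflWeight_swap]
  ring

lemma pairing_omega_mul (p z : ℂ) : pairing (omega * p) (omega * z) = pairing p z := by
  have h : omega * conj omega = 1 := by rw [conj_omega, ← pow_succ', omega_pow_three]
  rw [pairing, pairing, map_mul]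
  congr 1
  linear_combination p * conj z * h

lemma pairing_conj (p z : ℂ) : pairing (conj p) (conj z) = pairing p z := by
  simp [pairing_eq]

variable {U V : ℂ → ℂ}

lemma op_rotation (h : IsTunnelling U V) (α lam : ℝ) (x : SqSum Mode) :
    (h.isBlochPotential α lam).op (rotation x) = rotation ((h.isBlochPotential α lam).op x) := by
  have := (h.isBlochPotential α lam).op_wperm descendsToTorus_omega (s := modeRot)
    (c := fun q => rotWeight q.1) (M := 1) (hc := fun q => (norm_rotWeight q.1).le) (θ := id)
    (r := rotWeight) (fun _ => rfl) (fun _ => rfl)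
    (fun q z => by rw [modeRot_apply, mom_rotMode, pairing_omega_mul])
    (ε := 1) (fun z i j => h.rotate α lam z i j) x
  rwa [one_smul] at this

lemma op_reflection (h : IsTunnelling U V) (α lam : ℝ) (x : SqSum Mode) :
    (h.isBlochPotential α lam).op (reflection x) =
      -reflection ((h.isBlochPotential α lam).op x) := by
  have := (h.isBlochPotential α lam).op_wperm descendsToTorus_conj (s := modeRefl)
    (c := fun q => reflWeight q.1) (M := 1) (hc := fun q => (norm_reflWeight q.1).le)
    (θ := Sum.swap) (r := reflWeight) (fun _ => rfl) (fun _ => rfl)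
    (fun q z => by rw [modeRefl_apply, layer_swap, mom_conjMode, pairing_conj])
    (ε := -1) (fun z i j => h.reflect α lam z i j) x
  rwa [neg_one_smul] at this

lemma inner_rotation (x y : SqSum Mode) : inner ℂ (rotation x) (rotation y) = inner ℂ x y := by
  unfold rotation
  exact inner_wperm_wperm (c := fun q : Mode => rotWeight q.1) (fun q => norm_rotWeight q.1) x y

lemma norm_reflection (x : SqSum Mode) : ‖reflection x‖ = ‖x‖ := by
  have h : inner ℂ (reflection x) (reflection x) = inner ℂ x x := by
    unfold reflection
    exact inner_wperm_wperm (c := fun q : Mode => reflWeight q.1)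
      (fun q => norm_reflWeight q.1) x x
  rw [inner_self_eq_norm_sq_to_K, inner_self_eq_norm_sq_to_K] at h
  exact (sq_eq_sq₀ (norm_nonneg _) (norm_nonneg _)).1 (by exact_mod_cast h)

lemma symm_blockOp_reflection (x y : SqSum Mode) :
    inner ℂ (blockOp 1 0 (reflection x)) y = inner ℂ x (blockOp 1 0 (reflection y)) := by
  let s : Mode ≃ Mode := (Equiv.refl Idx).prodCongr conjMode
  let c : Mode → ℂ := fun q => Sum.elim (fun _ => 1) (fun _ => 0) q.1 * reflWeight q.1.swap
  have hc : ∀ q, ‖c q‖ ≤ 1 := fun q => by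
    simp only [c, norm_mul, norm_reflWeight, mul_one]
    cases q.1 <;> simp
  have e : ∀ x, blockOp 1 0 (reflection x) = wperm s c 1 hc x := fun x => by
    ext ⟨i, m⟩
    rw [blockOp_apply, reflection_apply, wperm_apply, ← mul_assoc]
    change _ * x (i.swap.swap, conjMode m) = _ * x (i, conjMode m)
    rw [Sum.swap_swap]
    rfl
  have hs : ∀ q, s (s q) = q := fun q => Prod.ext rfl (conjMode.left_inv q.2)
  have hcs : ∀ q, c (s q) = conj (c q) := fun q => by
    change c q = _
    simp only [c, map_mul, conj_reflWeight]
    cases q.1 <;> simp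
  have h := isSymmetric_wperm (hc := hc) hs hcs x y
  simp only [ContinuousLinearMap.coe_coe] at h
  rw [e, e, h]

/-- The moire Dirac operator on Fourier coefficients. -/
noncomputable def moireFamily (h : IsTunnelling U V) : HoneycombFamily (SqSum Mode) where
  G := freeInverse
  B₀ := -kernelSwap
  W₁ := (h.isBlochPotential 1 0).op
  W₂ := (h.isBlochPotential 0 1).op
  R := rotation
  Q := reflection
  J := blockOp 1 0
  J' := blockOp 0 1
  compact_G := isCompactOperator_wperm tendsto_invSymbol
  symm_G := isSymmetric_freeInverse
  injective_G := injective_freeInverse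
  symm_B₀ := isSymmetric_neg_kernelSwap
  symm_W₁ := (h.isBlochPotential 1 0).isSymmetric_op (isHermitian U V 1 0)
  symm_W₂ := (h.isBlochPotential 0 1).isSymmetric_op (isHermitian U V 0 1)
  inner_R := inner_rotation
  R_cube x := by
    ext q
    simp only [rotation_apply]
    rw [modeRot_cube]
    change rotWeight q.1 * (rotWeight q.1 * (rotWeight q.1 * x q)) = _
    linear_combination x q * rotWeight_cube q.1
  norm_Q := norm_reflection
  R_J x := by
    ext ⟨i, m⟩
    rw [lp.coeFn_smul, Pi.smul_apply, rotation_apply, blockOp_apply, blockOp_apply, rotation_apply,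
      ← modeRot_modeFlip, smul_eq_mul]
    cases i
    · simp only [rotWeight, modeRot_apply, modeFlip_apply, Sum.elim_inl, Sum.swap_inl, Sum.elim_inr]
      linear_combination -(x (Sum.inr _, _)) * omega_pow_three
    · simp [modeRot_apply]
  R_Q x := by
    ext ⟨i, m⟩
    rw [lp.coeFn_smul, Pi.smul_apply, rotation_apply, reflection_apply, reflection_apply,
      rotation_apply, rotation_apply, modeRefl_modeRot, smul_eq_mul]
    change rotWeight i * (reflWeight i * _) =
      omega ^ 2 * (reflWeight i * (rotWeight i.swap * (rotWeight i.swap * _)))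
    rw [rotWeight_eq]
    ring
  symm_JQ := symm_blockOp_reflection
  inner_J x y := inner_wperm modeFlip_modeFlip (fun q => by
    obtain ⟨i | i, m⟩ := q <;> simp [modeFlip_apply]) x y
  norm_T k x := by
    rw [smul_blockOp_add]
    refine (ContinuousLinearMap.le_opNorm _ x).trans ?_
    gcongr
    refine (norm_wperm_le (by positivity)).trans ?_
    simp
  graph_R p u f hu := by
    rw [opGraph_iff] at *
    have := hu.rotation
    rwa [map_sub, add_apply, smul_apply, smul_apply, map_add, map_smul, map_smul, ← op_rotation h,
      ← op_rotation h, ← smul_apply, ← smul_apply, ← add_apply] at this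
  graph_Q p u f hu := by
    rw [opGraph_iff] at *
    have := hu.reflection
    have e : -reflection (f - ((p.1 : ℂ) • (h.isBlochPotential 1 0).op +
        (p.2 : ℂ) • (h.isBlochPotential 0 1).op) u) = -reflection f -
        ((p.1 : ℂ) • (h.isBlochPotential 1 0).op +
        (p.2 : ℂ) • (h.isBlochPotential 0 1).op) (reflection u) := by
      rw [map_sub, add_apply, smul_apply, smul_apply, map_add, map_smul, map_smul, add_apply,
        smul_apply, smul_apply, op_reflection h, op_reflection h]
      module
    rwa [e] at this

/-! ### The Hamiltonian on Fourier coefficients -/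

/-- The sign of the second derivative in the two blocks. -/
def blockSign : Idx → ℂ := Sum.elim (fun _ => 1) fun _ => -1

lemma symbol_eq (q : Mode) : symbol q =
    (mom (layer q.1) q.2).re + blockSign q.1 * Complex.I * (mom (layer q.1) q.2).im := by
  obtain ⟨i | i, m⟩ := q
  · simp only [symbol, blockSign, layer, Sum.elim_inl, one_mul, id]
    rw [mul_comm Complex.I, Complex.re_add_im]
  · simp only [symbol, blockSign, layer, Sum.elim_inr, id]
    apply Complex.ext <;> simp

lemma firstOrder_swap (p q : Idx → ℂ) (i : Idx) :
    firstOrder p q i.swap = -Complex.I * (p i + blockSign i * Complex.I * q i) := by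
  rcases i with i | i
  · simp [firstOrder, blockSign, Matrix.fromBlocks_mulVec]
    ring
  · simp [firstOrder, blockSign, Matrix.fromBlocks_mulVec]
    ring

/-- A weak solution of the free equation solves it on the level of Fourier coefficients. -/
lemma freeGraph_of_weak {y d : SqSum Mode} {ux uy : Spinor}
    (hx : ∀ i, IsL2Loc (ux i) ∧ IsL2Loc (uy i) ∧ IsWeakDeriv 1 (synth y i) (ux i) ∧
      IsWeakDeriv Complex.I (synth y i) (uy i))
    (hd : ∀ᵐ z : ℂ, (fun i => synth d i z) = firstOrder (fun i => ux i z) fun i => uy i z) :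
    FreeGraph y d := by
  rintro ⟨i, m⟩
  obtain ⟨hx1, hy1, hx2, hy2⟩ := hx i
  have key := coeff_eq_of_weak (l := layer i) (integrable_Lp (component i.swap d))
    (integrable_Lp (component i y)) (c₁ := Complex.I) (c₂ := -blockSign i) (fun φ hφ hc => ?_) m
  · rw [← torusBasis_repr, ← torusBasis_repr, repr_component, repr_component] at key
    rw [symbol_eq]
    change d (i.swap, m) = _
    rw [key]
    linear_combination -((mom (layer i) m).re : ℂ) * y (i, m) * Complex.I_sq
  · have hs := memL20_synth y
    have hφ1 := continuous_fderiv_apply hφ 1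
    have hφ2 := continuous_fderiv_apply hφ Complex.I
    have e1 : ∫ z, gauge (layer i) z * component i.swap d (proj z) * φ z =
        ∫ z, (-Complex.I * (ux i z * φ z) + blockSign i * (uy i z * φ z)) := by
      refine integral_congr_ae ?_
      filter_upwards [hd, coe_synth d i.swap] with z h1 h2
      have h3 := congrFun h1 i.swap
      rw [firstOrder_swap] at h3
      rw [layer_swap] at h2
      rw [← h2, h3]
      linear_combination -blockSign i * uy i z * φ z * Complex.I_sq
    have e2 : ∫ z, gauge (layer i) z * component i y (proj z) *
          (Complex.I * fderiv ℝ φ z 1 + -blockSign i * fderiv ℝ φ z Complex.I) =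
        ∫ z, (Complex.I * (synth y i z * fderiv ℝ φ z 1) +
          -blockSign i * (synth y i z * fderiv ℝ φ z Complex.I)) := by
      refine integral_congr_ae ?_
      filter_upwards [coe_synth y i] with z h1
      rw [← h1]
      ring
    rw [e1, e2, integral_add ((hx1.integrable_mul hφ.continuous hc).const_mul _)
      ((hy1.integrable_mul hφ.continuous hc).const_mul _),
      integral_add (((hs.1 i).integrable_mul hφ1 (hc.fderiv_apply ℝ 1)).const_mul _)
      (((hs.1 i).integrable_mul hφ2 (hc.fderiv_apply ℝ Complex.I)).const_mul _),
      integral_const_mul, integral_const_mul, integral_const_mul, integral_const_mul,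
      hx2 φ hφ hc, hy2 φ hφ hc]
    ring

lemma norm_pairing_le (p a : ℂ) : ‖((pairing p a : ℝ) : ℂ)‖ ≤ ‖p‖ * ‖a‖ := by
  rw [Complex.norm_real, Real.norm_eq_abs, pairing]
  refine (Complex.abs_re_le_norm _).trans_eq ?_
  rw [norm_mul, RCLike.norm_conj]

/-- Elements of the domain of the free operator have square integrable weak derivatives. -/
lemma FreeGraph.exists_deriv {y d : SqSum Mode} (h : FreeGraph y d) (a : ℂ) :
    ∃ x : SqSum Mode, (∀ q, x q = Complex.I * (pairing (mom (layer q.1) q.2) a : ℝ) * y q) ∧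
      ∀ i, IsWeakDeriv a (synth y i) (synth x i) := by
  have hs : Summable fun q : Mode =>
      ‖Complex.I * (pairing (mom (layer q.1) q.2) a : ℝ) * y q‖ ^ 2 := by
    refine Summable.of_nonneg_of_le (fun q => sq_nonneg _) (fun q => ?_)
      (((modeFlip.summable_iff (f := fun q => ‖d q‖ ^ 2)).2 (summable_norm_sq d)).mul_left
        (‖a‖ ^ 2))
    have h1 : ‖d (modeFlip q)‖ = ‖mom (layer q.1) q.2‖ * ‖y q‖ := by
      rw [h q, norm_mul, norm_symbol]
    simp only [Function.comp_apply]
    rw [h1, ← mul_pow, norm_mul, norm_mul, Complex.norm_I, one_mul]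
    have := norm_pairing_le (mom (layer q.1) q.2) a
    refine pow_le_pow_left₀ (by positivity) ?_ 2
    calc _ ≤ ‖mom (layer q.1) q.2‖ * ‖a‖ * ‖y q‖ := by gcongr
      _ = _ := by ring
  refine ⟨⟨fun q => _, memℓp_of_summable hs⟩, fun q => rfl, fun i φ hφ hc => ?_⟩
  set x : SqSum Mode := ⟨fun q => _, memℓp_of_summable hs⟩
  have key := weak_of_coeff (l := layer i) (v := component i y) (d := component i x) (a := a)
    (fun m => by rw [repr_component, repr_component]) hφ hc
  have e1 : ∫ z, synth y i z * fderiv ℝ φ z a =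
      ∫ z, gauge (layer i) z * component i y (proj z) * fderiv ℝ φ z a := by
    refine integral_congr_ae ?_
    filter_upwards [coe_synth y i] with z hz
    rw [hz]
  have e2 : ∫ z, synth x i z * φ z = ∫ z, gauge (layer i) z * component i x (proj z) * φ z := by
    refine integral_congr_ae ?_
    filter_upwards [coe_synth x i] with z hz
    rw [hz]
  rw [e1, e2, key]

lemma coe_synth_add (x y : SqSum Mode) (i : Idx) :
    ∀ᵐ z : ℂ, synth (x + y) i z = synth x i z + synth y i z := by
  rw [map_add]
  exact AEEqFun.coeFn_add (synth x i) (synth y i)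

lemma coe_synth_sub (x y : SqSum Mode) (i : Idx) :
    ∀ᵐ z : ℂ, synth (x - y) i z = synth x i z - synth y i z := by
  rw [map_sub]
  exact AEEqFun.coeFn_sub (synth x i) (synth y i)

lemma coe_synth_smul (c : ℂ) (x : SqSum Mode) (i : Idx) :
    ∀ᵐ z : ℂ, synth (c • x) i z = c * synth x i z := by
  rw [map_smul]
  exact AEEqFun.coeFn_smul c (synth x i)

/-- The first order part of the Hamiltonian is the free operator. -/
lemma FreeGraph.firstOrder_eq {y d x x' : SqSum Mode} (h : FreeGraph y d)
    (hx : ∀ q, x q = Complex.I * (pairing (mom (layer q.1) q.2) 1 : ℝ) * y q)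
    (hx' : ∀ q, x' q = Complex.I * (pairing (mom (layer q.1) q.2) Complex.I : ℝ) * y q) :
    ∀ᵐ z : ℂ, (fun i => synth d i z) =
      firstOrder (fun i => synth x i z) fun i => synth x' i z := by
  have e : ∀ i, component i.swap d =
      -Complex.I • (component i x + (blockSign i * Complex.I) • component i x') := fun i => by
    refine torusBasis.repr.injective ?_
    ext m
    simp only [map_smul, map_add, lp.coeFn_smul, lp.coeFn_add, Pi.smul_apply, Pi.add_apply,
      repr_component, smul_eq_mul]
    have h1 := h (i, m)
    rw [modeFlip_apply] at h1
    simp only at h1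
    rw [h1, hx, hx', symbol_eq]
    simp only [pairing_eq, Complex.one_re, Complex.one_im, Complex.I_re, Complex.I_im, mul_one,
      mul_zero, add_zero, zero_add]
    linear_combination (((mom (layer i) m).re : ℂ) + blockSign i * Complex.I *
      (mom (layer i) m).im) * y (i, m) * Complex.I_sq
  have e' : ∀ i, ∀ᵐ z : ℂ, synth d i.swap z =
      -Complex.I * (synth x i z + blockSign i * Complex.I * synth x' i z) := fun i => by
    have h1 : synth d i.swap =
        -Complex.I • (synth x i + (blockSign i * Complex.I) • synth x' i) := by
      rw [synth_apply, layer_swap, e, map_smul, map_add, map_smul]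
      rfl
    rw [h1]
    filter_upwards [AEEqFun.coeFn_smul (-Complex.I)
      (synth x i + (blockSign i * Complex.I) • synth x' i),
      AEEqFun.coeFn_add (synth x i) ((blockSign i * Complex.I) • synth x' i),
      AEEqFun.coeFn_smul (blockSign i * Complex.I) (synth x' i)] with z h2 h3 h4
    rw [h2, Pi.smul_apply, h3, Pi.add_apply, h4, Pi.smul_apply, smul_eq_mul, smul_eq_mul]
  filter_upwards [ae_all_iff.2 e'] with z hz
  funext i
  have h1 := hz i.swap
  have h2 := firstOrder_swap (fun i => synth x i z) (fun i => synth x' i z) i.swap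
  rw [Sum.swap_swap] at h1 h2
  rw [h1, h2]

lemma synth_blockOp (a b : ℂ) (y : SqSum Mode) (i : Idx) :
    synth (blockOp a b y) i = Sum.elim (fun _ => a) (fun _ => b) i • synth y i.swap := by
  rw [synth_apply, synth_apply, layer_swap, ← map_smul]
  congr 1
  refine torusBasis.repr.injective ?_
  ext m
  rw [map_smul, lp.coeFn_smul, Pi.smul_apply, repr_component, repr_component, blockOp_apply]
  rfl

lemma zerothOrder_mulVec (α lam : ℝ) (k z : ℂ) (v : Idx → ℂ) (i : Idx) :
    (zerothOrder U V α lam k z *ᵥ v) i =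
      α * ∑ j, zerothOrder U V 1 0 0 z i j * v j + lam * ∑ j, zerothOrder U V 0 1 0 z i j * v j +
        Sum.elim (fun _ => conj k) (fun _ => k) i * v i.swap := by
  rcases i with i | i <;> fin_cases i <;>
    simp [zerothOrder, matU, matC, Matrix.fromBlocks, Matrix.mulVec, dotProduct] <;> ring

/-- The bounded part of the Bloch Hamiltonian. -/
noncomputable def boundedPart (h : IsTunnelling U V) (p : ℝ × ℝ) (k : ℂ) :
    SqSum Mode →L[ℂ] SqSum Mode :=
  (p.1 : ℂ) • (h.isBlochPotential 1 0).op + (p.2 : ℂ) • (h.isBlochPotential 0 1).op +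
    (moireFamily h).T k

lemma B_add_T (h : IsTunnelling U V) (p : ℝ × ℝ) (k : ℂ) :
    (moireFamily h).B p + (moireFamily h).T k = -kernelSwap + boundedPart h p k :=
  add_assoc _ _ _

/-- In position space the bounded part is the zeroth order part of the Hamiltonian. -/
lemma synth_boundedPart (h : IsTunnelling U V) (p : ℝ × ℝ) (k : ℂ) (y : SqSum Mode) :
    ∀ᵐ z : ℂ, (fun i => synth (boundedPart h p k y) i z) =
      zerothOrder U V p.1 p.2 k z *ᵥ fun i => synth y i z := by
  have e : boundedPart h p k y = (p.1 : ℂ) • (h.isBlochPotential 1 0).op y +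
      (p.2 : ℂ) • (h.isBlochPotential 0 1).op y + blockOp (conj k) k y := by
    rw [← smul_blockOp_add]
    rfl
  have main : ∀ i, ∀ᵐ z : ℂ, synth (boundedPart h p k y) i z =
      (zerothOrder U V p.1 p.2 k z *ᵥ fun i => synth y i z) i := fun i => by
    rw [e]
    have hb : ∀ᵐ z : ℂ, synth (blockOp (conj k) k y) i z =
        Sum.elim (fun _ => conj k) (fun _ => k) i * synth y i.swap z := by
      rw [synth_blockOp]
      exact AEEqFun.coeFn_smul _ (synth y i.swap)
    filter_upwards [coe_synth_add ((p.1 : ℂ) • (h.isBlochPotential 1 0).op y +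
        (p.2 : ℂ) • (h.isBlochPotential 0 1).op y) (blockOp (conj k) k y) i,
      coe_synth_add ((p.1 : ℂ) • (h.isBlochPotential 1 0).op y)
        ((p.2 : ℂ) • (h.isBlochPotential 0 1).op y) i,
      coe_synth_smul (p.1 : ℂ) ((h.isBlochPotential 1 0).op y) i,
      coe_synth_smul (p.2 : ℂ) ((h.isBlochPotential 0 1).op y) i,
      (h.isBlochPotential 1 0).synth_op y i, (h.isBlochPotential 0 1).synth_op y i, hb]
      with z h1 h2 h3 h4 h5 h6 h7
    rw [h1, h2, h3, h4, h5, h6, h7, zerothOrder_mulVec]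
  filter_upwards [ae_all_iff.2 main] with z hz
  exact funext hz

lemma isImage_synth_iff (h : IsTunnelling U V) (p : ℝ × ℝ) (k : ℂ) (y w : SqSum Mode) :
    IsImage U V p.1 p.2 k (synth y) (synth w) ↔ FreeGraph y (w - boundedPart h p k y) := by
  have hsub := ae_all_iff.2 fun i => coe_synth_sub w (boundedPart h p k y) i
  constructor
  · rintro ⟨-, ux, uy, hd, he⟩
    refine freeGraph_of_weak hd ?_
    filter_upwards [he, hsub, synth_boundedPart h p k y] with z h1 h2 h3
    have h4 : (fun i => synth (w - boundedPart h p k y) i z) =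
        (fun i => synth w i z) - fun i => synth (boundedPart h p k y) i z := funext h2
    rw [h4, h1, h3, add_sub_cancel_right]
  · intro hf
    obtain ⟨x, hx, hx1⟩ := hf.exists_deriv 1
    obtain ⟨x', hx', hx1'⟩ := hf.exists_deriv Complex.I
    refine ⟨memL20_synth y, synth x, synth x', fun i => ⟨(memL20_synth x).1 i,
      (memL20_synth x').1 i, hx1 i, hx1' i⟩, ?_⟩
    filter_upwards [hf.firstOrder_eq hx hx', hsub, synth_boundedPart h p k y] with z h1 h2 h3
    rw [← h1, ← h3]
    funext i
    simp only [Pi.add_apply, h2 i, sub_add_cancel]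

lemma eigenspace_eq_map (h : IsTunnelling U V) (p : ℝ × ℝ) (k : ℂ) (x : ℝ) :
    eigenspace U V p.1 p.2 k x =
      (opEigenspace (moireFamily h).G ((moireFamily h).B p + (moireFamily h).T k) x).map synth := by
  have key : ∀ y, IsImage U V p.1 p.2 k (synth y) ((x : ℂ) • synth y) ↔
      y ∈ opEigenspace (moireFamily h).G ((moireFamily h).B p + (moireFamily h).T k) x :=
    fun y => by
      rw [mem_opEigenspace, B_add_T, ← map_smul]
      exact (isImage_synth_iff h p k y _).trans (opGraph_iff _ _ _).symm
  ext u
  rw [Submodule.mem_map]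
  constructor
  · intro hu
    obtain ⟨y, rfl⟩ := exists_synth_eq (u := u) hu.1
    exact ⟨y, (key y).1 hu, rfl⟩
  · rintro ⟨y, hy, rfl⟩
    exact (key y).2 hy

lemma rank_eigenspace (h : IsTunnelling U V) (p : ℝ × ℝ) (k : ℂ) (x : ℝ) :
    Module.rank ℂ (eigenspace U V p.1 p.2 k x) = Module.rank ℂ
      (opEigenspace (moireFamily h).G ((moireFamily h).B p + (moireFamily h).T k) x) := by
  rw [eigenspace_eq_map h]
  exact (LinearEquiv.rank_eq (Submodule.equivMapOfInjective synth injective_synth _)).symm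

lemma finrank_K (h : IsTunnelling U V) (p : ℝ × ℝ) :
    Module.finrank ℂ ((moireFamily h).K p) = Module.finrank ℂ (eigenspace U V p.1 p.2 0 0) := by
  have hT : (moireFamily h).B p + (moireFamily h).T 0 = (moireFamily h).B p := by
    ext1 y
    rw [add_apply, HoneycombFamily.T_apply]
    simp
  have := rank_eigenspace h p 0 0
  rw [hT] at this
  exact (congrArg Cardinal.toNat this).symm

/-! ### Positive and negative eigenvalues of the free operator -/

/-- The normalized combination of the modes `q` and `modeFlip q` with relative phase `c`. -/
noncomputable def modePair (q : Mode) (c : ℂ) : SqSum Mode :=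
  ((Real.sqrt 2)⁻¹ : ℂ) • (lp.single (E := fun _ : Mode => ℂ) 2 q 1 +
    c • lp.single (E := fun _ : Mode => ℂ) 2 (modeFlip q) 1)

lemma modePair_apply (q : Mode) (c : ℂ) (r : Mode) : modePair q c r =
    ((Real.sqrt 2)⁻¹ : ℂ) * ((if r = q then 1 else 0) + c * if r = modeFlip q then 1 else 0) := by
  rw [modePair, lp.coeFn_smul, Pi.smul_apply, lp.coeFn_add, Pi.add_apply, lp.coeFn_smul,
    Pi.smul_apply, lp_single_apply, lp_single_apply, smul_eq_mul, smul_eq_mul]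

lemma inner_modePair (q : Mode) (c : ℂ) (x : SqSum Mode) : inner ℂ (modePair q c) x =
    ((Real.sqrt 2)⁻¹ : ℂ) * (x q + conj c * x (modeFlip q)) := by
  rw [modePair, inner_smul_left, inner_add_left, inner_smul_left, lp.inner_single_left,
    lp.inner_single_left]
  simp

lemma freeInverse_modePair (q : Mode) {c : ℂ} (hc : ‖c‖ = 1) {τ : ℝ}
    (h : invSymbol q * c = τ) (hq : modeFlip q ≠ q) :
    freeInverse (modePair q c) = (τ : ℂ) • modePair q c := by
  have hcc : c * conj c = 1 := by
    rw [Complex.mul_conj, Complex.normSq_eq_norm_sq, hc]; norm_num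
  have h' := congrArg conj h
  rw [map_mul, Complex.conj_ofReal, ← invSymbol_modeFlip] at h'
  ext r
  rw [freeInverse_apply, lp.coeFn_smul, Pi.smul_apply, modePair_apply, modePair_apply, smul_eq_mul]
  by_cases h1 : r = q
  · subst h1
    simp only [hq, hq.symm, if_true, if_false]
    linear_combination ((Real.sqrt 2)⁻¹ : ℂ) * h
  · by_cases h2 : r = modeFlip q
    · subst h2
      rw [modeFlip_modeFlip]
      simp only [hq, hq.symm, if_true, if_false]
      linear_combination ((Real.sqrt 2)⁻¹ : ℂ) * c * h' -
        ((Real.sqrt 2)⁻¹ : ℂ) * invSymbol (modeFlip q) * hcc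
    · have h3 : modeFlip r ≠ q := fun h => h2 (by rw [← h, modeFlip_modeFlip])
      have h4 : modeFlip r ≠ modeFlip q := fun h => h1 (modeFlip.injective h)
      simp [h1, h2, h3, h4]

/-- For both signs the free operator has infinitely many orthonormal eigenvectors. -/
lemma exists_orthonormal_eigenvectors {ε : ℝ} (hε : |ε| = 1) :
    ∃ (v : ℕ → SqSum Mode) (τ : ℕ → ℝ), Orthonormal ℂ v ∧ (∀ n, 0 < τ n) ∧
      ∀ n, freeInverse (v n) = ((ε * τ n : ℝ) : ℂ) • v n := by
  -- the phase of `c` makes the eigenvalue `invSymbol q * (ε * c)` real with the sign of `ε`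
  let q : ℕ → Mode := fun n => (Sum.inl 0, fun _ => n)
  have hq : ∀ n, modeFlip (q n) ≠ q n := fun n h => by
    have := congrArg Prod.fst h
    simp [q, modeFlip_apply] at this
  have hinj : ∀ {m n}, q m = q n → m = n := fun h => by
    have := congrFun (congrArg Prod.snd h) 0
    simpa [q] using this
  have hqf : ∀ m n, q m ≠ modeFlip (q n) := fun m n h => by
    have := congrArg Prod.fst h
    simp [q, modeFlip_apply] at this
  choose c hc1 hc2 using fun n => HoneycombFamily.exists_norm_one_mul_eq (invSymbol (q n))
  have hεc : ∀ n, ‖(ε : ℂ) * c n‖ = 1 := fun n => by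
    rw [norm_mul, hc1, mul_one, Complex.norm_real, Real.norm_eq_abs, hε]
  have h2 : ((Real.sqrt 2)⁻¹ : ℂ) * ((Real.sqrt 2)⁻¹ : ℂ) * 2 = 1 := by
    have : Real.sqrt 2 * Real.sqrt 2 = 2 := Real.mul_self_sqrt (by norm_num)
    have h3 : (Real.sqrt 2 : ℂ) * Real.sqrt 2 = 2 := by exact_mod_cast this
    have h4 : (Real.sqrt 2 : ℂ) ≠ 0 := by
      have : Real.sqrt 2 ≠ 0 := by positivity
      exact_mod_cast this
    field_simp
    rw [sq, h3]
  refine ⟨fun n => modePair (q n) (ε * c n), fun n => ‖invSymbol (q n)‖, ?_,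
    fun n => norm_pos_iff.2 (invSymbol_ne_zero _), fun n => ?_⟩
  · rw [orthonormal_iff_ite]
    intro m n
    rw [inner_modePair, modePair_apply, modePair_apply]
    by_cases hmn : m = n
    · subst hmn
      have hcc : (ε : ℂ) * c m * conj ((ε : ℂ) * c m) = 1 := by
        rw [Complex.mul_conj, Complex.normSq_eq_norm_sq, hεc]; norm_num
      simp only [hq m, (hq m).symm, if_true, if_false]
      linear_combination h2 + ((Real.sqrt 2)⁻¹ : ℂ) * ((Real.sqrt 2)⁻¹ : ℂ) * hcc
    · have h3 : q m ≠ q n := fun h => hmn (hinj h)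
      have h4 : modeFlip (q m) ≠ modeFlip (q n) := fun h => h3 (modeFlip.injective h)
      simp [h3, h4, hmn, hqf m n, (hqf n m).symm]
  · refine freeInverse_modePair (q n) (hεc n) ?_ (hq n)
    rw [Complex.ofReal_mul, ← hc2]
    ring

end TBG

theorem mainTheorem8 (U V : ℂ → ℂ) (hUV : TBG.IsTunnelling U V)
    (Ω : Set (ℝ × ℝ)) (hΩ : IsOpen Ω)
    (hdim : ∀ p ∈ Ω, Module.finrank ℂ (TBG.eigenspace U V p.1 p.2 0 0) = 2) :
    ∃ vF : ℝ × ℝ → ℝ, AnalyticOnNhd ℝ vF Ω ∧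
      ∀ p ∈ Ω,
        (∃ E : ℤ → ℂ → ℝ, TBG.IsBlochBands U V p.1 p.2 E) ∧
        ∀ E : ℤ → ℂ → ℝ, TBG.IsBlochBands U V p.1 p.2 E →
          (fun k : ℂ => E 1 k - |vF p| * ‖k‖) =O[𝓝 0] (fun k : ℂ => ‖k‖ ^ 2) ∧
          (fun k : ℂ => E (-1) k - (-(|vF p| * ‖k‖))) =O[𝓝 0] (fun k : ℂ => ‖k‖ ^ 2) ∧
          (vF p ≠ 0 → TBG.IsConicSingularity (E 1) (E (-1)) |vF p|) := by
  have hK : ∀ p ∈ Ω, Module.finrank ℂ ((TBG.moireFamily hUV).K p) = 2 := fun p hp =>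
    (TBG.finrank_K hUV p).trans (hdim p hp)
  refine ⟨(TBG.moireFamily hUV).vF, TBG.HoneycombFamily.analyticOnNhd_vF hΩ hK, fun p hp => ?_⟩
  have hrank := TBG.rank_eigenspace hUV p
  obtain ⟨v, τ, hv, hτ, hGv⟩ := TBG.exists_orthonormal_eigenvectors (ε := 1) (by norm_num)
  obtain ⟨w, σ, hw, hσ, hGw⟩ := TBG.exists_orthonormal_eigenvectors (ε := -1) (by norm_num)
  refine ⟨TBG.HoneycombFamily.exists_isBlochBands (hK p hp) hrank hv hw (τ := fun n => 1 * τ n)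
    (σ := fun n => -1 * σ n) (fun n => by simpa using hτ n) (fun n => by simpa using hσ n)
    hGv hGw, fun E hE => ?_⟩
  obtain ⟨h1, h2⟩ := TBG.HoneycombFamily.cone_of_isBlochBands (hK p hp) hrank hE
  exact ⟨h1, h2, fun h0 => TBG.isConicSingularity hE (abs_pos.2 h0) h1 h2⟩
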